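/- **Setting.** For each sample size $n$ consider the Gaussian simultaneous equation model $$y_{1i}=y_{2i}\alpha_1+w_i'\alpha_2+\zeta_i,\qquad y_{2i}=f(z_i)+v_i,\qquad i=1,\dots,n,$$ with fixed instruments $z_i=(u_i',w_i')'$, $w_i\in\mathbb R^{k_w}$, and disturbances $(\zeta_i,v_i)$, $i=1,\dots,n$, that are i.i.d. bivariate normal with mean zero, variances $\sigma_\zeta^2,\sigma_v^2$ and covariance $\sigma_{\zeta v}$. All quantities except $k_w$ may depend on $n$. Let $x_i=P(z_i)\in\mathbb R^{p}$, $p=p_n$, be a dictionary of technical instruments. Write $\mathbb E_n[g_i]=n^{-1}\sum_{i=1}^n g_i$, $\alpha=(\alpha_1,\alpha_2')'$, $A_i=(f(z_i),w_i')'$, $d_i=(y_{2i},w_i')'$, $Q_n=\mathbb E_n[A_iA_i']$; $\|b\|_0$ is the number of nonzero components of $b$. **Condition ASIV** (asymptotic conditions are required for all large $n$). (i) $\sigma_v$, $\sigma_\zeta$ and the eigenvalues of $Q_n$ are bounded away from zero and from above uniformly in $n$. (ii) $\mathbb E_n[x_{ij}^2]=1$ for all $j$, and there are $\beta_0\in\mathbb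 R^p$ (depending on $n$) and a constant $K$ independent of $n$ with $\|\beta_0\|_0\le s=s_n$ and $\{\mathbb E_n[(f(z_i)-x_i'\beta_0)^2]\}^{1/2}\le K\sigma_v\sqrt{s/n}$. (iii) There are $\ell_n\to\infty$ and constants $0<\kappa'<\kappa''<\infty$ with $$\kappa'\le \min_{\delta\ne0,\ \|\delta\|_0\le \ell_n s}\frac{\delta'\mathbb E_n[x_ix_i']\delta}{\|\delta\|^2}\le\max_{\delta\ne0,\ \|\delta\|_0\le \ell_n s}\frac{\delta'\mathbb E_n[x_ix_i']\delta}{\|\delta\|^2}\le\kappa''.$$ (iv) $s^2\log^2(p\vee n)=o(n)$. **First stage.** Fix $c>1$ and $\gamma=\gamma_n\in(0,1)$ with $\gamma=o(1)$ and $\log(1/\gamma)\lesssim\log(p\vee n)$. Let $\widehat Q(b)=\mathbb E_n[(y_{2i}-x_i'b)^2]$, let $\Phi^{-1}$ be the standard normal quantile function and, for i.i.d. $g_i\sim N(0,1)$, let $\Lambda$ and $\widetilde\Lambda$ be the $(1-\gamma)$-quantiles of $n\|\mathbb E_n[x_ig_i]\|_\infty$ and of $n\|\mathbb E_n[x_ig_i]\|_\infty/\sqrt{\mathbb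 E_n[g_i^2]}$. A *feasible Lasso* estimate is either - (Iterated Lasso) a minimizer $\hat\beta$ of $\widehat Q(b)+\frac{\lambda}{n}\|b\|_1$ with $\lambda=2c\hat\sigma\sqrt n\,\Phi^{-1}(1-\gamma/(2p))$ or $\lambda=2c\hat\sigma\Lambda$, or - (Square-root Lasso) a minimizer $\hat\beta$ of $\sqrt{\widehat Q(b)}+\frac{\lambda}{n}\|b\|_1$ with $\lambda=c\widetilde\Lambda$ or $\lambda=c\sqrt n\,\Phi^{-1}(1-\gamma/(2p))$. Here $\hat\sigma$ is any estimate with $\hat\sigma=\sigma_v+o_P(1)$, or the output of one of the following two iterations. Start with $\hat\sigma_0=\psi\{\widehat Q(\bar\beta)\}^{1/2}$, where $\bar\beta$ is least squares on a given set $I_0$ of $o(n)$ regressors and $\psi>0$ is a constant with $c\psi>1$. For $k=0,1,\dots$ compute the Lasso estimate $\hat b$ with $\lambda=2c\hat\sigma_k\Lambda$ and set $\hat\sigma_{k+1}^2=\widehat Q(\hat b)$ (Lasso iteration), or compute moreover the least squares estimate $\tilde b$ on $\widehat T=\mathrm{supp}(\hat b)$ and set $\hat\sigma_{k+1}^2=\widehat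 Q(\tilde b)\,n/(n-|\widehat T|)$ (Post-Lasso iteration). Stop and report $\hat\sigma=\hat\sigma_{k+1}$ as soon as $|\hat\sigma_{k+1}-\hat\sigma_k|\le\nu$ or $k>K_0$, with constants $\nu\ge0$ and $K_0>1$. A *Post-Lasso* estimate is a minimizer of $\widehat Q$ over the vectors supported in $\mathrm{supp}(\hat\beta)$ for a feasible Lasso estimate $\hat\beta$. **Theorem.** Suppose Condition ASIV holds, and let $\hat\beta$ be a feasible Lasso or a Post-Lasso estimate. Put $\widehat A_i=(x_i'\hat\beta,w_i')'$ and $$\widehat\alpha^*=\big(\mathbb E_n[\widehat A_id_i']\big)^{-1}\mathbb E_n[\widehat A_iy_{1i}].$$ Then $\sqrt n(\widehat\alpha^*-\alpha)=O_P(1)$, and as $n\to\infty$ $$(\sigma_\zeta^2Q_n^{-1})^{-1/2}\sqrt n(\widehat\alpha^*-\alpha)=N(0,I)+o_P(1),$$ that is, for all large $n$ there is a standard normal vector on the same probability space from which the left side differs by $o_P(1)$. The last display also holds with $Q_n$ replaced by $\widehat Q_n=\mathbb E_n[\widehat A_i\widehat A_i']$ and $\sigma_\zeta^2$ replaced by $\hat\sigma_\zeta^2=\mathbb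 E_n[(y_{1i}-d_i'\widehat\alpha^*)^2]$. -/

import Mathlib

open MeasureTheory ProbabilityTheory Filter Topology Asymptotics

namespace LassoIV

noncomputable section

/-! ### Empirical averages, sparse least squares and `ℓ¹`-penalised estimators

A regression sample is a response `y : Fin n → ℝ` and a design `x : Fin n → Fin p → ℝ`. -/

/-- Empirical average `𝔼ₙ[g] = n⁻¹ ∑ᵢ gᵢ`. -/
def En {n : ℕ} (g : Fin n → ℝ) : ℝ := (∑ i, g i) / n

/-- The support of a coefficient vector; its cardinality is `‖b‖₀`. -/
def supp {p : ℕ} (b : Fin p → ℝ) : Finset (Fin p) := {j | b j ≠ 0}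

/-- The `ℓ¹` norm. -/
def l1Norm {p : ℕ} (b : Fin p → ℝ) : ℝ := ∑ j, |b j|

/-- Least squares criterion `𝔼ₙ[(yᵢ - xᵢ'b)²]`. -/
def Qhat {n p : ℕ} (y : Fin n → ℝ) (x : Fin n → Fin p → ℝ) (b : Fin p → ℝ) : ℝ :=
  En fun i => (y i - ∑ j, x i j * b j) ^ 2

/-- `b` is a Lasso estimate with penalty level `lam`: a minimiser of
`𝔼ₙ[(yᵢ - xᵢ'b)²] + (lam / n) ‖b‖₁`. -/
def IsLasso {n p : ℕ} (y : Fin n → ℝ) (x : Fin n → Fin p → ℝ) (lam : ℝ) (b : Fin p → ℝ) : Prop :=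
  ∀ b' : Fin p → ℝ, Qhat y x b + lam / n * l1Norm b ≤ Qhat y x b' + lam / n * l1Norm b'

/-- `b` is a Square-root Lasso estimate with penalty level `lam`: a minimiser of
`𝔼ₙ[(yᵢ - xᵢ'b)²]^{1/2} + (lam / n) ‖b‖₁`. -/
def IsSqrtLasso {n p : ℕ} (y : Fin n → ℝ) (x : Fin n → Fin p → ℝ) (lam : ℝ) (b : Fin p → ℝ) :
    Prop :=
  ∀ b' : Fin p → ℝ,
    √(Qhat y x b) + lam / n * l1Norm b ≤ √(Qhat y x b') + lam / n * l1Norm b'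

/-- `b` is a least squares estimate in the model `T`: a minimiser of `𝔼ₙ[(yᵢ - xᵢ'b)²]` among the
vectors that vanish outside `T`. -/
def IsLeastSquares {n p : ℕ} (y : Fin n → ℝ) (x : Fin n → Fin p → ℝ) (T : Finset (Fin p))
    (b : Fin p → ℝ) : Prop :=
  (∀ j ∉ T, b j = 0) ∧
    ∀ b' : Fin p → ℝ, (∀ j ∉ T, b' j = 0) → Qhat y x b ≤ Qhat y x b'

/-! ### Penalty levels -/

/-- The `q`-quantile of a law on the real line. -/
def quantile (ν : Measure ℝ) (q : ℝ) : ℝ := sInf {t : ℝ | q ≤ ν.real (Set.Iic t)}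

/-- The standard normal quantile function `Φ⁻¹`. -/
def PhiInv (q : ℝ) : ℝ := quantile (gaussianReal 0 1) q

/-- The law of `g = (g₁, …, g_d)` with independent standard normal entries, i.e. `N(0, I)`. -/
def stdNormal (d : ℕ) : Measure (Fin d → ℝ) := Measure.pi fun _ => gaussianReal 0 1

/-- `n ‖𝔼ₙ[xᵢ gᵢ]‖_∞` (the norm of `Fin p → ℝ` is the maximum norm). -/
def scoreMax {n p : ℕ} (x : Fin n → Fin p → ℝ) (g : Fin n → ℝ) : ℝ :=
  n * ‖(fun j => En fun i => x i j * g i : Fin p → ℝ)‖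

/-- `Λ(1-γ|X)`: the `(1-γ)`-quantile of `n ‖𝔼ₙ[xᵢ gᵢ]‖_∞`. -/
def Lam {n p : ℕ} (x : Fin n → Fin p → ℝ) (γ : ℝ) : ℝ :=
  quantile ((stdNormal n).map fun g => scoreMax x g) (1 - γ)

/-- The self-normalised analogue: the `(1-γ)`-quantile of
`n ‖𝔼ₙ[xᵢ gᵢ]‖_∞ / 𝔼ₙ[gᵢ²]^{1/2}`. -/
def LamSqrt {n p : ℕ} (x : Fin n → Fin p → ℝ) (γ : ℝ) : ℝ :=
  quantile ((stdNormal n).map fun g => scoreMax x g / √(En fun i => g i ^ 2)) (1 - γ)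

/-! ### Iterative estimation of the noise level -/

/-- One pass of the Lasso iteration: from the noise level `τ` to the noise level `τ'`. -/
def LassoStep {n p : ℕ} (y : Fin n → ℝ) (x : Fin n → Fin p → ℝ) (c γ τ τ' : ℝ) : Prop :=
  ∃ b, IsLasso y x (2 * c * τ * Lam x γ) b ∧ τ' = √(Qhat y x b)

/-- One pass of the Post-Lasso iteration, with the degrees-of-freedom correction. -/
def PostLassoStep {n p : ℕ} (y : Fin n → ℝ) (x : Fin n → Fin p → ℝ) (c γ τ τ' : ℝ) : Prop :=
  ∃ b b', IsLasso y x (2 * c * τ * Lam x γ) b ∧ IsLeastSquares y x (supp b) b' ∧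
    τ' = √(Qhat y x b' * (n / ((n : ℝ) - (supp b).card)))

/-- `sig` is reported by the iteration of `step` that starts from `ψ` times the residual standard
deviation of the least squares regression on the regressors in `I₀`, with tolerance `tol` and
bound `K` on the iteration counter. -/
def Reports {n p : ℕ} (y : Fin n → ℝ) (x : Fin n → Fin p → ℝ) (step : ℝ → ℝ → Prop)
    (ψ : ℝ) (I₀ : Finset (Fin p)) (tol : ℝ) (K : ℕ) (sig : ℝ) : Prop :=
  ∃ (N : ℕ) (τ : ℕ → ℝ),
    (∃ b, IsLeastSquares y x I₀ b ∧ τ 0 = ψ * √(Qhat y x b)) ∧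
    (∀ k ≤ N, step (τ k) (τ (k + 1))) ∧
    (∀ k < N, ¬ (|τ (k + 1) - τ k| ≤ tol ∨ K < k)) ∧
    (|τ (N + 1) - τ N| ≤ tol ∨ K < N) ∧
    sig = τ (N + 1)

/-! ### Sparse eigenvalues -/

/-- The Gram matrix `𝔼ₙ[xᵢ xᵢ']`. -/
def gram {n p : ℕ} (x : Fin n → Fin p → ℝ) : Matrix (Fin p) (Fin p) ℝ :=
  Matrix.of fun j k => En fun i => x i j * x i k

/-- The quotients `δ'Mδ / ‖δ‖²` over the nonzero `δ` with `‖δ‖₀ ≤ m`. -/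
def sparseRayleigh {p : ℕ} (m : ℝ) (M : Matrix (Fin p) (Fin p) ℝ) : Set ℝ :=
  {t | ∃ δ : Fin p → ℝ, δ ≠ 0 ∧ ((supp δ).card : ℝ) ≤ m ∧
    t = (δ ⬝ᵥ M.mulVec δ) / (δ ⬝ᵥ δ)}

/-- The minimal `m`-sparse eigenvalue. -/
def sparseEigMin {p : ℕ} (m : ℝ) (M : Matrix (Fin p) (Fin p) ℝ) : ℝ := sInf (sparseRayleigh m M)

/-- The maximal `m`-sparse eigenvalue. -/
def sparseEigMax {p : ℕ} (m : ℝ) (M : Matrix (Fin p) (Fin p) ℝ) : ℝ := sSup (sparseRayleigh m M)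

/-! ### Stochastic orders along a sequence of probability spaces -/

/-- `Xₙ = o_P(1)`. The set functions are outer measures, so no measurability of `Xₙ` is needed. -/
def IsLittleOP {Ω : ℕ → Type*} [∀ n, MeasurableSpace (Ω n)] (μ : ∀ n, Measure (Ω n))
    {E : Type*} [NormedAddCommGroup E] (X : ∀ n, Ω n → E) : Prop :=
  ∀ ε : ℝ, 0 < ε → Tendsto (fun n => μ n {ω | ε ≤ ‖X n ω‖}) atTop (𝓝 0)

/-- `Xₙ = O_P(1)`. -/
def IsBigOP {Ω : ℕ → Type*} [∀ n, MeasurableSpace (Ω n)] (μ : ∀ n, Measure (Ω n))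
    {E : Type*} [NormedAddCommGroup E] (X : ∀ n, Ω n → E) : Prop :=
  ∀ ε : ENNReal, 0 < ε → ∃ C : ℝ, ∀ᶠ n in atTop, μ n {ω | C < ‖X n ω‖} ≤ ε

/-- `Xₙ = N(0, I) + o_P(1)`: up to `o_P(1)`, `Xₙ` is, for all large `n`, an exactly standard normal
vector on the same probability space. -/
def IsStdNormalPlusOP {Ω : ℕ → Type*} [∀ n, MeasurableSpace (Ω n)] (μ : ∀ n, Measure (Ω n))
    {d : ℕ} (X : ∀ n, Ω n → (Fin d → ℝ)) : Prop :=
  ∃ Z : ∀ n, Ω n → (Fin d → ℝ),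
    (∀ᶠ n in atTop, HasLaw (Z n) (stdNormal d) (μ n)) ∧
    IsLittleOP μ fun n ω => X n ω - Z n ω

/-- `M^{-1/2}` for a symmetric positive definite matrix, through the functional calculus. -/
def invSqrt {d : ℕ} (M : Matrix (Fin d) (Fin d) ℝ) : Matrix (Fin d) (Fin d) ℝ :=
  cfc (fun t : ℝ => (√t)⁻¹) M

/-! ### The simultaneous equation model -/

/-- A triangular array of Gaussian simultaneous equation models with fixed instruments
`zᵢ = (uᵢ', wᵢ')'`, technical instruments `P(zᵢ)` and disturbances `(ζᵢ, vᵢ)` that are independent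
over `i` with law `N(0, [σζ², σζv; σζv, σv²])`. Everything may change with the sample size `n`,
except for the dimension `kw` of the controls. -/
structure IVArray {Ω : ℕ → Type*} [∀ n, MeasurableSpace (Ω n)] (μ : ∀ n, Measure (Ω n))
    (kw : ℕ) where
  /-- dimension of the excluded elementary instruments -/
  ku : ℕ → ℕ
  /-- dimension of the technical instruments -/
  p : ℕ → ℕ
  u : ∀ n, Fin n → Fin (ku n) → ℝ
  w : ∀ n, Fin n → Fin kw → ℝ
  /-- first stage regression function, the optimal instrument -/
  f : ∀ n, (Fin (ku n) → ℝ) × (Fin kw → ℝ) → ℝ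
  /-- dictionary of technical transformations -/
  P : ∀ n, (Fin (ku n) → ℝ) × (Fin kw → ℝ) → Fin (p n) → ℝ
  /-- the structural parameter `(α₁, α₂')'` -/
  α : ∀ _ : ℕ, Fin (kw + 1) → ℝ
  σζ : ℕ → ℝ
  σv : ℕ → ℝ
  σζv : ℕ → ℝ
  ζ : ∀ n, Fin n → Ω n → ℝ
  v : ∀ n, Fin n → Ω n → ℝ
  indep : ∀ n, iIndepFun (fun i ω => (ζ n i ω, v n i ω)) (μ n)
  gaussian : ∀ n i, HasGaussianLaw (fun ω => (ζ n i ω, v n i ω)) (μ n)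
  mean_ζ : ∀ n i, ∫ ω, ζ n i ω ∂(μ n) = 0
  mean_v : ∀ n i, ∫ ω, v n i ω ∂(μ n) = 0
  var_ζ : ∀ n i, variance (ζ n i) (μ n) = σζ n ^ 2
  var_v : ∀ n i, variance (v n i) (μ n) = σv n ^ 2
  cov_ζv : ∀ n i, covariance (ζ n i) (v n i) (μ n) = σζv n

namespace IVArray

variable {Ω : ℕ → Type*} [∀ n, MeasurableSpace (Ω n)] {μ : ∀ n, Measure (Ω n)} {kw : ℕ}
  (M : IVArray μ kw)

/-- The vector of instrumental variables `zᵢ`. -/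
def z (n : ℕ) (i : Fin n) : (Fin (M.ku n) → ℝ) × (Fin kw → ℝ) := (M.u n i, M.w n i)

/-- The technical instruments `xᵢ = P(zᵢ)`. -/
def x (n : ℕ) (i : Fin n) : Fin (M.p n) → ℝ := M.P n (M.z n i)

/-- The endogenous variable `y₂ᵢ = f(zᵢ) + vᵢ`. -/
def y₂ (n : ℕ) (ω : Ω n) (i : Fin n) : ℝ := M.f n (M.z n i) + M.v n i ω

/-- The response `y₁ᵢ = y₂ᵢ α₁ + wᵢ'α₂ + ζᵢ`. -/
def y₁ (n : ℕ) (ω : Ω n) (i : Fin n) : ℝ :=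
  M.y₂ n ω i * M.α n 0 + ∑ j : Fin kw, M.w n i j * M.α n j.succ + M.ζ n i ω

/-- The ideal instrument vector `Aᵢ = (f(zᵢ), wᵢ')'`. -/
def A (n : ℕ) (i : Fin n) : Fin (kw + 1) → ℝ := Fin.cons (M.f n (M.z n i)) (M.w n i)

/-- `dᵢ = (y₂ᵢ, wᵢ')'`. -/
def d (n : ℕ) (ω : Ω n) (i : Fin n) : Fin (kw + 1) → ℝ := Fin.cons (M.y₂ n ω i) (M.w n i)

/-- `Qₙ = 𝔼ₙ[Aᵢ Aᵢ']`. -/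
def Q (n : ℕ) : Matrix (Fin (kw + 1)) (Fin (kw + 1)) ℝ := gram (M.A n)

/-! #### The estimator built from a first stage estimate `b` -/

/-- The estimated instrument vector `Âᵢ = (xᵢ'b, wᵢ')'`. -/
def Ahat (n : ℕ) (b : Fin (M.p n) → ℝ) (i : Fin n) : Fin (kw + 1) → ℝ :=
  Fin.cons (∑ j, M.x n i j * b j) (M.w n i)

/-- The IV estimator `(𝔼ₙ[Âᵢ dᵢ'])⁻¹ 𝔼ₙ[Âᵢ y₁ᵢ]`. -/
def αhat (n : ℕ) (b : Fin (M.p n) → ℝ) (ω : Ω n) : Fin (kw + 1) → ℝ :=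
  (Matrix.of fun j k => En fun i => M.Ahat n b i j * M.d n ω i k :
      Matrix (Fin (kw + 1)) (Fin (kw + 1)) ℝ)⁻¹.mulVec
    (fun j => En fun i => M.Ahat n b i j * M.y₁ n ω i)

/-- `Q̂ₙ = 𝔼ₙ[Âᵢ Âᵢ']`. -/
def Qhat (n : ℕ) (b : Fin (M.p n) → ℝ) : Matrix (Fin (kw + 1)) (Fin (kw + 1)) ℝ :=
  gram (M.Ahat n b)

/-- The plug-in estimate `𝔼ₙ[(y₁ᵢ - dᵢ'α̂)²]` of `σζ²`. -/
def σζsqHat (n : ℕ) (b : Fin (M.p n) → ℝ) (ω : Ω n) : ℝ :=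
  En fun i => (M.y₁ n ω i - ∑ k, M.d n ω i k * M.αhat n b ω k) ^ 2

/-! #### Assumptions -/

/-- Condition ASM for the first stage: normalised technical instruments and an approximately sparse
regression function. -/
def ASM (s : ℕ → ℕ) : Prop :=
  (∀ᶠ n in atTop, ∀ j, (En fun i => M.x n i j ^ 2) = 1) ∧
  ∃ K : ℝ, ∀ᶠ n in atTop, ∃ β₀ : Fin (M.p n) → ℝ,
    (supp β₀).card ≤ s n ∧
    √(En fun i => (M.f n (M.z n i) - ∑ j, M.x n i j * β₀ j) ^ 2) ≤ K * M.σv n * √(s n / n)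

/-- Condition SE: the sparse eigenvalues of `𝔼ₙ[xᵢ xᵢ']` of order `ℓₙ s`, for some `ℓₙ → ∞`, are
bounded away from zero and from above. -/
def SE (s : ℕ → ℕ) : Prop :=
  ∃ (l : ℕ → ℝ) (κ₁ κ₂ : ℝ), Tendsto l atTop atTop ∧ 0 < κ₁ ∧ κ₁ < κ₂ ∧
    ∀ᶠ n in atTop,
      κ₁ ≤ sparseEigMin (l n * s n) (gram (M.x n)) ∧
      sparseEigMin (l n * s n) (gram (M.x n)) ≤ sparseEigMax (l n * s n) (gram (M.x n)) ∧
      sparseEigMax (l n * s n) (gram (M.x n)) ≤ κ₂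

/-- Condition ASIV. -/
structure ASIV (s : ℕ → ℕ) : Prop where
  bounded : ∃ a b : ℝ, 0 < a ∧ ∀ᶠ n in atTop,
    a ≤ M.σv n ∧ M.σv n ≤ b ∧ a ≤ M.σζ n ∧ M.σζ n ≤ b ∧
    ∀ e ∈ spectrum ℝ (M.Q n), a ≤ e ∧ e ≤ b
  sparse : M.ASM s
  sparseEig : M.SE s
  growth : (fun n => (s n : ℝ) ^ 2 * Real.log (max (M.p n : ℝ) n) ^ 2)
    =o[atTop] fun n => (n : ℝ)

/-- The confidence levels `1 - γₙ`: `γₙ = o(1)` and `log (1 / γₙ) ≲ log (p ∨ n)`. -/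
structure ConfidenceLevel (γ : ℕ → ℝ) : Prop where
  pos : ∀ n, 0 < γ n
  lt_one : ∀ n, γ n < 1
  tendsto : Tendsto γ atTop (𝓝 0)
  log_le : (fun n => Real.log (1 / γ n)) =O[atTop] fun n => Real.log (max (M.p n : ℝ) n)

/-- Admissible estimates of the first stage noise level `σv`: any estimate `σv + o_P(1)`, and also
the output of the Lasso or the Post-Lasso iteration. -/
inductive NoiseEstimate (c : ℝ) (γ : ℕ → ℝ) (sig : ∀ n, Ω n → ℝ) : Prop
  | consistent (h : IsLittleOP μ fun n ω => sig n ω - M.σv n)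
  | lassoIteration (ψ tol : ℝ) (K : ℕ) (I₀ : ∀ n, Finset (Fin (M.p n)))
      (hψ : 0 < ψ) (hcψ : 1 < c * ψ) (htol : 0 ≤ tol) (hK : 1 < K)
      (hI₀ : (fun n => ((I₀ n).card : ℝ)) =o[atTop] fun n => (n : ℝ))
      (h : ∀ n ω, Reports (M.y₂ n ω) (M.x n) (LassoStep (M.y₂ n ω) (M.x n) c (γ n))
        ψ (I₀ n) tol K (sig n ω))
  | postLassoIteration (ψ tol : ℝ) (K : ℕ) (I₀ : ∀ n, Finset (Fin (M.p n)))
      (hψ : 0 < ψ) (hcψ : 1 < c * ψ) (htol : 0 ≤ tol) (hK : 1 < K)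
      (hI₀ : (fun n => ((I₀ n).card : ℝ)) =o[atTop] fun n => (n : ℝ))
      (h : ∀ n ω, Reports (M.y₂ n ω) (M.x n) (PostLassoStep (M.y₂ n ω) (M.x n) c (γ n))
        ψ (I₀ n) tol K (sig n ω))

/-- Feasible Lasso estimates of the first stage: Iterated Lasso or Square-root Lasso, each with
the `X`-independent or the `X`-dependent penalty level. -/
inductive FeasibleLasso (c : ℝ) (γ : ℕ → ℝ) (b : ∀ n, Ω n → Fin (M.p n) → ℝ) : Prop
  | iteratedIndep (sig : ∀ n, Ω n → ℝ) (hsig : M.NoiseEstimate c γ sig)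
      (h : ∀ n ω, IsLasso (M.y₂ n ω) (M.x n)
        (2 * c * sig n ω * (√n * PhiInv (1 - γ n / (2 * M.p n)))) (b n ω))
  | iteratedDep (sig : ∀ n, Ω n → ℝ) (hsig : M.NoiseEstimate c γ sig)
      (h : ∀ n ω, IsLasso (M.y₂ n ω) (M.x n) (2 * c * sig n ω * Lam (M.x n) (γ n)) (b n ω))
  | sqrtDep
      (h : ∀ n ω, IsSqrtLasso (M.y₂ n ω) (M.x n) (c * LamSqrt (M.x n) (γ n)) (b n ω))
  | sqrtIndep
      (h : ∀ n ω, IsSqrtLasso (M.y₂ n ω) (M.x n)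
        (c * (√n * PhiInv (1 - γ n / (2 * M.p n)))) (b n ω))

/-- A feasible Lasso estimate, or a Post-Lasso estimate, i.e. least squares in the model selected by
a feasible Lasso estimate. -/
def FeasibleFirstStage (c : ℝ) (γ : ℕ → ℝ) (b : ∀ n, Ω n → Fin (M.p n) → ℝ) : Prop :=
  M.FeasibleLasso c γ b ∨
  ∃ b' : ∀ n, Ω n → Fin (M.p n) → ℝ, M.FeasibleLasso c γ b' ∧
    ∀ n ω, IsLeastSquares (M.y₂ n ω) (M.x n) (supp (b' n ω)) (b n ω)

end IVArray

end

end LassoIV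

/-!
The estimator satisfies `√n (α̂ - α) = Ĝ⁻¹ √n 𝔼ₙ[Âᵢ ζᵢ]` with `Ĝ = 𝔼ₙ[Âᵢ dᵢ']`, so it behaves like the
infeasible estimator with the ideal instruments `Aᵢ` as soon as the instrument error
`xᵢ'β̂ - f(zᵢ)` is negligible in two senses: its empirical norm tends to zero, and so does
`√n 𝔼ₙ[(xᵢ'β̂ - f(zᵢ)) ζᵢ]`. For the second, the error is the sum of the fixed approximation error,
handled by Chebyshev's inequality, and of `xᵢ'(β̂ - β₀)`, handled by Hölder's inequality:
`‖√n 𝔼ₙ[xᵢ ζᵢ]‖_∞ ≲ √(log (p ∨ n))` and `‖β̂ - β₀‖₁ ≲ s √(log (p ∨ n) / n)`, with product of the order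
`s log (p ∨ n) / √n → 0` (`FeasibleFirstStage.tendsto_nrm`, `FeasibleFirstStage.tendsto_score`).

The bounds for `β̂` need no relation between the disturbances of the two equations. They rest on the
following facts about the first stage.
* A lower bound on sparse eigenvalues passes to all vectors up to a multiple of `‖d‖₁² / m`
  (`quadForm_ge_of_sparse`, by an averaging argument), which gives compatibility on cones.
* If the penalty dominates the score, then Lasso has prediction error of the order
  `√(s log (p ∨ n) / n)` (`IsLasso.nrm_le`), it selects `O(s)` regressors (`IsLasso.card_le`), and
  least squares in the selected model has the same rate (`IsLasso.nrm_le_of_isLeastSquares`).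
* All penalty levels in use dominate the score with probability tending to one and have order at most
  `√(n log (p ∨ n))` (`RegularDesign.penaltyLevel_phiInv`, `RegularDesign.penaltyLevel_lam`,
  `RegularDesign.penaltyLevel_lamSqrt`).
* A Square-root Lasso estimate is a Lasso estimate whose noise level is its own residual standard
  deviation (`IsSqrtLasso.isLasso`), and that noise level is consistent.
* An iteration starts from a conservative noise level, since least squares on `o(n)` regressors
  removes only a vanishing fraction of the noise, and each pass turns conservative noise levels into
  accurate ones, uniformly; hence the number of passes is irrelevant
  (`NoisyDesign.tendsto_of_reports`).

For the limit law, the ideal standardised score `(σζ² Qₙ⁻¹)^{-1/2} Qₙ⁻¹ √n 𝔼ₙ[Aᵢ ζᵢ]` is an orthonormal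
transform of the vector `ζ / σζ`, hence exactly standard normal for every large `n`
(`ASIV.hasLaw_score`); no central limit theorem is involved. Inverses and inverse square roots are
uniformly continuous on matrices with eigenvalues bounded away from zero and infinity (`Close.inv`,
`Close.invSqrt`), so that the feasible and the ideal standardisation differ by `o_P(1)`.

Statements in probability are phrased with a filter `whp μ` on the disjoint union of the probability
spaces, whose members are the events with probability tending to one; `o_P(1)` is then convergence
along this filter.
-/


namespace LassoIV

noncomputable section

/-! ### Events of probability tending to one -/

section Whp

variable {Ω : ℕ → Type*} [∀ n, MeasurableSpace (Ω n)] (μ : ∀ n, Measure (Ω n))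

/-- The filter of the events whose probability tends to one along the sequence of probability
spaces. An event is a set of pairs `⟨n, ω⟩` with `ω : Ω n`; no measurability is required, since the
complements are measured by outer measures. -/
def whp : Filter (Σ n, Ω n) where
  sets := {S | Tendsto (fun n => μ n {ω | ⟨n, ω⟩ ∉ S}) atTop (𝓝 0)}
  univ_sets := by simp
  sets_of_superset {S T} hS hST := by
    refine tendsto_of_tendsto_of_tendsto_of_le_of_le tendsto_const_nhds hS
      (fun n => zero_le) fun n => measure_mono fun ω hω h => hω (hST h)
  inter_sets {S T} hS hT := by
    have h := Tendsto.add hS hT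
    rw [add_zero] at h
    refine tendsto_of_tendsto_of_tendsto_of_le_of_le tendsto_const_nhds h
      (fun n => zero_le) fun n => (measure_mono ?_).trans (measure_union_le _ _)
    intro ω hω
    simp only [Set.mem_inter_iff, Set.mem_ofPred_eq, not_and_or] at hω
    exact hω

variable {μ}

lemma eventually_whp {P : (Σ n, Ω n) → Prop} :
    (∀ᶠ q in whp μ, P q) ↔ Tendsto (fun n => μ n {ω | ¬ P ⟨n, ω⟩}) atTop (𝓝 0) := Iff.rfl

lemma eventually_whp_of_le {P : (Σ n, Ω n) → Prop} {e : ℕ → ENNReal}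
    (he : Tendsto e atTop (𝓝 0)) (h : ∀ᶠ n in atTop, μ n {ω | ¬ P ⟨n, ω⟩} ≤ e n) :
    ∀ᶠ q in whp μ, P q :=
  eventually_whp.2 <| tendsto_of_tendsto_of_tendsto_of_le_of_le' tendsto_const_nhds he
      (.of_forall fun _ => zero_le) h

lemma tendsto_fst_whp : Tendsto (Sigma.fst : (Σ n, Ω n) → ℕ) (whp μ) atTop := by
  intro S hS
  refine eventually_whp_of_le (e := 0) tendsto_const_nhds ?_
  filter_upwards [hS] with n hn
  simp [hn]

lemma eventually_whp_fst {P : ℕ → Prop} (h : ∀ᶠ n in atTop, P n) : ∀ᶠ q in whp μ, P q.1 :=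
  tendsto_fst_whp.eventually h

lemma isLittleOP_iff_tendsto {E : Type*} [NormedAddCommGroup E] {X : ∀ n, Ω n → E} :
    IsLittleOP μ X ↔ Tendsto (fun q : Σ n, Ω n => X q.1 q.2) (whp μ) (𝓝 0) := by
  simp only [IsLittleOP, Metric.tendsto_nhds, dist_zero_right, eventually_whp, not_lt]

/-- Chebyshev's inequality as a criterion for convergence to zero in probability. -/
lemma tendsto_whp_of_variance [∀ n, IsProbabilityMeasure (μ n)] {X : ∀ n, Ω n → ℝ}
    (hX : ∀ᶠ n in atTop, MemLp (X n) 2 (μ n)) {m : ℕ → ℝ}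
    (hm : ∀ᶠ n in atTop, ∫ ω, X n ω ∂μ n = m n)
    {e : ℕ → ℝ} (he : Tendsto e atTop (𝓝 0)) (hv : ∀ᶠ n in atTop, Var[X n; μ n] ≤ e n) :
    Tendsto (fun q : Σ n, Ω n => X q.1 q.2 - m q.1) (whp μ) (𝓝 0) := by
  rw [Metric.tendsto_nhds]
  intro ε hε
  refine eventually_whp_of_le (e := fun n => ENNReal.ofReal (e n / ε ^ 2)) ?_ ?_
  · have := ENNReal.tendsto_ofReal (he.div_const (ε ^ 2))
    simpa using this
  · filter_upwards [hX, hm, hv] with n h1 h2 h3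
    have := meas_ge_le_variance_div_sq h1 hε
    rw [h2] at this
    refine (measure_mono ?_).trans (this.trans (ENNReal.ofReal_le_ofReal (by gcongr)))
    intro ω hω
    simpa [Real.dist_eq] using hω

/-- A product of a convergence to zero in probability with a stochastically bounded sequence. -/
lemma tendsto_whp_mul_of_isBigOP {X Y : ∀ n, Ω n → ℝ}
    (hX : Tendsto (fun q : Σ n, Ω n => X q.1 q.2) (whp μ) (𝓝 0)) (hY : IsBigOP μ Y) :
    Tendsto (fun q : Σ n, Ω n => X q.1 q.2 * Y q.1 q.2) (whp μ) (𝓝 0) := by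
  rw [Metric.tendsto_nhds]
  intro ε hε
  rw [eventually_whp, ENNReal.tendsto_nhds_zero]
  intro η hη
  obtain ⟨C, hC⟩ := hY (η / 2) (ENNReal.div_pos hη.ne' (by simp))
  have h1 := Metric.tendsto_nhds.1 hX (ε / (|C| + 1)) (by positivity)
  rw [eventually_whp, ENNReal.tendsto_nhds_zero] at h1
  filter_upwards [hC, h1 (η / 2) (ENNReal.div_pos hη.ne' (by simp))] with n h2 h3
  refine (measure_mono ?_).trans ((measure_union_le _ _).trans
    ((add_le_add h3 h2).trans_eq (ENNReal.add_halves η)))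
  intro ω hω
  by_contra hcon
  simp only [Set.mem_union, Set.mem_ofPred_eq, not_or, not_lt, dist_zero_right,
    Real.norm_eq_abs, abs_mul, not_le] at hω hcon
  rw [lt_div_iff₀ (by positivity)] at hcon
  have : |Y n ω| ≤ |C| := hcon.2.trans (le_abs_self C)
  nlinarith [abs_nonneg (X n ω)]

lemma isBigOP_of_variance [∀ n, IsProbabilityMeasure (μ n)] {X : ∀ n, Ω n → ℝ}
    (hX : ∀ᶠ n in atTop, MemLp (X n) 2 (μ n)) (hm : ∀ᶠ n in atTop, ∫ ω, X n ω ∂μ n = 0)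
    {B : ℝ} (hv : ∀ᶠ n in atTop, Var[X n; μ n] ≤ B) : IsBigOP μ X := by
  intro ε hε
  have hB : Tendsto (fun c : ℝ => ENNReal.ofReal (B / c ^ 2)) atTop (𝓝 0) := by
    have h : Tendsto (fun c : ℝ => B / c ^ 2) atTop (𝓝 0) :=
      tendsto_const_nhds.div_atTop (tendsto_pow_atTop two_ne_zero)
    simpa using ENNReal.tendsto_ofReal h
  obtain ⟨c, hc, hc0⟩ := ((ENNReal.tendsto_nhds_zero.1 hB ε hε).and (eventually_gt_atTop 0)).exists
  refine ⟨c, ?_⟩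
  filter_upwards [hX, hm, hv] with n h1 h2 h3
  have := meas_ge_le_variance_div_sq h1 hc0
  refine (measure_mono ?_).trans (this.trans ((ENNReal.ofReal_le_ofReal (by gcongr)).trans hc))
  intro ω hω
  simp only [Set.mem_ofPred_eq, Real.norm_eq_abs] at hω
  simpa [h2] using hω.le

lemma IsBigOP.add_tendsto {X Y : ∀ n, Ω n → ℝ} (hX : IsBigOP μ X)
    (hY : Tendsto (fun q : Σ n, Ω n => Y q.1 q.2) (whp μ) (𝓝 0)) :
    IsBigOP μ fun n ω => X n ω + Y n ω := by
  intro ε hε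
  obtain ⟨C, hC⟩ := hX (ε / 2) (ENNReal.div_pos hε.ne' (by simp))
  have h1 := Metric.tendsto_nhds.1 hY 1 one_pos
  rw [eventually_whp, ENNReal.tendsto_nhds_zero] at h1
  refine ⟨C + 1, ?_⟩
  filter_upwards [hC, h1 (ε / 2) (ENNReal.div_pos hε.ne' (by simp))] with n h2 h3
  refine (measure_mono ?_).trans ((measure_union_le _ _).trans
    ((add_le_add h2 h3).trans_eq (ENNReal.add_halves ε)))
  intro ω hω
  by_contra hcon
  simp only [Set.mem_union, Set.mem_ofPred_eq, not_or, not_lt, dist_zero_right,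
    Real.norm_eq_abs, not_le] at hω hcon
  have := abs_add_le (X n ω) (Y n ω)
  linarith

/-- Stochastic boundedness of a vector follows from that of its entries. -/
lemma isBigOP_pi {d : ℕ} {X : ∀ n, Ω n → Fin d → ℝ}
    (h : ∀ j, IsBigOP μ fun n ω => X n ω j) : IsBigOP μ X := by
  intro ε hε
  rcases Nat.eq_zero_or_pos d with rfl | hd
  · refine ⟨0, .of_forall fun n => ?_⟩
    have : {ω | 0 < ‖X n ω‖} = ∅ := by
      ext ω
      simp [Subsingleton.elim (X n ω) 0]
    rw [this]
    simp
  have hεd : 0 < ε / d := ENNReal.div_pos hε.ne' (by simp)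
  choose C hC using fun j => h j (ε / d) hεd
  refine ⟨∑ j, |C j|, ?_⟩
  filter_upwards [eventually_all.2 hC] with n hn
  calc μ n {ω | ∑ j, |C j| < ‖X n ω‖} ≤ μ n (⋃ j, {ω | C j < ‖X n ω j‖}) := by
        refine measure_mono fun ω hω => ?_
        by_contra hcon
        simp only [Set.mem_iUnion, Set.mem_ofPred_eq, not_exists, not_lt] at hcon hω
        refine absurd hω (not_lt.2 ((pi_norm_le_iff_of_nonneg (by positivity)).2 fun j => ?_))
        exact (hcon j).trans ((le_abs_self _).trans
          (Finset.single_le_sum (f := fun j => |C j|) (fun _ _ => abs_nonneg _)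
            (Finset.mem_univ j)))
    _ ≤ ∑ j, μ n {ω | C j < ‖X n ω j‖} := measure_iUnion_fintype_le _ _
    _ ≤ ∑ _j : Fin d, ε / d := Finset.sum_le_sum fun j _ => hn j
    _ = ε := by
        rw [Finset.sum_const, Finset.card_univ, Fintype.card_fin, nsmul_eq_mul]
        exact ENNReal.mul_div_cancel (by simpa using hd.ne') (by simp)

end Whp

/-! ### Empirical inner product and norm -/

section Empirical

variable {n p : ℕ}

/-- The empirical norm `𝔼ₙ[gᵢ²]^{1/2}`. -/
def nrm (g : Fin n → ℝ) : ℝ := √(En fun i => g i ^ 2)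

/-- The fitted values `xᵢ'b`. -/
def fit (x : Fin n → Fin p → ℝ) (b : Fin p → ℝ) (i : Fin n) : ℝ := ∑ j, x i j * b j

lemma En_add (g h : Fin n → ℝ) : (En fun i => g i + h i) = En g + En h := by
  simp [En, Finset.sum_add_distrib, add_div]

lemma En_sub (g h : Fin n → ℝ) : (En fun i => g i - h i) = En g - En h := by
  simp [En, Finset.sum_sub_distrib, sub_div]

lemma En_const_mul (a : ℝ) (g : Fin n → ℝ) : (En fun i => a * g i) = a * En g := by
  simp [En, ← Finset.mul_sum, mul_div_assoc]

lemma En_sum {ι : Type*} (s : Finset ι) (g : ι → Fin n → ℝ) :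
    (En fun i => ∑ j ∈ s, g j i) = ∑ j ∈ s, En (g j) := by
  simp only [En]
  rw [Finset.sum_comm, Finset.sum_div]

lemma En_mono {g h : Fin n → ℝ} (hgh : ∀ i, g i ≤ h i) : En g ≤ En h := by
  unfold En
  gcongr with i
  exact hgh i

lemma En_sq_nonneg (g : Fin n → ℝ) : 0 ≤ En fun i => g i ^ 2 := by
  unfold En
  positivity

lemma nrm_nonneg (g : Fin n → ℝ) : 0 ≤ nrm g := Real.sqrt_nonneg _

lemma nrm_sq (g : Fin n → ℝ) : nrm g ^ 2 = En fun i => g i ^ 2 := Real.sq_sqrt (En_sq_nonneg g)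

lemma nrm_sub_comm (g h : Fin n → ℝ) : (nrm fun i => g i - h i) = nrm fun i => h i - g i := by
  unfold nrm
  congr 2
  funext i
  ring

lemma nrm_neg (g : Fin n → ℝ) : (nrm fun i => -g i) = nrm g := by simp [nrm]

lemma nrm_const_mul (a : ℝ) (g : Fin n → ℝ) : (nrm fun i => a * g i) = |a| * nrm g := by
  simp only [nrm, mul_pow]
  rw [En_const_mul, Real.sqrt_mul (sq_nonneg a), Real.sqrt_sq_eq_abs]

/-- The Cauchy–Schwarz inequality for empirical averages. -/
lemma abs_En_mul_le (g h : Fin n → ℝ) : |En fun i => g i * h i| ≤ nrm g * nrm h := by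
  refine abs_le_of_sq_le_sq ?_ (mul_nonneg (nrm_nonneg _) (nrm_nonneg _))
  rw [mul_pow, nrm_sq, nrm_sq]
  simp only [En]
  rw [div_pow, div_mul_div_comm, ← sq]
  gcongr
  exact Finset.sum_mul_sq_le_sq_mul_sq _ _ _

lemma nrm_add_sq (g h : Fin n → ℝ) :
    (nrm fun i => g i + h i) ^ 2 = nrm g ^ 2 + 2 * (En fun i => g i * h i) + nrm h ^ 2 := by
  rw [nrm_sq, nrm_sq, nrm_sq, ← En_const_mul, ← En_add, ← En_add]
  congr 1
  funext i
  ring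

lemma nrm_sub_sq (g h : Fin n → ℝ) :
    (nrm fun i => g i - h i) ^ 2 = nrm g ^ 2 - 2 * (En fun i => g i * h i) + nrm h ^ 2 := by
  rw [nrm_sq, nrm_sq, nrm_sq, ← En_const_mul, ← En_sub, ← En_add]
  congr 1
  funext i
  ring

lemma nrm_add_le (g h : Fin n → ℝ) : (nrm fun i => g i + h i) ≤ nrm g + nrm h := by
  refine abs_le_of_sq_le_sq' ?_ (add_nonneg (nrm_nonneg _) (nrm_nonneg _)) |>.2
  rw [nrm_add_sq]
  nlinarith [le_of_abs_le (abs_En_mul_le g h)]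

lemma nrm_sub_le (g h : Fin n → ℝ) : (nrm fun i => g i - h i) ≤ nrm g + nrm h := by
  simpa [sub_eq_add_neg, nrm_neg] using nrm_add_le g fun i => -h i

lemma abs_nrm_sub_nrm_le (g h : Fin n → ℝ) : |nrm g - nrm h| ≤ nrm fun i => g i - h i := by
  rw [abs_sub_le_iff]
  constructor
  · have := nrm_add_le (fun i => g i - h i) h
    simp only [sub_add_cancel] at this
    linarith
  · have := nrm_add_le (fun i => h i - g i) g
    simp only [sub_add_cancel] at this
    rw [nrm_sub_comm] at this
    linarith

lemma nrm_sum_le {ι : Type*} (s : Finset ι) (g : ι → Fin n → ℝ) :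
    (nrm fun i => ∑ j ∈ s, g j i) ≤ ∑ j ∈ s, nrm (g j) := by
  classical
  induction s using Finset.induction_on with
  | empty => simp [nrm, En]
  | insert a s ha ih =>
    simp only [Finset.sum_insert ha]
    exact (nrm_add_le _ _).trans (by gcongr)

variable (x : Fin n → Fin p → ℝ)

lemma fit_add (b b' : Fin p → ℝ) (i : Fin n) : fit x (b + b') i = fit x b i + fit x b' i := by
  simp [fit, mul_add, Finset.sum_add_distrib]

lemma fit_sub (b b' : Fin p → ℝ) (i : Fin n) : fit x (b - b') i = fit x b i - fit x b' i := by
  simp [fit, mul_sub, Finset.sum_sub_distrib]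

lemma fit_smul (a : ℝ) (b : Fin p → ℝ) (i : Fin n) : fit x (a • b) i = a * fit x b i := by
  simp only [fit, Pi.smul_apply, smul_eq_mul, Finset.mul_sum]
  exact Finset.sum_congr rfl fun j _ => by ring

lemma fit_single (j : Fin p) (t : ℝ) (i : Fin n) : fit x (Pi.single j t) i = t * x i j := by
  rw [fit, Finset.sum_eq_single j]
  · simp [mul_comm]
  · intro k _ hk
    simp [hk]
  · simp

lemma En_mul_fit (g : Fin n → ℝ) (b : Fin p → ℝ) :
    (En fun i => g i * fit x b i) = ∑ j, b j * En fun i => x i j * g i := by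
  simp only [fit, Finset.mul_sum]
  rw [En_sum]
  refine Finset.sum_congr rfl fun j _ => ?_
  rw [← En_const_mul]
  congr 1
  funext i
  ring

lemma scoreMax_nonneg (g : Fin n → ℝ) : 0 ≤ scoreMax x g := by
  unfold scoreMax
  positivity

/-- Hölder's inequality `|𝔼ₙ[gᵢ xᵢ'b]| ≤ ‖𝔼ₙ[xᵢ gᵢ]‖_∞ ‖b‖₁`. -/
lemma abs_En_mul_fit_le (g : Fin n → ℝ) (b : Fin p → ℝ) :
    |En fun i => g i * fit x b i| ≤ scoreMax x g / n * l1Norm b := by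
  rcases Nat.eq_zero_or_pos n with rfl | hn
  · simp [En]
  rw [En_mul_fit, scoreMax, mul_div_cancel_left₀ _ (by positivity), l1Norm, Finset.mul_sum]
  refine (Finset.abs_sum_le_sum_abs _ _).trans (Finset.sum_le_sum fun j _ => ?_)
  rw [abs_mul, mul_comm]
  gcongr
  exact norm_le_pi_norm (fun j => En fun i => x i j * g i) j

lemma Qhat_eq_nrm_sq (y : Fin n → ℝ) (b : Fin p → ℝ) :
    Qhat y x b = (nrm fun i => y i - fit x b i) ^ 2 := by
  rw [nrm_sq]
  rfl

lemma Qhat_nonneg (y : Fin n → ℝ) (b : Fin p → ℝ) : 0 ≤ Qhat y x b := En_sq_nonneg _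

lemma sqrt_Qhat (y : Fin n → ℝ) (b : Fin p → ℝ) :
    √(Qhat y x b) = nrm fun i => y i - fit x b i := rfl

lemma l1Norm_nonneg (b : Fin p → ℝ) : 0 ≤ l1Norm b := Finset.sum_nonneg fun _ _ => abs_nonneg _

lemma mem_supp {b : Fin p → ℝ} {j : Fin p} : j ∈ supp b ↔ b j ≠ 0 := by simp [supp]

lemma card_supp_le_of_forall {b : Fin p → ℝ} {T : Finset (Fin p)} (h : ∀ j ∉ T, b j = 0) :
    (supp b).card ≤ T.card :=
  Finset.card_le_card fun j hj => by_contra fun hT => mem_supp.1 hj (h j hT)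

lemma card_supp_sub_le (b b' : Fin p → ℝ) :
    (supp (b - b')).card ≤ (supp b).card + (supp b').card := by
  classical
  refine (card_supp_le_of_forall (T := supp b ∪ supp b') fun j hj => ?_).trans
    (Finset.card_union_le _ _)
  simp only [Finset.mem_union, mem_supp, not_or, not_not] at hj
  simp [hj]

lemma l1Norm_eq_split (T : Finset (Fin p)) (b : Fin p → ℝ) :
    l1Norm b = ∑ j ∈ T, |b j| + ∑ j ∈ Tᶜ, |b j| := (Finset.sum_add_sum_compl T _).symm

/-- Moving from a vector supported on `T` increases the `ℓ¹` norm off `T` and can decrease it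
on `T` only. -/
lemma l1Norm_sub_le (b₀ b : Fin p → ℝ) :
    l1Norm b₀ - l1Norm b ≤
      ∑ j ∈ supp b₀, |(b - b₀) j| - ∑ j ∈ (supp b₀)ᶜ, |(b - b₀) j| := by
  rw [l1Norm_eq_split (supp b₀) b₀, l1Norm_eq_split (supp b₀) b]
  have h1 : ∑ j ∈ (supp b₀)ᶜ, |b₀ j| = 0 := Finset.sum_eq_zero fun j hj => by
    have := mem_supp.not.1 (Finset.mem_compl.1 hj)
    simpa using this
  have h2 : ∑ j ∈ (supp b₀)ᶜ, |(b - b₀) j| = ∑ j ∈ (supp b₀)ᶜ, |b j| :=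
    Finset.sum_congr rfl fun j hj => by
      have := mem_supp.not.1 (Finset.mem_compl.1 hj)
      simp only [not_not] at this
      simp [this]
  have h3 : ∑ j ∈ supp b₀, |b₀ j| - ∑ j ∈ supp b₀, |b j| ≤ ∑ j ∈ supp b₀, |(b - b₀) j| := by
    rw [← Finset.sum_sub_distrib]
    refine Finset.sum_le_sum fun j _ => ?_
    rw [Pi.sub_apply, abs_sub_comm]
    exact abs_sub_abs_le_abs_sub _ _
  linarith

lemma sum_abs_le_sqrt_card (T : Finset (Fin p)) (b : Fin p → ℝ) :
    ∑ j ∈ T, |b j| ≤ √(T.card * ∑ j, b j ^ 2) := by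
  refine Real.le_sqrt_of_sq_le ?_
  refine sq_sum_le_card_mul_sum_sq.trans ?_
  gcongr
  simp only [sq_abs]
  exact Finset.sum_le_sum_of_subset_of_nonneg (Finset.subset_univ _) fun _ _ _ => sq_nonneg _

lemma l1Norm_eq_sum_supp (b : Fin p → ℝ) : l1Norm b = ∑ j ∈ supp b, |b j| := by
  refine (Finset.sum_subset (Finset.subset_univ _) fun j _ hj => ?_).symm
  simpa using mem_supp.not.1 hj

end Empirical

/-! ### Sparse eigenvalues control the quadratic form on all vectors -/

section Transfer

variable {n p : ℕ}

/-- If a quadratic form is nonnegative on sparse vectors, then along the path from a sparse vector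
`u` in the direction of a vector `θ` of unit `ℓ¹` norm it is nonnegative up to an explicit
correction. This is the expectation of the form at the sparse vector `u + e₁ + ⋯ + e_k`, where the
`e`'s are independent signed basis vectors with mean `θ`; the expectation is taken one
vector at a time. -/
lemma quadForm_add_smul_nonneg (B : LinearMap.BilinForm ℝ (Fin p → ℝ)) (θ : Fin p → ℝ)
    (hθ : l1Norm θ = 1) (k : ℕ) : ∀ (r : ℕ) (u : Fin p → ℝ), (supp u).card ≤ r →
      (∀ d : Fin p → ℝ, (supp d).card ≤ r + k → 0 ≤ B d d) →
      0 ≤ B (u + (k : ℝ) • θ) (u + (k : ℝ) • θ) +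
        k * (∑ j, |θ j| * B (Pi.single j 1) (Pi.single j 1) - B θ θ) := by
  induction k with
  | zero => intro r u hu hB; simpa using hB u (by simpa using hu)
  | succ k ih =>
    intro r u hu hB
    set D := ∑ j, |θ j| * B (Pi.single j 1) (Pi.single j 1) with hD
    set e : Fin p → Fin p → ℝ := fun j => Pi.single j (SignType.sign (θ j) : ℝ) with he
    have hθe : ∑ j, |θ j| • e j = θ := by
      ext i
      rw [Finset.sum_apply, Finset.sum_eq_single i]
      · simp [he]
      · intro j _ hj
        simp [he, hj.symm]
      · simp
    have hstep : ∀ j, 0 ≤ B (u + e j + (k : ℝ) • θ) (u + e j + (k : ℝ) • θ) +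
        k * (D - B θ θ) := by
      intro j
      refine ih (r + 1) (u + e j) ?_ fun d hd => hB d (by omega)
      classical
      refine (card_supp_le_of_forall (T := insert j (supp u)) fun i hi => ?_).trans
        ((Finset.card_insert_le _ _).trans (by omega))
      simp only [Finset.mem_insert, mem_supp, not_or, not_not] at hi
      simp [he, hi.1, hi.2]
    have hee : ∀ j, |θ j| * B (e j) (e j) = |θ j| * B (Pi.single j 1) (Pi.single j 1) := by
      intro j
      have h1 : e j = (SignType.sign (θ j) : ℝ) • Pi.single j 1 := by
        ext i
        by_cases h : i = j <;> simp [he, h]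
      rw [h1, map_smul, LinearMap.map_smul₂, smul_eq_mul, smul_eq_mul]
      rcases lt_trichotomy (θ j) 0 with h | h | h <;> simp [h]
    set a := u + (k : ℝ) • θ with ha
    have hexp : ∀ j, |θ j| * B (u + e j + (k : ℝ) • θ) (u + e j + (k : ℝ) • θ) =
        |θ j| * B a a + B a (|θ j| • e j) + B (|θ j| • e j) a +
          |θ j| * B (Pi.single j 1) (Pi.single j 1) := by
      intro j
      rw [show u + e j + (k : ℝ) • θ = a + e j by rw [ha]; abel, ← hee j]
      simp only [map_add, LinearMap.add_apply, map_smul, LinearMap.smul_apply, smul_eq_mul]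
      ring
    have hsum : 0 ≤ ∑ j, |θ j| * (B (u + e j + (k : ℝ) • θ) (u + e j + (k : ℝ) • θ) +
        k * (D - B θ θ)) :=
      Finset.sum_nonneg fun j _ => mul_nonneg (abs_nonneg _) (hstep j)
    simp only [mul_add (|θ _|), hexp, Finset.sum_add_distrib, ← Finset.sum_mul] at hsum
    have h1 : ∑ j, |θ j| = 1 := hθ
    have h2 : ∑ j, B a (|θ j| • e j) = B a θ := by rw [← map_sum, hθe]
    have h3 : ∑ j, B (|θ j| • e j) a = B θ a := by
      rw [← LinearMap.sum_apply, ← map_sum, hθe]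
    rw [h1, h2, h3, ← hD] at hsum
    have h4 : u + ((k + 1 : ℕ) : ℝ) • θ = a + θ := by
      rw [ha]; push_cast; rw [add_smul, one_smul]; abel
    rw [h4]
    simp only [map_add, LinearMap.add_apply]
    push_cast
    linarith

/-- Transfer principle: a quadratic form that is nonnegative on `m`-sparse vectors is bounded below
on all vectors by a multiple of `-‖d‖₁² / (m - 1)`. -/
lemma quadForm_ge_of_sparse (B : LinearMap.BilinForm ℝ (Fin p → ℝ)) {m : ℕ} (hm : 1 ≤ m)
    (hB : ∀ d : Fin p → ℝ, (supp d).card ≤ m → 0 ≤ B d d) {D : ℝ}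
    (hD : ∀ j, B (Pi.single j 1) (Pi.single j 1) ≤ D) (d : Fin p → ℝ) :
    0 ≤ (m - 1) * B d d + D * l1Norm d ^ 2 := by
  rcases (l1Norm_nonneg d).eq_or_lt with h0 | h0
  · have hd : d = 0 := by
      ext j
      have := (Finset.sum_eq_zero_iff_of_nonneg fun j _ => abs_nonneg (d j)).1 h0.symm j
        (Finset.mem_univ j)
      simpa using this
    simp [hd, l1Norm]
  set L := l1Norm d
  set θ := L⁻¹ • d with hθ
  have h1 : l1Norm θ = 1 := by
    simp only [l1Norm, hθ, Pi.smul_apply, smul_eq_mul, abs_mul, ← Finset.mul_sum]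
    rw [abs_of_pos (inv_pos.2 h0)]
    exact inv_mul_cancel₀ h0.ne'
  have h2 := quadForm_add_smul_nonneg B θ h1 m 0 0 (by simp [supp]) (by simpa using hB)
  have h3 : ∑ j, |θ j| * B (Pi.single j 1) (Pi.single j 1) ≤ D := by
    calc _ ≤ ∑ j, |θ j| * D := Finset.sum_le_sum fun j _ => by gcongr; exact hD j
      _ = D := by rw [← Finset.sum_mul, show ∑ j, |θ j| = 1 from h1, one_mul]
  have h4 : B d d = L ^ 2 * B θ θ := by
    rw [show d = L • θ by rw [hθ, smul_inv_smul₀ h0.ne']]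
    simp only [map_smul, LinearMap.smul_apply, smul_eq_mul]
    ring
  have hm' : (1 : ℝ) ≤ m := by exact_mod_cast hm
  simp only [zero_add, map_smul, LinearMap.smul_apply, smul_eq_mul] at h2
  have h5 : 0 ≤ (m : ℝ) * ((m - 1) * B θ θ + D) := by nlinarith
  have h6 : 0 ≤ (m - 1) * B θ θ + D := nonneg_of_mul_nonneg_right h5 (by linarith)
  rw [h4]
  nlinarith [mul_nonneg (sq_nonneg L) h6]

/-- The quadratic form `𝔼ₙ[(xᵢ'd)²]` is at least `κ ‖d‖²` on `m`-sparse vectors. -/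
def SparseLower (x : Fin n → Fin p → ℝ) (m κ : ℝ) : Prop :=
  ∀ d : Fin p → ℝ, ((supp d).card : ℝ) ≤ m → κ * ∑ j, d j ^ 2 ≤ nrm (fit x d) ^ 2

/-- The quadratic form `𝔼ₙ[(xᵢ'd)²]` is at most `κ ‖d‖²` on `m`-sparse vectors. -/
def SparseUpper (x : Fin n → Fin p → ℝ) (m κ : ℝ) : Prop :=
  ∀ d : Fin p → ℝ, ((supp d).card : ℝ) ≤ m → nrm (fit x d) ^ 2 ≤ κ * ∑ j, d j ^ 2

lemma SparseLower.transfer {x : Fin n → Fin p → ℝ} {κ : ℝ} {m : ℕ} (hm : 1 ≤ m) (hκ : 0 ≤ κ)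
    (h : SparseLower x m κ) (hx : ∀ j, (En fun i => x i j ^ 2) = 1) (d : Fin p → ℝ) :
    (m - 1) * (κ * ∑ j, d j ^ 2) ≤ (m - 1) * nrm (fit x d) ^ 2 + l1Norm d ^ 2 := by
  let B : LinearMap.BilinForm ℝ (Fin p → ℝ) :=
    LinearMap.mk₂ ℝ (fun b b' => (En fun i => fit x b i * fit x b' i) - κ * ∑ j, b j * b' j)
      (fun a b c => by
        simp only [fit_add, add_mul, En_add, Pi.add_apply, Finset.sum_add_distrib]; ring)
      (fun t a b => by
        simp only [fit_smul, mul_assoc, En_const_mul, Pi.smul_apply, smul_eq_mul,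
          ← Finset.mul_sum]; ring)
      (fun a b c => by
        simp only [fit_add, mul_add, En_add, Pi.add_apply, Finset.sum_add_distrib]; ring)
      (fun t a b => by
        simp only [fit_smul, mul_left_comm _ t, En_const_mul, Pi.smul_apply, smul_eq_mul,
          ← Finset.mul_sum]; ring)
  have hBd : ∀ d, B d d = nrm (fit x d) ^ 2 - κ * ∑ j, d j ^ 2 := by
    intro d
    rw [nrm_sq]
    simp only [B, LinearMap.mk₂_apply, ← sq]
  have := quadForm_ge_of_sparse B hm (fun d hd => by
      rw [hBd]; exact sub_nonneg.2 (h d (by exact_mod_cast hd))) (D := 1) (fun j => by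
      rw [hBd, nrm_sq]
      simp only [fit_single, one_mul, hx]
      have : 0 ≤ κ * ∑ k, (Pi.single j (1 : ℝ) : Fin p → ℝ) k ^ 2 := by positivity
      linarith) d
  rw [hBd] at this
  linarith

/-- Sparse lower eigenvalues give the compatibility condition: vectors whose `ℓ¹` mass off `T` is at
most `a` times their mass on `T` have `ℓ¹` mass on `T` controlled by the empirical norm. -/
lemma SparseLower.compat {x : Fin n → Fin p → ℝ} {κ a m : ℝ} (hκ : 0 < κ) (ha : 0 ≤ a)
    (h : SparseLower x m κ) (hx : ∀ j, (En fun i => x i j ^ 2) = 1) {T : Finset (Fin p)} {s : ℝ}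
    (hs : 1 ≤ s) (hT : (T.card : ℝ) ≤ s) (hm : 2 * (1 + a) ^ 2 * s / κ + 2 ≤ m) (d : Fin p → ℝ)
    (hd : ∑ j ∈ Tᶜ, |d j| ≤ a * ∑ j ∈ T, |d j|) :
    ∑ j ∈ T, |d j| ≤ √(2 * s / κ) * nrm (fit x d) := by
  have hm0 : 0 ≤ 2 * (1 + a) ^ 2 * s / κ := by positivity
  have hmf : m - 1 < ⌊m⌋₊ := by have := Nat.lt_floor_add_one m; linarith
  have hm1 : 1 ≤ ⌊m⌋₊ := Nat.le_floor (by push_cast; linarith)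
  have h' : SparseLower x (⌊m⌋₊ : ℝ) κ := fun d hd => h d (hd.trans (Nat.floor_le (by linarith)))
  have ht := h'.transfer hm1 hκ.le hx d
  set t := ∑ j ∈ T, |d j| with htdef
  set E := ∑ j, d j ^ 2
  set N := nrm (fit x d)
  have ht0 : 0 ≤ t := Finset.sum_nonneg fun _ _ => abs_nonneg _
  have hE : 0 ≤ E := Finset.sum_nonneg fun _ _ => sq_nonneg _
  have h1 : t ^ 2 ≤ s * E := by
    have := sum_abs_le_sqrt_card T d
    rw [Real.le_sqrt ht0 (by positivity)] at this
    exact this.trans (by gcongr)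
  have h2 : l1Norm d ≤ (1 + a) * t := by
    rw [l1Norm_eq_split T d]; linarith
  have h3 : l1Norm d ^ 2 ≤ (1 + a) ^ 2 * (s * E) := by
    calc _ ≤ ((1 + a) * t) ^ 2 := by gcongr; exact l1Norm_nonneg d
      _ = (1 + a) ^ 2 * t ^ 2 := by ring
      _ ≤ _ := by gcongr
  set M : ℝ := (⌊m⌋₊ : ℝ) - 1
  have hM : 2 * (1 + a) ^ 2 * s / κ ≤ M := by simp only [M]; linarith
  have hMpos : 0 < M := by
    refine lt_of_lt_of_le ?_ hM
    positivity
  rw [div_le_iff₀ hκ] at hM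
  have h4 : (1 + a) ^ 2 * (s * E) ≤ M * κ / 2 * E := by nlinarith
  have h5 : M * (κ / 2 * E) ≤ M * N ^ 2 := by nlinarith
  have h6 : κ / 2 * E ≤ N ^ 2 := le_of_mul_le_mul_left h5 hMpos
  refine abs_le_of_sq_le_sq' ?_ (mul_nonneg (Real.sqrt_nonneg _) (nrm_nonneg _)) |>.2
  rw [mul_pow, Real.sq_sqrt (by positivity)]
  calc t ^ 2 ≤ s * E := h1
    _ = 2 * s / κ * (κ / 2 * E) := by field_simp
    _ ≤ _ := by gcongr

lemma SparseLower.l1Norm_le {x : Fin n → Fin p → ℝ} {κ m k : ℝ} (hκ : 0 < κ)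
    (h : SparseLower x m κ) (d : Fin p → ℝ) (hd : ((supp d).card : ℝ) ≤ k) (hk : k ≤ m) :
    l1Norm d ≤ √(k / κ) * nrm (fit x d) := by
  have hk0 : 0 ≤ k := le_trans (by positivity) hd
  have h1 := h d (hd.trans hk)
  have h2 := sum_abs_le_sqrt_card (supp d) d
  rw [← l1Norm_eq_sum_supp, Real.le_sqrt (l1Norm_nonneg d) (by positivity)] at h2
  refine abs_le_of_sq_le_sq' ?_ (mul_nonneg (Real.sqrt_nonneg _) (nrm_nonneg _)) |>.2
  rw [mul_pow, Real.sq_sqrt (by positivity)]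
  calc l1Norm d ^ 2 ≤ k * ∑ j, d j ^ 2 := h2.trans (by gcongr)
    _ = k / κ * (κ * ∑ j, d j ^ 2) := by field_simp
    _ ≤ _ := by gcongr

end Transfer

/-! ### Deterministic bounds for Lasso, Post-Lasso and Square-root Lasso -/

section Deterministic

variable {n p : ℕ}

/-- The compatibility condition with cone constant `a` and modulus `φ`. -/
def Compat (x : Fin n → Fin p → ℝ) (T : Finset (Fin p)) (a φ : ℝ) : Prop :=
  ∀ d : Fin p → ℝ, ∑ j ∈ Tᶜ, |d j| ≤ a * ∑ j ∈ T, |d j| → ∑ j ∈ T, |d j| ≤ φ * nrm (fit x d)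

variable {x : Fin n → Fin p → ℝ} {y v r : Fin n → ℝ} {b₀ b : Fin p → ℝ}

lemma resid_eq (hy : ∀ i, y i = fit x b₀ i + r i + v i) (b : Fin p → ℝ) (i : Fin n) :
    y i - fit x b i = (v i + r i) - fit x (b - b₀) i := by
  rw [hy, fit_sub]
  ring

lemma Qhat_sub_Qhat (hy : ∀ i, y i = fit x b₀ i + r i + v i) (b : Fin p → ℝ) :
    Qhat y x b - Qhat y x b₀ = nrm (fit x (b - b₀)) ^ 2 -
      2 * (En fun i => v i * fit x (b - b₀) i) - 2 * (En fun i => r i * fit x (b - b₀) i) := by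
  rw [Qhat_eq_nrm_sq, Qhat_eq_nrm_sq]
  simp only [resid_eq hy]
  rw [nrm_sub_sq]
  simp only [sub_self, fit, Pi.zero_apply, mul_zero, Finset.sum_const_zero, sub_zero, add_mul]
  rw [En_add]
  ring

lemma Qhat_sub_Qhat_ge (hy : ∀ i, y i = fit x b₀ i + r i + v i) (b : Fin p → ℝ) :
    nrm (fit x (b - b₀)) ^ 2 - 2 * (scoreMax x v / n * l1Norm (b - b₀)) -
      2 * (nrm r * nrm (fit x (b - b₀))) ≤ Qhat y x b - Qhat y x b₀ := by
  rw [Qhat_sub_Qhat hy]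
  have h1 := le_of_abs_le (abs_En_mul_fit_le x v (b - b₀))
  have h2 := le_of_abs_le (abs_En_mul_le r (fit x (b - b₀)))
  linarith

/-- The prediction error of Lasso, when the penalty level dominates the score. -/
lemma IsLasso.nrm_le {lam θ φ : ℝ} (hb : IsLasso y x lam b)
    (hy : ∀ i, y i = fit x b₀ i + r i + v i) (hlam : 0 ≤ lam) (hθ : θ < 1)
    (hscore : 2 * scoreMax x v ≤ θ * lam) (hφ : 0 ≤ φ)
    (hc : Compat x (supp b₀) ((1 + θ) / (1 - θ)) φ) :
    nrm (fit x (b - b₀)) ≤ 2 * nrm r + 2 * (lam / n) * φ := by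
  have h1 := hb b₀
  have h2 := Qhat_sub_Qhat_ge hy b
  have h3 := l1Norm_sub_le b₀ b
  have h4 := l1Norm_eq_split (supp b₀) (b - b₀)
  set t := ∑ j ∈ supp b₀, |(b - b₀) j| with ht
  set t' := ∑ j ∈ (supp b₀)ᶜ, |(b - b₀) j| with ht'
  set N := nrm (fit x (b - b₀)) with hN
  set A := lam / n with hA
  have hA0 : 0 ≤ A := by positivity
  have ht0 : 0 ≤ t := Finset.sum_nonneg fun _ _ => abs_nonneg _
  have ht0' : 0 ≤ t' := Finset.sum_nonneg fun _ _ => abs_nonneg _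
  have hN0 : 0 ≤ N := nrm_nonneg _
  have hr0 := nrm_nonneg r
  have h5 : 2 * (scoreMax x v / n) ≤ θ * A := by
    rw [hA, ← mul_div_assoc, ← mul_div_assoc]
    gcongr
  have h6 : 2 * (scoreMax x v / n * l1Norm (b - b₀)) ≤ θ * A * (t + t') := by
    rw [h4, ← mul_assoc]
    gcongr
  have h7 : A * (l1Norm b₀ - l1Norm b) ≤ A * (t - t') := by gcongr
  have h8 : N ^ 2 ≤ 2 * (nrm r * N) + A * ((1 + θ) * t - (1 - θ) * t') := by linarith
  rcases le_total ((1 + θ) * t) ((1 - θ) * t') with h | h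
  · have h9 : N ^ 2 ≤ 2 * (nrm r * N) := by nlinarith
    have : N ≤ 2 * nrm r := by
      by_contra hcon
      push Not at hcon
      nlinarith
    have : 0 ≤ 2 * A * φ := by positivity
    linarith
  · have h9 : t ≤ φ * N := hc _ (by
      rw [div_mul_eq_mul_div, le_div_iff₀ (by linarith)]
      linarith)
    have h10 : (1 + θ) * t - (1 - θ) * t' ≤ 2 * (φ * N) := by nlinarith
    have h11 : N ^ 2 ≤ (2 * nrm r + 2 * A * φ) * N := by nlinarith
    by_contra hcon
    push Not at hcon
    have : 0 ≤ 2 * A * φ := by positivity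
    nlinarith

/-- First order condition of Lasso at a nonzero coefficient. -/
lemma IsLasso.foc {lam : ℝ} (hb : IsLasso y x lam b) {j : Fin p} (hj : b j ≠ 0) :
    2 * (En fun i => x i j * (y i - fit x b i)) = lam / n * SignType.sign (b j) := by
  set e : Fin n → ℝ := fun i => y i - fit x b i with he
  set G := En fun i => x i j * e i with hG
  set A := lam / n with hA
  set S := En fun i => x i j ^ 2 with hS
  have key : ∀ t : ℝ, |t| ≤ |b j| → 0 ≤ t * (A * SignType.sign (b j) - 2 * G) + t ^ 2 * S := by
    intro t ht
    have h1 := hb (b + Pi.single j t)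
    rw [Qhat_eq_nrm_sq, Qhat_eq_nrm_sq] at h1
    have h2 : (fun i => y i - fit x (b + Pi.single j t) i) = fun i => e i - t * x i j := by
      funext i
      rw [fit_add, fit_single, he]
      ring
    rw [h2, nrm_sub_sq e, nrm_const_mul, mul_pow, sq_abs, nrm_sq (fun i => x i j)] at h1
    change nrm e ^ 2 + A * l1Norm b ≤ _ at h1
    have h3 : (En fun i => e i * (t * x i j)) = t * G := by
      rw [hG, ← En_const_mul]
      congr 1
      funext i
      ring
    have h4 : l1Norm (b + Pi.single j t) - l1Norm b = t * SignType.sign (b j) := by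
      unfold l1Norm
      rw [← Finset.sum_sub_distrib, Finset.sum_eq_single j]
      · rw [Pi.add_apply, Pi.single_eq_same]
        rcases lt_or_gt_of_ne hj with h | h
        · rw [sign_neg h, abs_of_neg h] at *
          have := abs_le.1 ht
          rw [abs_of_nonpos (by linarith)]
          simp
        · rw [sign_pos h, abs_of_pos h] at *
          have := abs_le.1 ht
          rw [abs_of_nonneg (by linarith)]
          simp
      · intro k _ hk
        simp [hk]
      · simp
    rw [h3] at h1
    have h5 : A * l1Norm (b + Pi.single j t) = A * l1Norm b + A * (t * SignType.sign (b j)) := by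
      rw [← h4]; ring
    rw [h5] at h1
    nlinarith
  have hS0 : 0 ≤ S := En_sq_nonneg _
  set W := A * SignType.sign (b j) - 2 * G with hW
  -- A linear term that dominates the quadratic one near zero in both directions must vanish.
  have hW0 : W = 0 := by
    by_contra hne
    have hbj : 0 < |b j| := abs_pos.2 hj
    have hWp : 0 < |W| := abs_pos.2 hne
    set τ := min |b j| (|W| / (2 * (S + 1))) with hτ
    have hτ0 : 0 < τ := lt_min hbj (by positivity)
    have hτ1 : τ ≤ |b j| := min_le_left _ _
    have hτ2 : τ * (2 * (S + 1)) ≤ |W| := by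
      rw [← le_div_iff₀ (by positivity)]
      exact min_le_right _ _
    have h1 := key (-(SignType.sign W : ℝ) * τ) (by
      rcases lt_or_gt_of_ne hne with h | h <;> simp [h, abs_of_pos hτ0, hτ1])
    have h2 : (SignType.sign W : ℝ) * W = |W| := by
      rw [sign_mul_self]
    have h3 : (SignType.sign W : ℝ) ^ 2 = 1 := by
      rcases lt_or_gt_of_ne hne with h | h <;> simp [h]
    have h4 : -(SignType.sign W : ℝ) * τ * W + (-(SignType.sign W : ℝ) * τ) ^ 2 * S =
        τ * (τ * S - |W|) := by
      linear_combination (-τ) * h2 + τ ^ 2 * S * h3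
    rw [h4] at h1
    nlinarith
  linarith

/-- Any set of selected regressors has a size that is limited by the prediction error: on it, the
residuals have correlations of the size of the penalty. -/
lemma IsLasso.card_le {lam θ κ m : ℝ} (hb : IsLasso y x lam b)
    (hy : ∀ i, y i = fit x b₀ i + r i + v i) (hlam : 0 ≤ lam)
    (hscore : 2 * scoreMax x v ≤ θ * lam) (hκ : SparseUpper x m κ) {S : Finset (Fin p)}
    (hS : S ⊆ supp b) (hSm : (S.card : ℝ) ≤ m) :
    (1 - θ) * (lam / n) * S.card ≤ 2 * √(κ * S.card) * (nrm r + nrm (fit x (b - b₀))) := by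
  set A := lam / n with hA
  have hA0 : 0 ≤ A := by positivity
  classical
  set u : Fin p → ℝ := fun j => if j ∈ S then SignType.sign (b j) else 0 with hu
  have husupp : ∀ j ∉ S, u j = 0 := fun j hj => by simp [hu, hj]
  have hsq : ∀ j ∈ S, (SignType.sign (b j) : ℝ) * SignType.sign (b j) = 1 := by
    intro j hj
    have := mem_supp.1 (hS hj)
    rcases lt_or_gt_of_ne this with h | h <;> simp [h]
  have h1 : 2 * (En fun i => (y i - fit x b i) * fit x u i) = A * S.card := by
    rw [En_mul_fit, Finset.mul_sum]
    calc _ = ∑ j ∈ S, A := by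
          rw [← Finset.sum_subset (Finset.subset_univ S) fun j _ hj => by simp [husupp j hj]]
          refine Finset.sum_congr rfl fun j hj => ?_
          have := hb.foc (mem_supp.1 (hS hj))
          simp only [hu, hj, if_true]
          rw [mul_left_comm, this, mul_left_comm, hsq j hj, mul_one]
      _ = A * S.card := by simp [mul_comm]
  have hl1 : l1Norm u = S.card := by
    unfold l1Norm
    rw [← Finset.sum_subset (Finset.subset_univ S) fun j _ hj => by simp [husupp j hj],
      Finset.card_eq_sum_ones]
    push_cast
    refine Finset.sum_congr rfl fun j hj => ?_
    have := mem_supp.1 (hS hj)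
    simp only [hu, hj, if_true]
    rcases lt_or_gt_of_ne this with h | h <;> simp [h]
  have hl2 : ∑ j, u j ^ 2 = S.card := by
    rw [← Finset.sum_subset (Finset.subset_univ S) fun j _ hj => by simp [husupp j hj],
      Finset.card_eq_sum_ones]
    push_cast
    refine Finset.sum_congr rfl fun j hj => ?_
    simp only [hu, hj, if_true]
    rw [sq, hsq j hj]
  have h2 : nrm (fit x u) ≤ √(κ * S.card) := by
    refine Real.le_sqrt_of_sq_le ?_
    rw [← hl2]
    exact hκ u (le_trans (by exact_mod_cast card_supp_le_of_forall husupp) hSm)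
  have h3 : (En fun i => (y i - fit x b i) * fit x u i) =
      (En fun i => v i * fit x u i) + ((En fun i => r i * fit x u i) -
        En fun i => fit x (b - b₀) i * fit x u i) := by
    rw [← En_sub, ← En_add]
    congr 1
    funext i
    rw [resid_eq hy]
    ring
  have h4 := le_of_abs_le (abs_En_mul_fit_le x v u)
  have h5 := le_of_abs_le (abs_En_mul_le r (fit x u))
  have h6 := neg_le_of_abs_le (abs_En_mul_le (fit x (b - b₀)) (fit x u))
  have h7 : 2 * (scoreMax x v / n * l1Norm u) ≤ θ * A * S.card := by
    rw [hl1, ← mul_assoc]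
    refine mul_le_mul_of_nonneg_right ?_ (Nat.cast_nonneg _)
    rw [hA, ← mul_div_assoc, ← mul_div_assoc]
    gcongr
  have h8 : (nrm r + nrm (fit x (b - b₀))) * nrm (fit x u) ≤
      (nrm r + nrm (fit x (b - b₀))) * √(κ * S.card) := by
    gcongr
    exact add_nonneg (nrm_nonneg _) (nrm_nonneg _)
  rw [h3] at h1
  linarith

/-- The prediction error of least squares in the model selected by a penalised estimate, when the
selected model is sparse. -/
lemma IsLasso.nrm_le_of_isLeastSquares {lam ρ E : ℝ} {b' : Fin p → ℝ} (hb : IsLasso y x lam b)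
    (hy : ∀ i, y i = fit x b₀ i + r i + v i) (hlam : 0 ≤ lam) (hρ : 0 ≤ ρ)
    (hscore : 2 * scoreMax x v ≤ lam) (hb' : IsLeastSquares y x (supp b) b')
    (hl : l1Norm (b - b₀) ≤ ρ * nrm (fit x (b - b₀)))
    (hl' : l1Norm (b' - b₀) ≤ ρ * nrm (fit x (b' - b₀)))
    (hE1 : nrm r + lam / n * ρ ≤ E) (hE2 : nrm (fit x (b - b₀)) ≤ 2 * E) :
    nrm (fit x (b' - b₀)) ≤ 4 * E := by
  have h1 := Qhat_sub_Qhat_ge hy b'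
  have h2 := hb'.2 b fun j hj => by simpa using mem_supp.not.1 hj
  have h3 := hb b₀
  set A := lam / n with hA
  have hA0 : 0 ≤ A := by positivity
  set N := nrm (fit x (b - b₀))
  set N' := nrm (fit x (b' - b₀))
  have hN : 0 ≤ N := nrm_nonneg _
  have hN' : 0 ≤ N' := nrm_nonneg _
  have hr := nrm_nonneg r
  have h4 : l1Norm b₀ - l1Norm b ≤ ρ * N := by
    refine le_trans ?_ hl
    unfold l1Norm
    rw [← Finset.sum_sub_distrib]
    refine Finset.sum_le_sum fun j _ => ?_
    rw [Pi.sub_apply, abs_sub_comm]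
    exact abs_sub_abs_le_abs_sub _ _
  have h5 : A * (l1Norm b₀ - l1Norm b) ≤ A * (ρ * N) := by gcongr
  have h6 : 2 * (scoreMax x v / n * l1Norm (b' - b₀)) ≤ A * (ρ * N') := by
    rw [← mul_assoc]
    refine mul_le_mul ?_ hl' (l1Norm_nonneg _) hA0
    rw [hA, ← mul_div_assoc]
    gcongr
  have h7 : N' ^ 2 ≤ 2 * (nrm r * N') + A * (ρ * N') + A * (ρ * N) := by linarith
  have hAρ : 0 ≤ A * ρ := by positivity
  have h8 : A * ρ ≤ E := by linarith
  have h9 : A * (ρ * N) ≤ 2 * E ^ 2 := by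
    calc A * (ρ * N) = (A * ρ) * N := by ring
      _ ≤ E * (2 * E) := by gcongr; linarith
      _ = _ := by ring
  have hE : 0 ≤ E := by linarith
  have h10 : N' ^ 2 ≤ 2 * E * N' + 2 * E ^ 2 := by nlinarith
  by_contra hcon
  push Not at hcon
  nlinarith

/-- A Square-root Lasso estimate is a Lasso estimate whose noise level is its own residual standard
deviation: `√Q ≤ (Q / τ + τ) / 2`, with equality at `√Q = τ`. -/
lemma IsSqrtLasso.isLasso {lam : ℝ} (hb : IsSqrtLasso y x lam b) (h0 : 0 < √(Qhat y x b)) :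
    IsLasso y x (2 * √(Qhat y x b) * lam) b := by
  intro b'
  have h := hb b'
  set τ := √(Qhat y x b)
  have h1 : Qhat y x b = τ ^ 2 := (Real.sq_sqrt (Qhat_nonneg _ _ _)).symm
  have h2 : Qhat y x b' = √(Qhat y x b') ^ 2 := (Real.sq_sqrt (Qhat_nonneg _ _ _)).symm
  rw [h1, h2]
  set τ' := √(Qhat y x b')
  have h3 := mul_le_mul_of_nonneg_left h h0.le
  have h4 : 2 * τ * lam / n = 2 * τ * (lam / n) := by ring
  rw [h4]
  nlinarith [sq_nonneg (τ - τ')]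

/-- From an upper and a lower bound on the change `D` of a convex criterion to a bound on `|D|` that
is free of the `ℓ¹` masses `t` on and `t'` off the support. Outside the cone where compatibility
applies, the approximation error `ρ` alone controls the masses. -/
lemma abs_le_of_cone {A θ φ ρ N t t' D : ℝ} (hA0 : 0 ≤ A) (hθ0 : 0 ≤ θ) (hθ : θ < 1)
    (hφ : 0 ≤ φ) (hρ0 : 0 ≤ ρ) (hN0 : 0 ≤ N) (ht0 : 0 ≤ t) (ht0' : 0 ≤ t')
    (hup : D ≤ A * (t - t')) (hlow : -D ≤ θ * A * (t + t') + ρ * N)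
    (hcone : t' ≤ 2 * (1 + θ) / (1 - θ) * t → t ≤ φ * N) :
    |D| ≤ 5 / (1 - θ) * (A * φ + ρ) * N := by
  have h15 : (1 - θ) * (A * t') ≤ (1 + θ) * (A * t) + ρ * N := by nlinarith
  have hθ' : 0 < 1 - θ := by linarith
  have h16 : (1 - θ) * (A * (t + t')) ≤ 4 * ((A * φ + ρ) * N) := by
    have hAφ : 0 ≤ A * φ * N := by positivity
    have hρN : 0 ≤ ρ * N := by positivity
    rcases le_total ((1 - θ) * t') (2 * (1 + θ) * t) with h | h
    · have h9 : t ≤ φ * N := hcone (by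
        rw [div_mul_eq_mul_div, le_div_iff₀ hθ']
        linarith)
      have h17 : (1 - θ) * (t + t') ≤ 4 * (φ * N) := by nlinarith
      have := mul_le_mul_of_nonneg_left h17 hA0
      linarith
    · have h17 : (1 - θ) * (A * t') ≥ 2 * (1 + θ) * (A * t) := by
        have := mul_le_mul_of_nonneg_left h hA0
        linarith
      have hAt : 0 ≤ A * t := by positivity
      have h18 : (1 - θ) * (A * t') ≤ 2 * (ρ * N) := by linarith
      nlinarith
  have h19 : A * (t + t') ≤ 4 / (1 - θ) * ((A * φ + ρ) * N) := by
    rw [div_mul_eq_mul_div, le_div_iff₀ hθ']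
    linarith
  have h20 : |D| ≤ A * (t + t') + ρ * N := by
    have hAt : 0 ≤ A * t := by positivity
    have hAt' : 0 ≤ A * t' := by positivity
    have hρN : 0 ≤ ρ * N := by positivity
    have h22 : θ * A * (t + t') ≤ A * (t + t') := by nlinarith
    rw [abs_le]
    constructor <;> linarith
  have h21 : ρ * N ≤ 1 / (1 - θ) * ((A * φ + ρ) * N) := by
    rw [div_mul_eq_mul_div, le_div_iff₀ hθ']
    have hAφ : 0 ≤ A * φ * N := by positivity
    have hρN : 0 ≤ θ * (ρ * N) := by positivity
    linarith
  calc |D| ≤ A * (t + t') + ρ * N := h20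
    _ ≤ 4 / (1 - θ) * ((A * φ + ρ) * N) + 1 / (1 - θ) * ((A * φ + ρ) * N) := add_le_add h19 h21
    _ = 5 / (1 - θ) * (A * φ + ρ) * N := by ring

/-- The residual standard deviation of Square-root Lasso is close to that of the sparse
approximation. -/
lemma IsSqrtLasso.abs_sub_le {lam θ φ : ℝ} (hb : IsSqrtLasso y x lam b)
    (hy : ∀ i, y i = fit x b₀ i + r i + v i) (hlam : 0 ≤ lam) (hθ0 : 0 ≤ θ) (hθ : θ < 1)
    (h0 : 0 < √(Qhat y x b₀)) (hscore : scoreMax x v ≤ θ * lam * √(Qhat y x b₀)) (hφ : 0 ≤ φ)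
    (hc : Compat x (supp b₀) (2 * (1 + θ) / (1 - θ)) φ) :
    |√(Qhat y x b) - √(Qhat y x b₀)| ≤ 5 / (1 - θ) * (lam / n * φ + nrm r / √(Qhat y x b₀)) *
      (√(Qhat y x b) + √(Qhat y x b₀)) := by
  have h1 := hb b₀
  have h3 := l1Norm_sub_le b₀ b
  have h4 := l1Norm_eq_split (supp b₀) (b - b₀)
  have hres : √(Qhat y x b₀) = nrm fun i => v i + r i := by
    rw [sqrt_Qhat]
    congr 1
    funext i
    rw [hy]
    ring
  have hresb : √(Qhat y x b) = nrm fun i => (v i + r i) - fit x (b - b₀) i := by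
    rw [sqrt_Qhat]
    congr 1
    funext i
    exact resid_eq hy b i
  set τ := √(Qhat y x b) with hτ
  set τ₀ := √(Qhat y x b₀) with hτ₀
  set t := ∑ j ∈ supp b₀, |(b - b₀) j| with ht
  set t' := ∑ j ∈ (supp b₀)ᶜ, |(b - b₀) j| with ht'
  set N := nrm (fit x (b - b₀)) with hN
  set A := lam / n with hA
  have hτn : 0 ≤ τ := Real.sqrt_nonneg _
  have hA0 : 0 ≤ A := by positivity
  have ht0 : 0 ≤ t := Finset.sum_nonneg fun _ _ => abs_nonneg _
  have ht0' : 0 ≤ t' := Finset.sum_nonneg fun _ _ => abs_nonneg _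
  have hN0 : 0 ≤ N := nrm_nonneg _
  have hr0 := nrm_nonneg r
  set ρ := nrm r / τ₀ with hρ
  have hρ0 : 0 ≤ ρ := by positivity
  have hNle : N ≤ τ + τ₀ := by
    have := nrm_sub_le (fun i => v i + r i) fun i => (v i + r i) - fit x (b - b₀) i
    simp only [sub_sub_cancel] at this
    rw [← hres, ← hresb] at this
    linarith
  have h7 : A * (l1Norm b₀ - l1Norm b) ≤ A * (t - t') := by gcongr
  have hup : τ - τ₀ ≤ A * (t - t') := by linarith
  -- The lower bound is the subgradient inequality for the convex function `b ↦ √Q̂(b)` at `b₀`.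
  have hlow : τ₀ - τ ≤ θ * A * (t + t') + ρ * N := by
    have h8 := le_of_abs_le (abs_En_mul_le (fun i => v i + r i)
      fun i => (v i + r i) - fit x (b - b₀) i)
    rw [← hres, ← hresb] at h8
    have h9 : (En fun i => (v i + r i) * ((v i + r i) - fit x (b - b₀) i)) =
        τ₀ ^ 2 - ((En fun i => v i * fit x (b - b₀) i) + En fun i => r i * fit x (b - b₀) i) := by
      rw [hres, nrm_sq, ← En_add, ← En_sub]
      congr 1
      funext i
      ring
    have h10 := le_of_abs_le (abs_En_mul_fit_le x v (b - b₀))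
    have h11 := le_of_abs_le (abs_En_mul_le r (fit x (b - b₀)))
    have h12 : scoreMax x v / n * l1Norm (b - b₀) ≤ τ₀ * (θ * A * (t + t')) := by
      rw [h4, ← mul_assoc]
      gcongr
      rw [hA]
      calc scoreMax x v / n ≤ (θ * lam * τ₀) / n := by gcongr
        _ = _ := by ring
    have h13 : nrm r * N = τ₀ * (ρ * N) := by rw [hρ]; field_simp
    have h14 : τ₀ * (τ₀ - τ) ≤ τ₀ * (θ * A * (t + t') + ρ * N) := by
      rw [h9] at h8
      nlinarith
    exact le_of_mul_le_mul_left h14 h0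
  have := abs_le_of_cone hA0 hθ0 hθ hφ hρ0 hN0 ht0 ht0' hup (by linarith) (hc _)
  refine this.trans ?_
  have hθ' : 0 < 1 - θ := by linarith
  gcongr

end Deterministic

/-! ### Linear forms in standard normal vectors -/

section Gaussian

instance (d : ℕ) : IsProbabilityMeasure (stdNormal d) := by unfold stdNormal; infer_instance

variable {n : ℕ}

lemma hasLaw_eval_stdNormal (i : Fin n) :
    HasLaw (fun g : Fin n → ℝ => g i) (gaussianReal 0 1) (stdNormal n) :=
  (measurePreserving_eval (fun _ : Fin n => gaussianReal 0 1) i).hasLaw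

lemma iIndepFun_stdNormal : iIndepFun (fun (i : Fin n) (g : Fin n → ℝ) => g i) (stdNormal n) :=
  iIndepFun_pi (μ := fun _ : Fin n => gaussianReal 0 1) (X := fun _ => id) fun _ => aemeasurable_id

lemma hasGaussianLaw_stdNormal :
    HasGaussianLaw (fun (g : Fin n → ℝ) => (g · : Fin n → ℝ)) (stdNormal n) :=
  iIndepFun_stdNormal.hasGaussianLaw fun i => (hasLaw_eval_stdNormal i).hasGaussianLaw

lemma memLp_eval_stdNormal (i : Fin n) : MemLp (fun g : Fin n → ℝ => g i) 2 (stdNormal n) :=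
  (hasLaw_eval_stdNormal i).hasGaussianLaw.memLp_two

lemma memLp_linear (a : Fin n → ℝ) :
    MemLp (fun g : Fin n → ℝ => ∑ i, a i * g i) 2 (stdNormal n) :=
  memLp_finsetSum _ fun i _ => (memLp_eval_stdNormal i).const_mul (a i)

lemma integral_eval_stdNormal (i : Fin n) : ∫ g : Fin n → ℝ, g i ∂stdNormal n = 0 := by
  have := (hasLaw_eval_stdNormal i).integral_eq
  rw [this]
  exact integral_id_gaussianReal

lemma integral_linear (a : Fin n → ℝ) :
    ∫ g : Fin n → ℝ, ∑ i, a i * g i ∂stdNormal n = 0 := by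
  rw [integral_finsetSum _ fun i _ =>
    ((memLp_eval_stdNormal i).integrable one_le_two).const_mul (a i)]
  simp [integral_const_mul, integral_eval_stdNormal]

lemma covariance_linear (a b : Fin n → ℝ) :
    cov[fun g : Fin n → ℝ => ∑ i, a i * g i, fun g => ∑ i, b i * g i; stdNormal n] =
      ∑ i, a i * b i := by
  rw [covariance_fun_sum_fun_sum (fun i => (memLp_eval_stdNormal i).const_mul (a i))
    fun i => (memLp_eval_stdNormal i).const_mul (b i)]
  simp only [covariance_const_mul_left, covariance_const_mul_right]
  refine Finset.sum_congr rfl fun i _ => ?_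
  rw [Finset.sum_eq_single i]
  · rw [covariance_self (memLp_eval_stdNormal i).aestronglyMeasurable.aemeasurable,
      (hasLaw_eval_stdNormal i).variance_eq, variance_id_gaussianReal]
    simp [mul_comm]
  · intro j _ hj
    rw [(iIndepFun_stdNormal.indepFun hj.symm).covariance_eq_zero (memLp_eval_stdNormal i)
      (memLp_eval_stdNormal j)]
    simp
  · simp

lemma variance_linear (a : Fin n → ℝ) :
    Var[fun g : Fin n → ℝ => ∑ i, a i * g i; stdNormal n] = ∑ i, a i ^ 2 := by
  rw [← covariance_self (memLp_linear a).aestronglyMeasurable.aemeasurable, covariance_linear]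
  simp [sq]

lemma hasGaussianLaw_linear (a : Fin n → ℝ) :
    HasGaussianLaw (fun g : Fin n → ℝ => ∑ i, a i * g i) (stdNormal n) := by
  have := hasGaussianLaw_stdNormal.map_fun
    (∑ i, a i • ContinuousLinearMap.proj (R := ℝ) (φ := fun _ : Fin n => ℝ) i)
  simpa using this

/-- A linear form with coefficients of unit Euclidean length is standard normal. -/
lemma hasLaw_linear {a : Fin n → ℝ} (ha : ∑ i, a i ^ 2 = 1) :
    HasLaw (fun g : Fin n → ℝ => ∑ i, a i * g i) (gaussianReal 0 1) (stdNormal n) where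
  aemeasurable := (hasGaussianLaw_linear a).aemeasurable
  map_eq := by
    rw [(hasGaussianLaw_linear a).map_eq_gaussianReal, integral_linear, variance_linear, ha]
    simp

/-- A matrix with orthonormal rows maps a standard normal vector to a standard normal vector. -/
lemma hasLaw_mulVec {d : ℕ} {W : Matrix (Fin d) (Fin n) ℝ} (hW : W * W.transpose = 1) :
    HasLaw (fun g : Fin n → ℝ => W.mulVec g) (stdNormal d) (stdNormal n) := by
  have hent : ∀ j k, ∑ i, W j i * W k i = (1 : Matrix (Fin d) (Fin d) ℝ) j k := by
    intro j k
    rw [← hW]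
    rfl
  have hlaw : ∀ j, HasLaw (fun g : Fin n → ℝ => ∑ i, W j i * g i) (gaussianReal 0 1)
      (stdNormal n) := fun j => hasLaw_linear (by simpa [sq] using hent j j)
  have hG : HasGaussianLaw (fun (g : Fin n → ℝ) (j : Fin d) => ∑ i, W j i * g i)
      (stdNormal n) := by
    have h := (hasGaussianLaw_stdNormal (n := n)).map_fun
      (ContinuousLinearMap.pi fun j => ∑ i, W j i •
        ContinuousLinearMap.proj (R := ℝ) (φ := fun _ : Fin n => ℝ) i)
    have heq : (fun (g : Fin n → ℝ) (j : Fin d) => ∑ i, W j i * g i) = fun g =>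
        (ContinuousLinearMap.pi fun j => ∑ i, W j i •
          ContinuousLinearMap.proj (R := ℝ) (φ := fun _ : Fin n => ℝ) i) g := by
      ext g j
      simp
    rw [heq]
    exact h
  have hind := hG.iIndepFun_of_covariance_eq_zero fun j k hjk => by
    rw [covariance_linear, hent, Matrix.one_apply_ne hjk]
  exact hind.hasLaw_pi hlaw

lemma integral_sq_gaussian : ∫ z : ℝ, z ^ 2 ∂gaussianReal 0 1 = 1 := by
  have h := variance_id_gaussianReal (μ := 0) (v := 1)
  rw [variance_of_integral_eq_zero aemeasurable_id integral_id_gaussianReal] at h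
  simpa using h

lemma memLp_sq_gaussian : MemLp (fun z : ℝ => z ^ 2) 2 (gaussianReal 0 1) := by
  rw [memLp_two_iff_integrable_sq (by fun_prop)]
  have := (memLp_id_gaussianReal' (μ := 0) (v := 1) 4 (by simp)).integrable_norm_pow (by norm_num)
  refine this.congr (.of_forall fun z => ?_)
  have : |z| ^ 4 = z ^ 4 := by rw [← abs_pow]; exact abs_of_nonneg (by positivity)
  simp only [id, Real.norm_eq_abs]
  rw [this]
  ring

/-- The law of large numbers for the squares of standard normal variables. -/
lemma tendsto_En_sq : Tendsto (fun q : Σ n, (Fin n → ℝ) => (En fun i => q.2 i ^ 2))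
    (whp stdNormal) (𝓝 1) := by
  have hmem : ∀ n (i : Fin n), MemLp (fun g : Fin n → ℝ => g i ^ 2) 2 (stdNormal n) :=
    fun n i => memLp_sq_gaussian.comp_measurePreserving
      (measurePreserving_eval (fun _ : Fin n => gaussianReal 0 1) i)
  have hint : ∀ n (i : Fin n), ∫ g : Fin n → ℝ, g i ^ 2 ∂stdNormal n = 1 := fun n i => by
    rw [← integral_sq_gaussian]
    exact (hasLaw_eval_stdNormal i).integral_comp (f := fun z => z ^ 2) (by fun_prop)
  have h := tendsto_whp_of_variance (μ := stdNormal)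
    (X := fun n (g : Fin n → ℝ) => (∑ i, g i ^ 2) / n) (m := fun _ => 1)
    (.of_forall fun n => ?_) ?_
    (e := fun n => Var[fun z : ℝ => z ^ 2; gaussianReal 0 1] / n) ?_ ?_
  · have h' := h.add_const 1
    simp only [sub_add_cancel, zero_add] at h'
    exact h'
  · have := (memLp_finsetSum Finset.univ fun i _ => hmem n i).const_mul (n : ℝ)⁻¹
    simpa only [div_eq_inv_mul] using this
  · filter_upwards [eventually_ge_atTop 1] with n hn
    rw [integral_div, integral_finsetSum _ fun i _ => (hmem n i).integrable one_le_two]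
    have : (n : ℝ) ≠ 0 := by positivity
    simp [hint, this]
  · exact tendsto_const_nhds.div_atTop tendsto_natCast_atTop_atTop
  · filter_upwards [eventually_ge_atTop 1] with n hn
    have hn0 : (n : ℝ) ≠ 0 := by positivity
    have h1 : (fun g : Fin n → ℝ => (∑ i, g i ^ 2) / n) =
        fun g => (n : ℝ)⁻¹ * (∑ i, fun g : Fin n → ℝ => g i ^ 2) g := by
      funext g
      simp [div_eq_inv_mul]
    rw [h1, variance_const_mul, IndepFun.variance_sum (fun i _ => hmem n i)]
    · have h2 : ∀ i : Fin n, Var[fun g : Fin n → ℝ => g i ^ 2; stdNormal n] =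
          Var[fun z : ℝ => z ^ 2; gaussianReal 0 1] := by
        intro i
        have hm := (hasLaw_eval_stdNormal i).map_eq
        rw [← hm, variance_map (X := fun z : ℝ => z ^ 2) (by fun_prop)
          (measurable_pi_apply i).aemeasurable]
        rfl
      simp only [h2, Finset.sum_const, Finset.card_univ, Fintype.card_fin, nsmul_eq_mul]
      apply le_of_eq
      field_simp
    · intro i _ j _ hij
      exact (iIndepFun_stdNormal.indepFun hij).comp (φ := fun z => z ^ 2) (ψ := fun z => z ^ 2)
        (by fun_prop) (by fun_prop)

/-- Exponentially small probability that the sum of squares of `n` standard normals is of smaller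
order than `n`. -/
lemma exists_stdNormal_En_sq_lt :
    ∃ a k : ℝ, 0 < a ∧ 0 < k ∧ ∀ n : ℕ, 1 ≤ n →
      (stdNormal n).real {g | (En fun i => g i ^ 2) < a} ≤ Real.exp (-(k * n)) := by
  set R := ∫ z : ℝ, Real.exp (-z ^ 2) ∂gaussianReal 0 1 with hR
  have hintg : Integrable (fun z : ℝ => Real.exp (-z ^ 2)) (gaussianReal 0 1) := by
    refine Integrable.of_bound (by fun_prop) 1 (.of_forall fun z => ?_)
    rw [Real.norm_eq_abs, abs_of_pos (Real.exp_pos _), Real.exp_le_one_iff]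
    nlinarith [sq_nonneg z]
  have hRpos : 0 < R := integral_exp_pos hintg
  -- The exponential moment is less than one, since `exp (-z²) < 1` away from zero.
  have hR1 : R < 1 := by
    have h1 : 0 < ∫ z : ℝ, (1 - Real.exp (-z ^ 2)) ∂gaussianReal 0 1 := by
      rw [integral_pos_iff_support_of_nonneg]
      · refine pos_iff_ne_zero.2 fun h0 => ?_
        have h2 := gaussianReal_absolutelyContinuous' 0 one_ne_zero h0
        have h3 : Set.Ioi (0 : ℝ) ⊆ Function.support fun z : ℝ => 1 - Real.exp (-z ^ 2) := by
          intro z hz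
          have hz' : 0 < z := hz
          have : Real.exp (-z ^ 2) < 1 := by
            rw [Real.exp_lt_one_iff]
            have := pow_pos hz' 2
            linarith
          rw [Function.mem_support]
          linarith
        have h4 := measure_mono_null h3 h2
        simp at h4
      · intro z
        have : Real.exp (-z ^ 2) ≤ 1 := by
          rw [Real.exp_le_one_iff]
          nlinarith [sq_nonneg z]
        simpa using this
      · exact (integrable_const _).sub hintg
    rw [integral_sub (integrable_const _) hintg] at h1
    simp at h1
    exact h1
  have hlog : 0 < -Real.log R := by
    have := Real.log_neg hRpos hR1
    linarith
  refine ⟨-Real.log R / 2, -Real.log R / 2, by linarith, by linarith, fun n hn => ?_⟩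
  have hn0 : (0 : ℝ) < n := by positivity
  have hprod : ∫ g : Fin n → ℝ, Real.exp (-∑ i, g i ^ 2) ∂stdNormal n = R ^ n := by
    have := integral_fintype_prod_eq_pow (ι := Fin n) (𝕜 := ℝ) (μ := gaussianReal 0 1)
      (fun z : ℝ => Real.exp (-z ^ 2))
    rw [Fintype.card_fin] at this
    rw [hR, ← this]
    refine integral_congr_ae (.of_forall fun g => ?_)
    simp only [← Real.exp_sum, Finset.sum_neg_distrib]
  have hmarkov := mul_meas_ge_le_integral_of_nonneg (μ := stdNormal n)
    (f := fun g : Fin n → ℝ => Real.exp (-∑ i, g i ^ 2)) (.of_forall fun g => (Real.exp_pos _).le)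
    (by
      refine Integrable.of_bound (Continuous.aestronglyMeasurable (by fun_prop)) 1
        (.of_forall fun z => ?_)
      rw [Real.norm_eq_abs, abs_of_pos (Real.exp_pos _), Real.exp_le_one_iff]
      have : 0 ≤ ∑ i, z i ^ 2 := by positivity
      linarith) (Real.exp (-(-Real.log R / 2 * n)))
  rw [hprod] at hmarkov
  have hRn : R ^ n = Real.exp (Real.log R * n) := by
    rw [mul_comm, Real.exp_nat_mul, Real.exp_log hRpos]
  have hsub : (stdNormal n).real {g | (En fun i => g i ^ 2) < -Real.log R / 2} ≤
      (stdNormal n).real {g | Real.exp (-(-Real.log R / 2 * n)) ≤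
        Real.exp (-∑ i, g i ^ 2)} := by
    refine measureReal_mono fun g hg => ?_
    simp only [Set.mem_ofPred_eq, En] at hg ⊢
    rw [div_lt_iff₀ hn0] at hg
    exact Real.exp_le_exp.2 (by linarith)
  refine hsub.trans ?_
  rw [hRn] at hmarkov
  refine le_of_mul_le_mul_left (hmarkov.trans_eq ?_) (Real.exp_pos (-(-Real.log R / 2 * n)))
  rw [← Real.exp_add]
  congr 1
  ring

lemma gaussian_Ioi_le {t : ℝ} (ht : 0 ≤ t) :
    (gaussianReal 0 1).real (Set.Ioi t) ≤ Real.exp (-(t ^ 2 / 2)) := by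
  have h := measure_ge_le_exp_mul_mgf (μ := gaussianReal 0 1) (X := id) t ht
    (integrable_exp_mul_gaussianReal t)
  rw [mgf_id_gaussianReal, ← Real.exp_add] at h
  refine (measureReal_mono fun z hz => ?_).trans (h.trans_eq ?_)
  · exact (Set.mem_Ioi.1 hz).le
  · congr 1
    norm_num
    ring

lemma gaussian_Iic_eq (t : ℝ) :
    (gaussianReal 0 1).real (Set.Iic t) = 1 - (gaussianReal 0 1).real (Set.Ioi t) := by
  rw [← Set.compl_Ioi, measureReal_compl measurableSet_Ioi]
  simp

lemma gaussian_abs_le (t : ℝ) :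
    (gaussianReal 0 1).real {z | t < |z|} ≤ 2 * (gaussianReal 0 1).real (Set.Ioi t) := by
  have h1 : {z : ℝ | t < |z|} ⊆ Set.Ioi t ∪ (fun z => -z) ⁻¹' Set.Ioi t := by
    intro z hz
    exact lt_abs.1 (show t < |z| from hz)
  have h2 : (gaussianReal 0 1).real ((fun z => -z) ⁻¹' Set.Ioi t) =
      (gaussianReal 0 1).real (Set.Ioi t) := by
    rw [← map_measureReal_apply measurable_neg measurableSet_Ioi, gaussianReal_map_neg, neg_zero]
  refine (measureReal_mono h1).trans ((measureReal_union_le _ _).trans ?_)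
  rw [h2]
  linarith

lemma gaussian_Iic_lt_one (t : ℝ) : (gaussianReal 0 1).real (Set.Iic t) < 1 := by
  rw [gaussian_Iic_eq, sub_lt_self_iff, measureReal_def]
  refine ENNReal.toReal_pos (fun h0 => ?_) (measure_ne_top _ _)
  have := gaussianReal_absolutelyContinuous' 0 one_ne_zero h0
  simp at this

lemma gaussian_abs_le_lt_one (t : ℝ) : (gaussianReal 0 1).real {z | |z| ≤ t} < 1 :=
  (measureReal_mono fun z hz => (le_abs_self z).trans hz).trans_lt (gaussian_Iic_lt_one t)

end Gaussian

/-! ### Quantiles and penalty levels -/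

section Quantile

lemma quantile_set_nonempty (ν : Measure ℝ) [IsProbabilityMeasure ν] {q : ℝ} (hq : q < 1) :
    {t : ℝ | q ≤ ν.real (Set.Iic t)}.Nonempty := by
  have h := (tendsto_cdf_atTop ν).eventually_const_lt hq
  obtain ⟨t, ht⟩ := h.exists
  exact ⟨t, by simpa [← cdf_eq_real] using ht.le⟩

lemma quantile_set_bddBelow (ν : Measure ℝ) [IsProbabilityMeasure ν] {q : ℝ} (hq : 0 < q) :
    BddBelow {t : ℝ | q ≤ ν.real (Set.Iic t)} := by
  obtain ⟨t, ht⟩ := ((tendsto_cdf_atBot ν).eventually_lt_const hq).exists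
  refine ⟨t, fun u hu => ?_⟩
  by_contra hcon
  push Not at hcon
  have h1 : q ≤ cdf ν u := by rw [cdf_eq_real]; exact hu
  have h2 := monotone_cdf ν hcon.le
  linarith

lemma quantile_le (ν : Measure ℝ) [IsProbabilityMeasure ν] {q t : ℝ} (hq : 0 < q)
    (ht : q ≤ ν.real (Set.Iic t)) : quantile ν q ≤ t :=
  csInf_le (quantile_set_bddBelow ν hq) ht

lemma le_quantile (ν : Measure ℝ) [IsProbabilityMeasure ν] {q t : ℝ} (hq : q < 1)
    (ht : ν.real (Set.Iic t) < q) : t ≤ quantile ν q := by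
  refine le_csInf (quantile_set_nonempty ν hq) fun u hu => ?_
  by_contra hcon
  push Not at hcon
  have h1 : q ≤ ν.real (Set.Iic u) := hu
  have h2 : ν.real (Set.Iic u) ≤ ν.real (Set.Iic t) :=
    measureReal_mono (Set.Iic_subset_Iic.2 hcon.le)
  linarith

/-- The infimum in the definition of the quantile is attained, since distribution functions are
right-continuous. -/
lemma le_measure_Iic_quantile (ν : Measure ℝ) [IsProbabilityMeasure ν] {q : ℝ} (hq1 : q < 1) :
    q ≤ ν.real (Set.Iic (quantile ν q)) := by
  rw [← cdf_eq_real]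
  have h := (cdf ν).right_continuous (quantile ν q)
  have h2 : Tendsto (cdf ν) (𝓝[>] (quantile ν q)) (𝓝 (cdf ν (quantile ν q))) :=
    h.mono_left (nhdsWithin_mono _ Set.Ioi_subset_Ici_self)
  refine ge_of_tendsto h2 (eventually_nhdsWithin_of_forall fun u hu => ?_)
  obtain ⟨t, ht, htu⟩ := exists_lt_of_csInf_lt (quantile_set_nonempty ν hq1) (Set.mem_Ioi.1 hu)
  have h1 : q ≤ cdf ν t := by rw [cdf_eq_real]; exact ht
  exact h1.trans (monotone_cdf ν htu.le)

end Quantile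

section Score

variable {n p : ℕ}

lemma scoreMax_le {x : Fin n → Fin p → ℝ} {g : Fin n → ℝ} {C : ℝ} (hC : 0 ≤ C)
    (h : ∀ j, |∑ i, x i j * g i| ≤ C) : scoreMax x g ≤ C := by
  rcases Nat.eq_zero_or_pos n with rfl | hn
  · simpa [scoreMax] using hC
  have hn' : (0 : ℝ) < n := by positivity
  rw [scoreMax, mul_comm, ← le_div_iff₀ hn', pi_norm_le_iff_of_nonneg (by positivity)]
  intro j
  rw [En, Real.norm_eq_abs, abs_div, abs_of_pos hn']
  gcongr
  exact h j

lemma abs_le_scoreMax (x : Fin n → Fin p → ℝ) (g : Fin n → ℝ) (j : Fin p) :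
    |∑ i, x i j * g i| ≤ scoreMax x g := by
  rcases Nat.eq_zero_or_pos n with rfl | hn
  · simp [scoreMax]
  have hn' : (0 : ℝ) < n := by positivity
  rw [scoreMax, mul_comm, ← div_le_iff₀ hn']
  have := norm_le_pi_norm (fun j => En fun i => x i j * g i) j
  simpa [En, abs_div, abs_of_pos hn'] using this

lemma scoreMax_const_mul (x : Fin n → Fin p → ℝ) (a : ℝ) (g : Fin n → ℝ) :
    (scoreMax x fun i => a * g i) = |a| * scoreMax x g := by
  have : (fun j => En fun i => x i j * (a * g i)) = a • fun j => En fun i => x i j * g i := by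
    funext j
    rw [Pi.smul_apply, smul_eq_mul, ← En_const_mul]
    congr 1
    funext i
    ring
  rw [scoreMax, this, norm_smul, scoreMax, Real.norm_eq_abs]
  ring

lemma measurable_scoreMax (x : Fin n → Fin p → ℝ) : Measurable fun g => scoreMax x g := by
  unfold scoreMax En
  exact Continuous.measurable (by fun_prop)

lemma measurable_En_sq : Measurable fun g : Fin n → ℝ => En fun i => g i ^ 2 := by
  unfold En
  exact Continuous.measurable (by fun_prop)

lemma measurable_selfNormalised (x : Fin n → Fin p → ℝ) :
    Measurable fun g => scoreMax x g / √(En fun i => g i ^ 2) :=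
  (measurable_scoreMax x).div measurable_En_sq.sqrt

/-- Each normalised technical instrument has a standard normal score. -/
lemma hasLaw_score {x : Fin n → Fin p → ℝ} (hn : 1 ≤ n) {j : Fin p}
    (hx : (En fun i => x i j ^ 2) = 1) :
    HasLaw (fun g : Fin n → ℝ => (∑ i, x i j * g i) / √n) (gaussianReal 0 1) (stdNormal n) := by
  have hn' : (0 : ℝ) < n := by positivity
  have h : ∑ i, (x i j / √n) ^ 2 = 1 := by
    simp only [div_pow, Real.sq_sqrt hn'.le]
    rw [← Finset.sum_div]
    exact hx
  convert! hasLaw_linear h using 2 with g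
  rw [Finset.sum_div]
  exact Finset.sum_congr rfl fun i _ => by ring

lemma score_tail {x : Fin n → Fin p → ℝ} (hn : 1 ≤ n) (hx : ∀ j, (En fun i => x i j ^ 2) = 1)
    {t : ℝ} (ht : 0 ≤ t) :
    (stdNormal n).real {g | √n * t < scoreMax x g} ≤
      p * (2 * (gaussianReal 0 1).real (Set.Ioi t)) := by
  have hn' : (0 : ℝ) < √n := Real.sqrt_pos.2 (by positivity)
  have h1 : {g | √n * t < scoreMax x g} ⊆
      ⋃ j, {g : Fin n → ℝ | t < |(∑ i, x i j * g i) / √n|} := by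
    intro g hg
    by_contra hcon
    simp only [Set.mem_iUnion, Set.mem_ofPred_eq, not_exists, not_lt, abs_div, abs_of_pos hn',
      div_le_iff₀ hn'] at hcon hg
    refine absurd hg (not_lt.2 (scoreMax_le (by positivity) fun j => ?_))
    linarith [hcon j]
  refine (measureReal_mono h1).trans ((measureReal_iUnion_fintype_le _).trans ?_)
  calc _ ≤ ∑ _j : Fin p, 2 * (gaussianReal 0 1).real (Set.Ioi t) := by
        refine Finset.sum_le_sum fun j _ => ?_
        rw [(hasLaw_score hn (hx j)).measureReal_eq (p := fun z => t < |z|)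
          (measurableSet_lt measurable_const (by fun_prop))]
        exact gaussian_abs_le t
    _ = _ := by simp

lemma score_lower {x : Fin n → Fin p → ℝ} (hn : 1 ≤ n) (hp : 1 ≤ p)
    (hx : ∀ j, (En fun i => x i j ^ 2) = 1) (t : ℝ) :
    (stdNormal n).real {g | scoreMax x g ≤ √n * t} ≤ (gaussianReal 0 1).real {z | |z| ≤ t} := by
  have hn' : (0 : ℝ) < √n := Real.sqrt_pos.2 (by positivity)
  let j : Fin p := ⟨0, hp⟩
  rw [← (hasLaw_score hn (hx j)).measureReal_eq (p := fun z => |z| ≤ t)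
    (measurableSet_le (by fun_prop) measurable_const)]
  refine measureReal_mono fun g hg => ?_
  simp only [Set.mem_ofPred_eq, abs_div, abs_of_pos hn', div_le_iff₀ hn'] at hg ⊢
  linarith [abs_le_scoreMax x g j]

end Score

/-- `log (p ∨ n)`. -/
def logMax (p : ℕ → ℕ) (n : ℕ) : ℝ := Real.log (max (p n : ℝ) n)

lemma log_le_logMax (p : ℕ → ℕ) {n : ℕ} (hn : 1 ≤ n) : Real.log n ≤ logMax p n :=
  Real.log_le_log (by positivity) (le_max_right _ _)

lemma logMax_nonneg (p : ℕ → ℕ) {n : ℕ} (hn : 1 ≤ n) : 0 ≤ logMax p n :=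
  (Real.log_natCast_nonneg n).trans (log_le_logMax p hn)

lemma tendsto_logMax (p : ℕ → ℕ) : Tendsto (logMax p) atTop atTop :=
  tendsto_atTop_mono' atTop ((eventually_ge_atTop 1).mono fun _ hn => log_le_logMax p hn)
    (Real.tendsto_log_atTop.comp tendsto_natCast_atTop_atTop)

/-- The requirements on a sequence of penalty levels `Λₙ`, for unit noise level: it is at least of
the order `√n`, at most of the order `√(n log (p ∨ n))`, and dominates the score of standard normal
noise with probability tending to one, up to factors `1 + ε`. -/
structure PenaltyLevel {p : ℕ → ℕ} (x : ∀ n, Fin n → Fin (p n) → ℝ) (Λ : ℕ → ℝ) : Prop where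
  lower : ∃ c : ℝ, 0 < c ∧ ∀ᶠ n : ℕ in atTop, c * √n ≤ Λ n
  upper : ∃ C : ℝ, 0 < C ∧ ∀ᶠ n : ℕ in atTop, Λ n ≤ C * √(n * logMax p n)
  score : ∀ ε : ℝ, 0 < ε → ∀ᶠ q : Σ n, (Fin n → ℝ) in whp stdNormal,
    scoreMax (x q.1) q.2 ≤ (1 + ε) * Λ q.1

/-- A sequence of normalised designs with `log (p ∨ n) = o(n)`, together with a sequence of
confidence levels `1 - γ`. -/
structure RegularDesign {p : ℕ → ℕ} (x : ∀ n, Fin n → Fin (p n) → ℝ) (γ : ℕ → ℝ) : Prop where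
  one_le : ∀ᶠ n in atTop, 1 ≤ p n
  normalised : ∀ᶠ n in atTop, ∀ j, (En fun i => x n i j ^ 2) = 1
  logMax_isLittleO : logMax p =o[atTop] fun n => (n : ℝ)
  pos : ∀ n, 0 < γ n
  lt_one : ∀ n, γ n < 1
  tendsto : Tendsto γ atTop (𝓝 0)
  log_le : (fun n => Real.log (1 / γ n)) =O[atTop] logMax p

section Penalty

variable {p : ℕ → ℕ} {x : ∀ n, Fin n → Fin (p n) → ℝ} {γ : ℕ → ℝ}

lemma eventually_whp_stdNormal_of_le {P : (Σ n, (Fin n → ℝ)) → Prop} {e : ℕ → ℝ}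
    (he : Tendsto e atTop (𝓝 0))
    (h : ∀ᶠ n in atTop, (stdNormal n).real {g | ¬ P ⟨n, g⟩} ≤ e n) :
    ∀ᶠ q in whp stdNormal, P q := by
  refine eventually_whp_of_le (e := fun n => ENNReal.ofReal (e n)) ?_ ?_
  · simpa using ENNReal.tendsto_ofReal he
  · filter_upwards [h] with n hn
    rw [← ofReal_measureReal]
    exact ENNReal.ofReal_le_ofReal hn

/-- A level beyond which the Gaussian tail has probability at most `γ / (4p)`. -/
def tailLevel (p : ℕ → ℕ) (γ : ℕ → ℝ) (n : ℕ) : ℝ := √(2 * Real.log (4 * p n / γ n))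

lemma RegularDesign.gaussian_tailLevel (h : RegularDesign x γ) :
    ∀ᶠ n in atTop, (gaussianReal 0 1).real (Set.Ioi (tailLevel p γ n)) ≤ γ n / (4 * p n) := by
  filter_upwards [h.one_le] with n hn
  have h0 := h.pos n
  have h1 := h.lt_one n
  have hp : (1 : ℝ) ≤ p n := by exact_mod_cast hn
  refine (gaussian_Ioi_le (Real.sqrt_nonneg _)).trans ?_
  have hge : 1 ≤ 4 * p n / γ n := by
    rw [le_div_iff₀ h0]
    linarith
  rw [Real.sq_sqrt (mul_nonneg two_pos.le (Real.log_nonneg hge)),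
    mul_div_cancel_left₀ _ two_ne_zero, Real.exp_neg, Real.exp_log (by positivity), inv_div]

lemma RegularDesign.tailLevel_le (h : RegularDesign x γ) :
    ∃ C : ℝ, 0 < C ∧ ∀ᶠ n in atTop, tailLevel p γ n ≤ C * √(logMax p n) := by
  obtain ⟨c, hc0, hc⟩ := h.log_le.exists_pos
  refine ⟨√(2 * (3 + c)), by positivity, ?_⟩
  filter_upwards [hc.bound, h.one_le, eventually_ge_atTop 1,
    (tendsto_logMax p).eventually_ge_atTop 1] with n h1 hp hn hL
  have h0 := h.pos n
  have hp' : (1 : ℝ) ≤ p n := by exact_mod_cast hp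
  rw [← Real.sqrt_mul (by positivity)]
  refine Real.sqrt_le_sqrt ?_
  rw [mul_assoc]
  gcongr
  have h2 : Real.log (4 * p n / γ n) = Real.log 4 + Real.log (p n) + Real.log (1 / γ n) := by
    rw [Real.log_div (by positivity) h0.ne', Real.log_mul (by norm_num) (by positivity),
      one_div, Real.log_inv]
    ring
  have h3 : Real.log 4 ≤ 2 := by
    rw [show (4 : ℝ) = 2 ^ 2 by norm_num, Real.log_pow]
    have := Real.log_two_lt_d9
    norm_num
    linarith
  have h4 : Real.log (p n) ≤ logMax p n :=
    Real.log_le_log (by positivity) (le_max_left _ _)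
  have h5 : Real.log (1 / γ n) ≤ c * logMax p n := by
    rw [Real.norm_eq_abs, Real.norm_eq_abs, abs_of_nonneg (logMax_nonneg p hn)] at h1
    exact (le_abs_self _).trans h1
  rw [h2]
  nlinarith

lemma RegularDesign.score_tailLevel (h : RegularDesign x γ) :
    ∀ᶠ n in atTop, (stdNormal n).real {g | √n * tailLevel p γ n < scoreMax (x n) g} ≤ γ n / 2 := by
  filter_upwards [h.gaussian_tailLevel, h.one_le, h.normalised, eventually_ge_atTop 1]
    with n h1 h2 h3 h4
  have hp : (0 : ℝ) < p n := by exact_mod_cast h2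
  refine (score_tail h4 h3 (Real.sqrt_nonneg _)).trans ?_
  calc (p n : ℝ) * (2 * (gaussianReal 0 1).real (Set.Ioi (tailLevel p γ n)))
      ≤ p n * (2 * (γ n / (4 * p n))) := by gcongr
    _ = γ n / 2 := by field_simp; ring

lemma RegularDesign.upper_of_tailLevel (h : RegularDesign x γ) {Λ : ℕ → ℝ} {D : ℝ} (hD : 0 < D)
    (hΛ : ∀ᶠ n : ℕ in atTop, Λ n ≤ D * (√n * tailLevel p γ n)) :
    ∃ C : ℝ, 0 < C ∧ ∀ᶠ n : ℕ in atTop, Λ n ≤ C * √(n * logMax p n) := by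
  obtain ⟨C, hC, h1⟩ := h.tailLevel_le
  refine ⟨D * C, by positivity, ?_⟩
  filter_upwards [h1, hΛ] with n h2 h3
  rw [Real.sqrt_mul (by positivity)]
  calc Λ n ≤ D * (√n * tailLevel p γ n) := h3
    _ ≤ D * (√n * (C * √(logMax p n))) := by gcongr
    _ = _ := by ring

lemma RegularDesign.one_le_phiInv (h : RegularDesign x γ) :
    ∀ᶠ n in atTop, 1 ≤ PhiInv (1 - γ n / (2 * p n)) := by
  have h1 : ∀ᶠ n in atTop, γ n < 1 - (gaussianReal 0 1).real (Set.Iic 1) :=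
    h.tendsto.eventually_lt_const (sub_pos.2 (gaussian_Iic_lt_one 1))
  filter_upwards [h1, h.one_le] with n h1 h2
  have hp : (1 : ℝ) ≤ p n := by exact_mod_cast h2
  have hγ := h.pos n
  have h3 : γ n / (2 * p n) ≤ γ n := by
    rw [div_le_iff₀ (by positivity)]
    nlinarith
  have : 0 < γ n / (2 * p n) := by positivity
  exact le_quantile _ (by linarith) (by linarith)

/-- The `X`-independent penalty level is admissible, by the union bound. -/
lemma RegularDesign.penaltyLevel_phiInv (h : RegularDesign x γ) :
    PenaltyLevel x fun n => √n * PhiInv (1 - γ n / (2 * p n)) where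
  lower := by
    refine ⟨1, one_pos, ?_⟩
    filter_upwards [h.one_le_phiInv] with n h1
    rw [one_mul]
    exact le_mul_of_one_le_right (Real.sqrt_nonneg _) h1
  upper := by
    refine h.upper_of_tailLevel one_pos ?_
    filter_upwards [h.gaussian_tailLevel, h.one_le] with n h1 h2
    have hp : (1 : ℝ) ≤ p n := by exact_mod_cast h2
    have hγ := h.pos n
    have hγ1 := h.lt_one n
    rw [one_mul]
    have h3 : γ n / (4 * p n) ≤ γ n / (2 * p n) := by gcongr; norm_num
    have h4 : γ n / (2 * p n) < 1 := by
      rw [div_lt_one (by positivity)]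
      linarith
    refine mul_le_mul_of_nonneg_left (quantile_le _ (by linarith) ?_) (Real.sqrt_nonneg _)
    rw [gaussian_Iic_eq]
    linarith
  score := by
    intro ε hε
    refine eventually_whp_stdNormal_of_le h.tendsto ?_
    filter_upwards [h.one_le_phiInv, h.one_le, h.normalised, eventually_ge_atTop 1]
      with n h1 h2 h3 h4
    have hp : (1 : ℝ) ≤ p n := by exact_mod_cast h2
    have hγ := h.pos n
    have hγ1 := h.lt_one n
    have hq0 : 0 < γ n / (2 * p n) := by positivity
    set q := 1 - γ n / (2 * p n) with hq
    have h5 := le_measure_Iic_quantile (gaussianReal 0 1) (q := q) (by linarith)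
    rw [gaussian_Iic_eq] at h5
    have h6 : 0 ≤ PhiInv q := zero_le_one.trans h1
    refine (measureReal_mono (s₂ := {g | √n * PhiInv q < scoreMax (x n) g}) ?_).trans
      ((score_tail h4 h3 h6).trans ?_)
    · intro g hg
      simp only [Set.mem_ofPred_eq, not_le] at hg ⊢
      refine lt_of_le_of_lt ?_ hg
      have : 0 ≤ ε * (√n * PhiInv q) := by positivity
      linarith
    · calc (p n : ℝ) * (2 * (gaussianReal 0 1).real (Set.Ioi (PhiInv q)))
          ≤ p n * (2 * (γ n / (2 * p n))) := by
            gcongr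
            have : (gaussianReal 0 1).real (Set.Ioi (PhiInv q)) ≤ 1 - q := by
              unfold PhiInv
              linarith
            linarith
        _ = γ n := by field_simp

/-- The `X`-dependent penalty level is admissible. -/
lemma RegularDesign.penaltyLevel_lam (h : RegularDesign x γ) :
    PenaltyLevel x fun n => Lam (x n) (γ n) where
  lower := by
    refine ⟨1, one_pos, ?_⟩
    have h1 : ∀ᶠ n in atTop, γ n < 1 - (gaussianReal 0 1).real {z | |z| ≤ 1} :=
      h.tendsto.eventually_lt_const (sub_pos.2 (gaussian_abs_le_lt_one 1))
    filter_upwards [h1, h.one_le, h.normalised, eventually_ge_atTop 1] with n h1 h2 h3 h4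
    have := Measure.isProbabilityMeasure_map (μ := stdNormal n)
      (measurable_scoreMax (x n)).aemeasurable
    refine le_quantile _ (by linarith [h.pos n]) ?_
    rw [map_measureReal_apply (measurable_scoreMax _) measurableSet_Iic]
    have := score_lower h4 h2 h3 1
    rw [mul_one] at this
    rw [one_mul]
    exact this.trans_lt (by linarith)
  upper := by
    refine h.upper_of_tailLevel one_pos ?_
    filter_upwards [h.score_tailLevel] with n h1
    have := Measure.isProbabilityMeasure_map (μ := stdNormal n)
      (measurable_scoreMax (x n)).aemeasurable
    rw [one_mul]
    refine quantile_le _ (by linarith [h.lt_one n]) ?_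
    rw [map_measureReal_apply (measurable_scoreMax _) measurableSet_Iic]
    have h2 := probReal_compl_eq_one_sub (μ := stdNormal n)
      (s := {g | √n * tailLevel p γ n < scoreMax (x n) g})
      (measurableSet_lt measurable_const (measurable_scoreMax _))
    have h3 : (stdNormal n).real {g | √n * tailLevel p γ n < scoreMax (x n) g}ᶜ ≤
        (stdNormal n).real ((fun g => scoreMax (x n) g) ⁻¹' Set.Iic (√n * tailLevel p γ n)) :=
      measureReal_mono fun g hg => by simpa using hg
    linarith [h.pos n]
  score := by
    intro ε hε
    refine eventually_whp_stdNormal_of_le h.tendsto ?_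
    refine .of_forall fun n => ?_
    have := Measure.isProbabilityMeasure_map (μ := stdNormal n)
      (measurable_scoreMax (x n)).aemeasurable
    have h1 := le_measure_Iic_quantile ((stdNormal n).map fun g => scoreMax (x n) g)
      (q := 1 - γ n) (by linarith [h.pos n])
    rw [map_measureReal_apply (measurable_scoreMax _) measurableSet_Iic] at h1
    have h2 := probReal_compl_eq_one_sub (μ := stdNormal n)
      ((measurable_scoreMax (x n)) (measurableSet_Iic (a := Lam (x n) (γ n))))
    refine (measureReal_mono (s₂ := ((fun g => scoreMax (x n) g) ⁻¹' Set.Iic (Lam (x n) (γ n)))ᶜ)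
      fun g hg => ?_).trans (h2.le.trans (by unfold Lam; linarith))
    simp only [Set.mem_ofPred_eq, not_le, Set.mem_compl_iff, Set.mem_preimage, Set.mem_Iic] at hg ⊢
    have h0 := scoreMax_nonneg (x n) g
    by_contra hcon
    push Not at hcon
    nlinarith

/-- The `X`-dependent self-normalised penalty level is admissible. -/
lemma RegularDesign.penaltyLevel_lamSqrt (h : RegularDesign x γ) :
    PenaltyLevel x fun n => LamSqrt (x n) (γ n) where
  lower := by
    refine ⟨1 / 2, by norm_num, ?_⟩
    have hρ : 0 < 1 - (gaussianReal 0 1).real {z | |z| ≤ 1} :=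
      sub_pos.2 (gaussian_abs_le_lt_one 1)
    set ρ := 1 - (gaussianReal 0 1).real {z | |z| ≤ 1} with hρdef
    have h1 : ∀ᶠ n in atTop, γ n < ρ / 2 := h.tendsto.eventually_lt_const (by linarith)
    have h5 : ∀ᶠ n in atTop,
        (stdNormal n).real {g | ¬ (En fun i => g i ^ 2) < 4} < ρ / 2 := by
      have := eventually_whp.1 (tendsto_En_sq.eventually_lt_const (show (1 : ℝ) < 4 by norm_num))
      have h6 := (ENNReal.tendsto_toReal ENNReal.zero_ne_top).comp this
      exact h6.eventually_lt_const (by simpa using hρ)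
    filter_upwards [h1, h5, h.one_le, h.normalised, eventually_ge_atTop 1] with n h1 h5 h2 h3 h4
    have := Measure.isProbabilityMeasure_map (μ := stdNormal n)
      (measurable_selfNormalised (x n)).aemeasurable
    refine le_quantile _ (by linarith [h.pos n]) ?_
    rw [map_measureReal_apply (measurable_selfNormalised _) measurableSet_Iic]
    have h6 := score_lower h4 h2 h3 1
    rw [mul_one] at h6
    refine (measureReal_mono (s₂ := {g | ¬ (En fun i => g i ^ 2) < 4} ∪
      {g | scoreMax (x n) g ≤ √n}) fun g hg => ?_).trans_lt
      ((measureReal_union_le _ _).trans_lt (by linarith))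
    simp only [Set.mem_preimage, Set.mem_Iic, Set.mem_union, Set.mem_ofPred_eq] at hg ⊢
    by_contra hcon
    push Not at hcon
    have hs : √(En fun i => g i ^ 2) ≤ 2 := by
      rw [Real.sqrt_le_left two_pos.le]
      linarith
    have hn' : (0 : ℝ) ≤ √n := Real.sqrt_nonneg _
    rcases (Real.sqrt_nonneg (En fun i => g i ^ 2)).eq_or_lt with h0 | h0
    · -- If all entries vanish, then so does the score.
      have hg0 : (En fun i => g i ^ 2) = 0 := by
        rwa [eq_comm, Real.sqrt_eq_zero (En_sq_nonneg g)] at h0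
      have hsum : ∑ i, g i ^ 2 = 0 := by
        rw [En, div_eq_zero_iff] at hg0
        exact hg0.resolve_right (by positivity)
      have hz : ∀ i, g i = 0 := fun i => by
        simpa using (Finset.sum_eq_zero_iff_of_nonneg fun i _ => sq_nonneg (g i)).1 hsum i
          (Finset.mem_univ i)
      have : scoreMax (x n) g ≤ 0 := scoreMax_le le_rfl fun j => by simp [hz]
      linarith
    · rw [div_le_iff₀ h0] at hg
      nlinarith
  upper := by
    obtain ⟨a, k, ha, hk, hak⟩ := exists_stdNormal_En_sq_lt
    refine h.upper_of_tailLevel (D := 1 / √a) (by positivity) ?_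
    -- The probability that `𝔼ₙ[gᵢ²]` is small is below `γ / 2`, as `log (1 / γ) = o(n)`.
    have hsmall : ∀ᶠ n : ℕ in atTop, Real.exp (-(k * n)) ≤ γ n / 2 := by
      have h1 := (h.log_le.trans_isLittleO h.logMax_isLittleO).bound (c := k / 2) (by positivity)
      filter_upwards [h1, eventually_ge_atTop ⌈2 / k⌉₊] with n h2 h3
      have h4 : 2 / k ≤ n := Nat.ceil_le.1 h3
      rw [div_le_iff₀ hk] at h4
      have hγ := h.pos n
      rw [Real.norm_eq_abs, Real.norm_eq_abs, one_div, Real.log_inv, Nat.abs_cast] at h2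
      have h5 := (le_abs_self _).trans h2
      rw [← Real.exp_log (half_pos hγ), Real.log_div hγ.ne' two_ne_zero]
      have := Real.log_two_lt_d9
      exact Real.exp_le_exp.2 (by linarith)
    filter_upwards [h.score_tailLevel, hsmall, eventually_ge_atTop 1] with n h1 h2 hn
    have := Measure.isProbabilityMeasure_map (μ := stdNormal n)
      (measurable_selfNormalised (x n)).aemeasurable
    refine quantile_le _ (by linarith [h.lt_one n]) ?_
    rw [map_measureReal_apply (measurable_selfNormalised _) measurableSet_Iic]
    set S := {g | √n * tailLevel p γ n < scoreMax (x n) g} ∪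
      {g : Fin n → ℝ | (En fun i => g i ^ 2) < a} with hS
    have hSm : MeasurableSet S :=
      (measurableSet_lt measurable_const (measurable_scoreMax _)).union
        (measurableSet_lt measurable_En_sq measurable_const)
    have h3 := probReal_compl_eq_one_sub (μ := stdNormal n) hSm
    have h4 : (stdNormal n).real S ≤ γ n / 2 + γ n / 2 :=
      (measureReal_union_le _ _).trans (add_le_add h1 ((hak n hn).trans h2))
    refine le_trans (by linarith) (measureReal_mono (s₁ := Sᶜ) fun g hg => ?_)
    simp only [hS, Set.mem_compl_iff, Set.mem_union, Set.mem_ofPred_eq, not_or, not_lt,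
      Set.mem_preimage, Set.mem_Iic] at hg ⊢
    have hsa : √a ≤ √(En fun i => g i ^ 2) := Real.sqrt_le_sqrt hg.2
    have ha' : 0 < √a := Real.sqrt_pos.2 ha
    calc scoreMax (x n) g / √(En fun i => g i ^ 2) ≤ scoreMax (x n) g / √a := by
          gcongr
          exact scoreMax_nonneg _ _
      _ ≤ (√n * tailLevel p γ n) / √a := by gcongr; exact hg.1
      _ = _ := by ring
  score := by
    intro ε hε
    have hm := fun n => measurable_selfNormalised (x n)
    have h1 : ∀ᶠ q : Σ n, (Fin n → ℝ) in whp stdNormal,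
        scoreMax (x q.1) q.2 / √(En fun i => q.2 i ^ 2) ≤ LamSqrt (x q.1) (γ q.1) := by
      refine eventually_whp_stdNormal_of_le h.tendsto ?_
      refine .of_forall fun n => ?_
      have := Measure.isProbabilityMeasure_map (μ := stdNormal n) (hm n).aemeasurable
      have h1 := le_measure_Iic_quantile
        ((stdNormal n).map fun g => scoreMax (x n) g / √(En fun i => g i ^ 2))
        (q := 1 - γ n) (by linarith [h.pos n])
      rw [map_measureReal_apply (hm n) measurableSet_Iic] at h1
      have h2 := probReal_compl_eq_one_sub (μ := stdNormal n)
        ((hm n) (measurableSet_Iic (a := LamSqrt (x n) (γ n))))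
      refine (measureReal_mono
        (s₂ := ((fun g => scoreMax (x n) g / √(En fun i => g i ^ 2)) ⁻¹'
          Set.Iic (LamSqrt (x n) (γ n)))ᶜ)
        fun g hg => ?_).trans (h2.le.trans (by unfold LamSqrt; linarith))
      simpa using hg
    have h2 : Tendsto (fun q : Σ n, (Fin n → ℝ) => √(En fun i => q.2 i ^ 2)) (whp stdNormal)
        (𝓝 1) := by
      simpa using tendsto_En_sq.sqrt
    filter_upwards [h1, h2.eventually_lt_const (show 1 < 1 + ε by linarith),
      h2.eventually_const_lt (show (0 : ℝ) < 1 by norm_num)] with q h3 h4 h5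
    have h6 : 0 ≤ LamSqrt (x q.1) (γ q.1) :=
      (div_nonneg (scoreMax_nonneg _ _) h5.le).trans h3
    rw [div_le_iff₀ h5] at h3
    nlinarith

end Penalty

/-! ### First stage rates along a sequence of sparse designs -/

/-- A sequence of designs with sparse eigenvalues bounded away from zero and infinity, and sparse
approximations `β₀` of the regression functions with approximation errors `r`. -/
structure SparseDesign {p : ℕ → ℕ} (x : ∀ n, Fin n → Fin (p n) → ℝ) (s : ℕ → ℕ)
    (β₀ : ∀ n, Fin (p n) → ℝ) (r : ∀ n, Fin n → ℝ) : Prop where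
  one_le_s : ∀ᶠ n in atTop, 1 ≤ s n
  normalised : ∀ᶠ n in atTop, ∀ j, (En fun i => x n i j ^ 2) = 1
  card_supp : ∀ᶠ n in atTop, (supp (β₀ n)).card ≤ s n
  approx : ∃ K : ℝ, 0 < K ∧ ∀ᶠ n in atTop, nrm (r n) ≤ K * √(s n / n)
  growth : (fun n => (s n : ℝ) ^ 2 * logMax p n ^ 2) =o[atTop] fun n => (n : ℝ)
  eig : ∃ (l : ℕ → ℝ) (κ₁ κ₂ : ℝ), Tendsto l atTop atTop ∧ 0 < κ₁ ∧ 0 < κ₂ ∧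
    ∀ᶠ n in atTop, SparseLower (x n) (l n * s n) κ₁ ∧ SparseUpper (x n) (l n * s n) κ₂

/-- The rate of convergence `√(s log (p ∨ n) / n)`. -/
def rate (p s : ℕ → ℕ) (n : ℕ) : ℝ := √(s n * logMax p n / n)

/-- A coefficient vector that attains the rate of convergence and selects a number of regressors of
the order of the sparsity index. -/
structure Good {p : ℕ → ℕ} (x : ∀ n, Fin n → Fin (p n) → ℝ) (s : ℕ → ℕ)
    (β₀ : ∀ n, Fin (p n) → ℝ) (B : ℝ) (n : ℕ) (b : Fin (p n) → ℝ) : Prop where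
  nrm_le : nrm (fit (x n) (b - β₀ n)) ≤ B * rate p s n
  card_le : ((supp b).card : ℝ) ≤ B * s n

namespace SparseDesign

variable {p : ℕ → ℕ} {x : ∀ n, Fin n → Fin (p n) → ℝ} {s : ℕ → ℕ} {β₀ : ∀ n, Fin (p n) → ℝ}
  {r : ∀ n, Fin n → ℝ}

lemma eventually_le_sparsity (h : SparseDesign x s β₀ r) {l : ℕ → ℝ} (hl : Tendsto l atTop atTop)
    (A B : ℝ) (hB : 0 ≤ B) : ∀ᶠ n in atTop, A * s n + B ≤ l n * s n := by
  filter_upwards [h.one_le_s, hl.eventually_ge_atTop (A + B)] with n h1 h2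
  have h1' : (1 : ℝ) ≤ s n := by exact_mod_cast h1
  nlinarith

lemma tendsto_sq_mul_logMax (h : SparseDesign x s β₀ r) :
    Tendsto (fun n => (s n : ℝ) * logMax p n / √n) atTop (𝓝 0) := by
  have h1 := h.growth.tendsto_div_nhds_zero
  have h2 : Tendsto (fun n : ℕ => √((s n : ℝ) ^ 2 * logMax p n ^ 2 / n)) atTop (𝓝 0) := by
    simpa using h1.sqrt
  refine h2.congr' ?_
  filter_upwards [eventually_ge_atTop 1] with n hn
  rw [Real.sqrt_div (by positivity), ← mul_pow,
    Real.sqrt_sq (mul_nonneg (by positivity) (logMax_nonneg p hn))]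

lemma tendsto_rate (h : SparseDesign x s β₀ r) : Tendsto (rate p s) atTop (𝓝 0) := by
  have h1 : Tendsto (fun n => (s n : ℝ) * logMax p n / n) atTop (𝓝 0) := by
    refine squeeze_zero' ?_ ?_ h.tendsto_sq_mul_logMax
    · filter_upwards [eventually_ge_atTop 1] with n hn
      have := logMax_nonneg p hn
      positivity
    · filter_upwards [eventually_ge_atTop 1] with n hn
      have := logMax_nonneg p hn
      have hn' : (1 : ℝ) ≤ n := by exact_mod_cast hn
      gcongr
      rw [Real.sqrt_le_left (by positivity)]
      nlinarith
  have h2 := h1.sqrt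
  rw [Real.sqrt_zero] at h2
  exact h2

lemma sqrt_div_le_rate (p s : ℕ → ℕ) : ∀ᶠ n : ℕ in atTop, √((s n : ℝ) / n) ≤ rate p s n := by
  filter_upwards [(tendsto_logMax p).eventually_ge_atTop 1] with n hn
  refine Real.sqrt_le_sqrt ?_
  gcongr
  exact le_mul_of_one_le_right (by positivity) hn

lemma nrm_r_le (h : SparseDesign x s β₀ r) :
    ∃ K : ℝ, 0 < K ∧ ∀ᶠ n in atTop, nrm (r n) ≤ K * rate p s n := by
  obtain ⟨K, hK, h1⟩ := h.approx
  refine ⟨K, hK, ?_⟩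
  filter_upwards [h1, sqrt_div_le_rate p s] with n h2 h3
  exact h2.trans (by gcongr)

/-- Compatibility holds for all large sample sizes, whatever the cone constant. -/
lemma compat (h : SparseDesign x s β₀ r) {a : ℝ} (ha : 0 ≤ a) :
    ∃ κ : ℝ, 0 < κ ∧ ∀ᶠ n in atTop, Compat (x n) (supp (β₀ n)) a √(κ * s n) := by
  obtain ⟨l, κ₁, κ₂, hl, hκ₁, -, h1⟩ := h.eig
  refine ⟨2 / κ₁, by positivity, ?_⟩
  filter_upwards [h1, h.normalised, h.card_supp, h.one_le_s,
    h.eventually_le_sparsity hl (2 * (1 + a) ^ 2 / κ₁) 2 two_pos.le] with n h2 h3 h4 h5 h6 d hd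
  have := h2.1.compat hκ₁ ha h3 (T := supp (β₀ n)) (s := s n) (by exact_mod_cast h5)
    (by exact_mod_cast h4) (le_trans (le_of_eq (by ring)) h6) d hd
  rwa [div_mul_eq_mul_div]

/-- Penalty levels of the order `√(n log (p ∨ n))` contribute at most the rate of convergence. -/
lemma div_mul_sqrt_le_rate {lam C κ : ℝ} (hκ : 0 ≤ κ) {n : ℕ}
    (hlam : lam ≤ C * √(n * logMax p n)) :
    lam / n * √(κ * s n) ≤ C * √κ * rate p s n := by
  rcases Nat.eq_zero_or_pos n with rfl | hn
  · simp [rate]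
  have hn' : (0 : ℝ) < n := by positivity
  have hL := logMax_nonneg p hn
  have h1 : √(n * logMax p n) / n = √(logMax p n / n) := by
    rw [Real.sqrt_mul hn'.le, Real.sqrt_div hL, div_eq_div_iff hn'.ne' (by positivity)]
    rw [mul_right_comm, Real.mul_self_sqrt hn'.le, mul_comm]
  calc lam / n * √(κ * s n) ≤ C * √(n * logMax p n) / n * √(κ * s n) := by gcongr
    _ = C * √κ * (√(logMax p n / n) * √(s n)) := by rw [mul_div_assoc, h1, Real.sqrt_mul hκ]; ring
    _ = C * √κ * rate p s n := by
      rw [← Real.sqrt_mul (by positivity), rate]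
      congr 2
      ring

/-- Lasso with a penalty level that dominates the score and has the right order, and the least
squares estimate in the model it selects, are good. -/
lemma lasso_good (h : SparseDesign x s β₀ r) {η C : ℝ} (hη : 0 < η) (hC : 0 < C) :
    ∃ B : ℝ, 0 < B ∧ ∀ᶠ n in atTop, ∀ (y v : Fin n → ℝ) (lam : ℝ) (b : Fin (p n) → ℝ),
      (∀ i, y i = fit (x n) (β₀ n) i + r n i + v i) →
      2 * (1 + η) * scoreMax (x n) v ≤ lam → √n ≤ C * lam → lam ≤ C * √(n * logMax p n) →
      IsLasso y (x n) lam b →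
      Good x s β₀ B n b ∧ ∀ b', IsLeastSquares y (x n) (supp b) b' → Good x s β₀ B n b' := by
  set θ := 1 / (1 + η) with hθ
  have hθ0 : 0 < θ := by positivity
  have hθ1 : θ < 1 := by rw [hθ, div_lt_one (by positivity)]; linarith
  have h1θ : 0 < 1 - θ := by linarith
  obtain ⟨l, κ₁, κ₂, hl, hκ₁, hκ₂, heig⟩ := h.eig
  obtain ⟨κ, hκ, hcompat⟩ := h.compat (a := (1 + θ) / (1 - θ)) (by positivity)
  obtain ⟨K, hK, happrox⟩ := h.approx
  set B₂ := 3 * K * C + 2 * √κ with hB₂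
  set B₃ := (2 * B₂ / (1 - θ)) ^ 2 * κ₂ with hB₃
  have hB₂0 : 0 < B₂ := by positivity
  have hB₃0 : 0 < B₃ := by positivity
  set κ' := (B₃ + 1) / κ₁ + κ with hκ'
  have hκ'0 : 0 < κ' := by positivity
  set B₁ := 2 * K + 2 * (C * √κ) with hB₁
  set B₄ := 4 * (K + C * √κ') with hB₄
  have hB₁0 : 0 < B₁ := by positivity
  have hB₄0 : 0 < B₄ := by positivity
  refine ⟨B₁ + B₃ + B₄, by positivity, ?_⟩
  filter_upwards [heig, hcompat, happrox, h.card_supp, h.one_le_s, sqrt_div_le_rate p s,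
    h.eventually_le_sparsity hl (B₃ + 1) 1 one_pos.le, eventually_ge_atTop 1]
    with n heig hcompat happrox hcard hs hrate hls hn
  intro y v lam b hy hscore hlam1 hlam2 hb
  have hn' : (0 : ℝ) < n := by positivity
  have hs' : (1 : ℝ) ≤ s n := by exact_mod_cast hs
  have hcard' : ((supp (β₀ n)).card : ℝ) ≤ s n := by exact_mod_cast hcard
  have hlam0 : 0 < lam := by
    have : 0 < C * lam := lt_of_lt_of_le (Real.sqrt_pos.2 hn') hlam1
    exact pos_of_mul_pos_right this hC.le
  have hscore' : 2 * scoreMax (x n) v ≤ θ * lam := by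
    rw [hθ, one_div, inv_mul_eq_div, le_div_iff₀ (by positivity)]
    linarith
  have hscore'' : 2 * scoreMax (x n) v ≤ lam := hscore'.trans (by nlinarith)
  set N := nrm (fit (x n) (b - β₀ n)) with hN
  have hN1 : N ≤ 2 * nrm (r n) + 2 * (lam / n) * √(κ * s n) :=
    hb.nrm_le hy hlam0.le hθ1 hscore' (Real.sqrt_nonneg _) hcompat
  have hpen := div_mul_sqrt_le_rate (p := p) (s := s) hκ.le hlam2
  have hrate0 : 0 ≤ rate p s n := Real.sqrt_nonneg _
  have hr : nrm (r n) ≤ K * rate p s n := happrox.trans (by gcongr)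
  have hN2 : N ≤ B₁ * rate p s n := by rw [hB₁]; linarith
  -- Sparsity: the approximation error is also dominated by the penalty level.
  have hsqrt : √((s n : ℝ) / n) ≤ C * (lam / n * √(s n)) := by
    rw [Real.sqrt_div (by positivity), div_le_iff₀ (Real.sqrt_pos.2 hn')]
    have h1 : 1 ≤ C * (lam / n) * √n := by
      rw [show C * (lam / n) * √n = C * lam * (√n / n) by ring, Real.sqrt_div_self', mul_one_div,
        le_div_iff₀ (Real.sqrt_pos.2 hn'), one_mul]
      exact hlam1
    calc √(s n : ℝ) ≤ √(s n : ℝ) * (C * (lam / n) * √n) :=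
          le_mul_of_one_le_right (Real.sqrt_nonneg _) h1
      _ = _ := by ring
  have htot : nrm (r n) + N ≤ lam / n * (√(s n) * B₂) := by
    have h1 : nrm (r n) ≤ K * (C * (lam / n * √(s n))) := happrox.trans (by gcongr)
    rw [Real.sqrt_mul hκ.le] at hN1
    rw [hB₂]
    linarith
  have hS : ∀ S ⊆ supp b, (S.card : ℝ) ≤ l n * s n → (S.card : ℝ) ≤ B₃ * s n := by
    intro S hS hSm
    have h1 := hb.card_le hy hlam0.le hscore' heig.2 hS hSm
    have h2 : (1 - θ) * (lam / n) * S.card ≤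
        2 * √(κ₂ * S.card) * (lam / n * (√(s n) * B₂)) := h1.trans (by gcongr)
    have h3 : lam / n * ((1 - θ) * S.card) ≤ lam / n * (2 * √(κ₂ * S.card) * (√(s n) * B₂)) := by
      linarith
    have h4 := le_of_mul_le_mul_left h3 (by positivity)
    rcases (Nat.cast_nonneg (α := ℝ) S.card).eq_or_lt with h0 | h0
    · rw [← h0]; positivity
    rw [Real.sqrt_mul hκ₂.le] at h4
    have hq : (S.card : ℝ) = √S.card * √S.card := (Real.mul_self_sqrt h0.le).symm
    have hq0 : 0 < √(S.card : ℝ) := Real.sqrt_pos.2 h0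
    have h5 : √(S.card : ℝ) * ((1 - θ) * √S.card) ≤ √S.card * (2 * √κ₂ * (√(s n) * B₂)) := by
      calc _ = (1 - θ) * (√S.card * √S.card) := by ring
        _ = (1 - θ) * S.card := by rw [← hq]
        _ ≤ _ := h4
        _ = _ := by ring
    have h6 := le_of_mul_le_mul_left h5 hq0
    have h7 : √(S.card : ℝ) ≤ 2 * B₂ / (1 - θ) * (√κ₂ * √(s n)) := by
      rw [div_mul_eq_mul_div, le_div_iff₀ h1θ]
      linarith
    calc (S.card : ℝ) = √S.card ^ 2 := (Real.sq_sqrt h0.le).symm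
      _ ≤ (2 * B₂ / (1 - θ) * (√κ₂ * √(s n))) ^ 2 :=
          pow_le_pow_left₀ (Real.sqrt_nonneg _) h7 2
      _ = B₃ * s n := by
        rw [mul_pow, mul_pow, Real.sq_sqrt hκ₂.le, Real.sq_sqrt (by positivity), hB₃]
        ring
  have hsupp : ((supp b).card : ℝ) ≤ B₃ * s n := by
    by_contra hcon
    push Not at hcon
    have hfl : ⌊B₃ * s n⌋₊ + 1 ≤ (supp b).card := Nat.floor_lt (by positivity) |>.2 hcon
    obtain ⟨S, hSs, hSc⟩ := Finset.exists_subset_card_eq hfl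
    have h1 : (S.card : ℝ) ≤ B₃ * s n + 1 := by
      rw [hSc]
      push_cast
      have := Nat.floor_le (a := B₃ * s n) (by positivity)
      linarith
    have h2 := hS S hSs (h1.trans (by nlinarith))
    have h3 := Nat.lt_floor_add_one (B₃ * s n)
    rw [hSc] at h2
    push_cast at h2
    linarith
  have hl1 : ∀ b' : Fin (p n) → ℝ, ((supp b').card : ℝ) ≤ B₃ * s n →
      l1Norm (b' - β₀ n) ≤ √(κ' * s n) * nrm (fit (x n) (b' - β₀ n)) := by
    intro b' hb'
    have h1 : ((supp (b' - β₀ n)).card : ℝ) ≤ (B₃ + 1) * s n := by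
      have h2 : ((supp (b' - β₀ n)).card : ℝ) ≤ (supp b').card + (supp (β₀ n)).card := by
        exact_mod_cast card_supp_sub_le b' (β₀ n)
      linarith
    refine (heig.1.l1Norm_le hκ₁ _ h1 (by linarith)).trans ?_
    gcongr
    · exact nrm_nonneg _
    · rw [hκ', mul_div_right_comm, add_mul ((B₃ + 1) / κ₁)]
      have : 0 ≤ κ * s n := by positivity
      linarith
  refine ⟨⟨hN2.trans (by gcongr; linarith), hsupp.trans (by gcongr; linarith)⟩, fun b' hb' => ?_⟩
  have hsupp' : ((supp b').card : ℝ) ≤ B₃ * s n :=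
    le_trans (by exact_mod_cast card_supp_le_of_forall hb'.1) hsupp
  have hpen' := div_mul_sqrt_le_rate (p := p) (s := s) hκ'0.le hlam2
  have hN' := hb.nrm_le_of_isLeastSquares hy hlam0.le (Real.sqrt_nonneg (κ' * s n)) hscore'' hb'
    (hl1 b hsupp) (hl1 b' hsupp') le_rfl (by
      have h1 : lam / n * √(κ * s n) ≤ lam / n * √(κ' * s n) := by
        gcongr
        rw [hκ']
        have : 0 ≤ (B₃ + 1) / κ₁ := by positivity
        linarith
      linarith)
  refine ⟨hN'.trans ?_, hsupp'.trans (by gcongr; linarith)⟩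
  calc 4 * (nrm (r n) + lam / n * √(κ' * s n)) ≤ B₄ * rate p s n := by rw [hB₄]; linarith
    _ ≤ _ := by gcongr; linarith

/-- The residual standard deviation of Square-root Lasso, relative to that of the sparse
approximation. -/
lemma sqrtLasso_sub_le (h : SparseDesign x s β₀ r) {θ C a ε : ℝ} (hθ0 : 0 ≤ θ) (hθ1 : θ < 1)
    (ha : 0 < a) (hε : 0 < ε) :
    ∀ᶠ n in atTop, ∀ (y v : Fin n → ℝ) (lam : ℝ) (b : Fin (p n) → ℝ),
      (∀ i, y i = fit (x n) (β₀ n) i + r n i + v i) →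
      0 ≤ lam → lam ≤ C * √(n * logMax p n) → a ≤ √(Qhat y (x n) (β₀ n)) →
      scoreMax (x n) v ≤ θ * lam * √(Qhat y (x n) (β₀ n)) → IsSqrtLasso y (x n) lam b →
      |√(Qhat y (x n) b) - √(Qhat y (x n) (β₀ n))| ≤
        ε * (√(Qhat y (x n) b) + √(Qhat y (x n) (β₀ n))) := by
  have h1θ : 0 < 1 - θ := by linarith
  obtain ⟨κ, hκ, hcompat⟩ := h.compat (a := 2 * (1 + θ) / (1 - θ)) (by positivity)
  obtain ⟨K, hK, hr⟩ := h.nrm_r_le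
  have hlim : Tendsto (fun n => 5 / (1 - θ) * (C * √κ * rate p s n + K * rate p s n / a))
      atTop (𝓝 0) := by
    have := (((h.tendsto_rate.const_mul (C * √κ)).add
      ((h.tendsto_rate.const_mul K).div_const a)).const_mul (5 / (1 - θ)))
    simpa using this
  filter_upwards [hcompat, hr, hlim.eventually_le_const hε]
    with n hcompat hr hlim y v lam b hy hlam0 hlam hτ hscore hb
  have h1 := hb.abs_sub_le hy hlam0 hθ0 hθ1 (ha.trans_le hτ) hscore (Real.sqrt_nonneg _) hcompat
  refine h1.trans ?_
  gcongr
  refine le_trans ?_ hlim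
  have hpen := div_mul_sqrt_le_rate (p := p) (s := s) hκ.le hlam
  have hrate0 : 0 ≤ rate p s n := Real.sqrt_nonneg _
  gcongr

lemma abs_sqrt_Qhat_sub_le {n p : ℕ} {x : Fin n → Fin p → ℝ} {y v r : Fin n → ℝ}
    {b₀ : Fin p → ℝ} (hy : ∀ i, y i = fit x b₀ i + r i + v i) (b : Fin p → ℝ) :
    |√(Qhat y x b) - nrm v| ≤ nrm r + nrm (fit x (b - b₀)) := by
  rw [sqrt_Qhat]
  refine (abs_nrm_sub_nrm_le _ _).trans ?_
  have : (fun i => y i - fit x b i - v i) = fun i => r i - fit x (b - b₀) i := by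
    funext i
    rw [resid_eq hy]
    ring
  rw [this]
  exact nrm_sub_le _ _

/-- Good coefficient vectors have an `ℓ¹` error of the order `s √(log (p ∨ n) / n)`. -/
lemma l1Norm_le_of_good (h : SparseDesign x s β₀ r) {B : ℝ} (hB : 0 < B) :
    ∃ D : ℝ, 0 < D ∧ ∀ᶠ n in atTop, ∀ b, Good x s β₀ B n b →
      l1Norm (b - β₀ n) ≤ D * (√(s n) * rate p s n) := by
  obtain ⟨l, κ₁, κ₂, hl, hκ₁, hκ₂, heig⟩ := h.eig
  refine ⟨√((B + 1) / κ₁) * B, by positivity, ?_⟩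
  filter_upwards [heig, h.card_supp, h.eventually_le_sparsity hl (B + 1) 0 le_rfl]
    with n heig hcard hls b hb
  have hcard' : ((supp (β₀ n)).card : ℝ) ≤ s n := by exact_mod_cast hcard
  have h1 : ((supp (b - β₀ n)).card : ℝ) ≤ (B + 1) * s n := by
    have h2 : ((supp (b - β₀ n)).card : ℝ) ≤ (supp b).card + (supp (β₀ n)).card := by
      exact_mod_cast card_supp_sub_le b (β₀ n)
    linarith [hb.card_le]
  refine (heig.1.l1Norm_le hκ₁ _ h1 (by linarith)).trans ?_
  calc √((B + 1) * s n / κ₁) * nrm (fit (x n) (b - β₀ n))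
      ≤ √((B + 1) * s n / κ₁) * (B * rate p s n) := by gcongr; exact hb.nrm_le
    _ = _ := by rw [mul_div_right_comm, Real.sqrt_mul (by positivity)]; ring

end SparseDesign

/-! ### Gaussian noise in the first stage -/

section Residual

open scoped RealInnerProductSpace

/-- The squared norm of a vector exceeds its squared distance from a subspace by at most a statistic
`T` (the squared norm of its projection) whose expectation under the standard normal law is the
dimension of the subspace. -/
lemma exists_integral_eq_finrank {n : ℕ} (U : Submodule ℝ (EuclideanSpace ℝ (Fin n))) :
    ∃ T : (Fin n → ℝ) → ℝ, Integrable T (stdNormal n) ∧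
      ∫ g, T g ∂stdNormal n = Module.finrank ℝ U ∧ (∀ g, 0 ≤ T g) ∧
      ∀ g, ∀ w ∈ U, ∑ i, g i ^ 2 - T g ≤ ∑ i, (g i - w i) ^ 2 := by
  let o := stdOrthonormalBasis ℝ U
  have hint : ∀ k, Integrable (fun g : Fin n → ℝ => (∑ i, (o k : EuclideanSpace ℝ (Fin n)) i * g i) ^ 2)
      (stdNormal n) := fun k => (memLp_linear _).integrable_sq
  refine ⟨fun g => ∑ k, (∑ i, (o k : EuclideanSpace ℝ (Fin n)) i * g i) ^ 2,
    integrable_finsetSum _ fun k _ => hint k, ?_, fun g => by positivity, fun g w hw => ?_⟩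
  · rw [integral_finsetSum _ fun k _ => hint k]
    have h1 : ∀ k, ∫ g : Fin n → ℝ, (∑ i, (o k : EuclideanSpace ℝ (Fin n)) i * g i) ^ 2
        ∂stdNormal n = 1 := by
      intro k
      rw [← variance_of_integral_eq_zero (memLp_linear _).aestronglyMeasurable.aemeasurable
        (integral_linear _), variance_linear]
      have h2 : ‖(o k : EuclideanSpace ℝ (Fin n))‖ = 1 := by
        rw [← Submodule.coe_norm]
        exact o.orthonormal.1 k
      have h3 := EuclideanSpace.norm_sq_eq (o k : EuclideanSpace ℝ (Fin n))
      rw [h2] at h3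
      simpa using h3.symm
    simp [h1]
  · set c : Fin (Module.finrank ℝ U) → ℝ := fun k => ⟪o k, (⟨w, hw⟩ : U)⟫ with hc
    set z : Fin (Module.finrank ℝ U) → ℝ :=
      fun k => ∑ i, (o k : EuclideanSpace ℝ (Fin n)) i * g i with hz
    have hwsum : w = ∑ k, c k • (o k : EuclideanSpace ℝ (Fin n)) := by
      have := congrArg Subtype.val (o.sum_repr' ⟨w, hw⟩)
      simp only [Submodule.coe_sum, Submodule.coe_smul] at this
      exact this.symm
    have h1 : ∑ i, g i * w i = ∑ k, c k * z k := by
      have hwi : ∀ i, w i = ∑ k, c k * (o k : EuclideanSpace ℝ (Fin n)) i := by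
        intro i
        conv_lhs => rw [hwsum]
        simp
      simp only [hwi, hz, Finset.mul_sum]
      rw [Finset.sum_comm]
      exact Finset.sum_congr rfl fun k _ => Finset.sum_congr rfl fun i _ => by ring
    have h2 : ∑ i, w i ^ 2 = ∑ k, c k ^ 2 := by
      have h3 := o.sum_sq_inner_right (⟨w, hw⟩ : U)
      rw [hc, h3, Submodule.coe_norm, EuclideanSpace.norm_sq_eq]
      simp
    have h3 : ∑ i, (g i - w i) ^ 2 = ∑ i, g i ^ 2 - 2 * ∑ i, g i * w i + ∑ i, w i ^ 2 := by
      rw [Finset.mul_sum, ← Finset.sum_sub_distrib, ← Finset.sum_add_distrib]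
      exact Finset.sum_congr rfl fun i _ => by ring
    have h4 : 0 ≤ ∑ k, (z k - c k) ^ 2 := by positivity
    have h5 : ∑ k, (z k - c k) ^ 2 = ∑ k, z k ^ 2 - 2 * ∑ k, c k * z k + ∑ k, c k ^ 2 := by
      rw [Finset.mul_sum, ← Finset.sum_sub_distrib, ← Finset.sum_add_distrib]
      exact Finset.sum_congr rfl fun i _ => by ring
    rw [h3, h1, h2]
    linarith

/-- Gaussian noise keeps its empirical norm at a distance from all vectors of a subspace whose
dimension is small compared with the sample size. -/
lemma eventually_le_nrm_sub {U : ∀ n, Submodule ℝ (EuclideanSpace ℝ (Fin n))}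
    (hU : (fun n => (Module.finrank ℝ (U n) : ℝ)) =o[atTop] fun n => (n : ℝ)) {ε : ℝ}
    (hε : 0 < ε) : ∀ᶠ q : Σ n, (Fin n → ℝ) in whp stdNormal,
      ∀ w ∈ U q.1, 1 - ε ≤ nrm fun i => q.2 i - w i := by
  choose T hT1 hT2 hT3 hT4 using fun n => exists_integral_eq_finrank (U n)
  have h1 : ∀ᶠ q : Σ n, (Fin n → ℝ) in whp stdNormal, T q.1 q.2 ≤ ε / 2 * q.1 := by
    refine eventually_whp_stdNormal_of_le
      (e := fun n => (Module.finrank ℝ (U n) : ℝ) / n / (ε / 2)) ?_ ?_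
    · simpa using hU.tendsto_div_nhds_zero.div_const (ε / 2)
    · filter_upwards [eventually_ge_atTop 1] with n hn
      have hn' : (0 : ℝ) < n := by positivity
      have := mul_meas_ge_le_integral_of_nonneg (.of_forall (hT3 n)) (hT1 n) (ε / 2 * n)
      rw [hT2, mul_comm, ← le_div_iff₀ (by positivity)] at this
      refine (measureReal_mono fun g hg => ?_).trans (this.trans_eq (by field_simp))
      simp only [not_le, Set.mem_ofPred_eq] at hg ⊢
      exact hg.le
  filter_upwards [h1, tendsto_En_sq.eventually_const_lt (show 1 - ε / 2 < 1 by linarith),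
    eventually_whp_fst (eventually_ge_atTop 1)] with q h1 h2 hn w hw
  have hn' : (0 : ℝ) < q.1 := by positivity
  rcases le_or_gt 1 ε with hε1 | hε1
  · exact le_trans (by linarith) (nrm_nonneg _)
  have h3 := hT4 q.1 q.2 w hw
  have h4 : (1 - ε) ^ 2 ≤ (nrm fun i => q.2 i - w i) ^ 2 := by
    rw [nrm_sq, En, le_div_iff₀ hn']
    rw [En, lt_div_iff₀ hn'] at h2
    have h5 : (1 - ε) ^ 2 * q.1 ≤ (1 - ε) * q.1 := by
      gcongr
      nlinarith
    linarith
  exact abs_le_of_sq_le_sq' h4 (nrm_nonneg _) |>.2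

end Residual

/-- A sequence of Gaussian noise vectors `v`, with independent entries of mean zero and standard
deviation `σ` bounded away from zero and infinity. -/
structure GaussianNoise {Ω : ℕ → Type*} [∀ n, MeasurableSpace (Ω n)] (μ : ∀ n, Measure (Ω n))
    (v : ∀ n, Ω n → Fin n → ℝ) (σ : ℕ → ℝ) : Prop where
  bounds : ∃ a b : ℝ, 0 < a ∧ 0 < b ∧ ∀ᶠ n in atTop, a ≤ σ n ∧ σ n ≤ b
  law : ∀ᶠ n in atTop, HasLaw (fun ω i => v n ω i / σ n) (stdNormal n) (μ n)

/-- A sequence of regression samples with sparse designs and Gaussian noise. -/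
structure NoisyDesign {Ω : ℕ → Type*} [∀ n, MeasurableSpace (Ω n)] (μ : ∀ n, Measure (Ω n))
    {p : ℕ → ℕ} (x : ∀ n, Fin n → Fin (p n) → ℝ) (s : ℕ → ℕ) (β₀ : ∀ n, Fin (p n) → ℝ)
    (r : ∀ n, Fin n → ℝ) (v : ∀ n, Ω n → Fin n → ℝ) (σ : ℕ → ℝ) : Prop
    extends SparseDesign x s β₀ r, GaussianNoise μ v σ where
  signal : ∃ F : ℝ, ∀ᶠ n in atTop, (nrm fun i => fit (x n) (β₀ n) i + r n i) ≤ F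

lemma eq_const_mul_div {n : ℕ} {c : ℝ} (hc : 0 < c) (v : Fin n → ℝ) :
    v = fun i => c * (v i / c) := by
  funext i
  field_simp

section Transfer

variable {Ω : ℕ → Type*} [∀ n, MeasurableSpace (Ω n)] {μ : ∀ n, Measure (Ω n)}

/-- Limits in probability can be computed under the common law. -/
lemma tendsto_whp_of_hasLaw {X : ∀ n, Ω n → Fin n → ℝ}
    (h : ∀ᶠ n in atTop, HasLaw (X n) (stdNormal n) (μ n)) :
    Tendsto (fun q : Σ n, Ω n => (⟨q.1, X q.1 q.2⟩ : Σ n, (Fin n → ℝ))) (whp μ)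
      (whp stdNormal) := by
  intro S hS
  refine eventually_whp_of_le (P := fun q => (⟨q.1, X q.1 q.2⟩ : Σ n, (Fin n → ℝ)) ∈ S)
    (eventually_whp.1 hS) ?_
  filter_upwards [h] with n hn
  conv_rhs => rw [← hn.map_eq]
  exact Measure.le_map_apply hn.aemeasurable _

lemma isBigOP_of_hasLaw {X : ∀ n, Ω n → Fin n → ℝ}
    (h : ∀ᶠ n in atTop, HasLaw (X n) (stdNormal n) (μ n)) {E : Type*} [NormedAddCommGroup E]
    {Y : ∀ n, (Fin n → ℝ) → E} (hY : IsBigOP stdNormal Y) : IsBigOP μ fun n ω => Y n (X n ω) := by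
  intro ε hε
  obtain ⟨C, hC⟩ := hY ε hε
  refine ⟨C, ?_⟩
  filter_upwards [hC, h] with n h1 h2
  rw [← h2.map_eq] at h1
  exact (Measure.le_map_apply h2.aemeasurable _).trans h1

end Transfer

namespace GaussianNoise

variable {Ω : ℕ → Type*} [∀ n, MeasurableSpace (Ω n)] {μ : ∀ n, Measure (Ω n)}
  {v : ∀ n, Ω n → Fin n → ℝ} {σ : ℕ → ℝ}

lemma sigma_pos (h : GaussianNoise μ v σ) : ∀ᶠ n in atTop, 0 < σ n := by
  obtain ⟨a, b, ha, -, hab⟩ := h.bounds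
  exact hab.mono fun n hn => ha.trans_le hn.1

lemma tendsto_nrm (h : GaussianNoise μ v σ) :
    Tendsto (fun q : Σ n, Ω n => nrm (v q.1 q.2) - σ q.1) (whp μ) (𝓝 0) := by
  obtain ⟨a, b, ha, hb, hab⟩ := h.bounds
  have h1 : Tendsto (fun q : Σ n, Ω n => nrm (fun i => v q.1 q.2 i / σ q.1)) (whp μ) (𝓝 1) := by
    have := (tendsto_En_sq.comp (tendsto_whp_of_hasLaw h.law)).sqrt
    rw [Real.sqrt_one] at this
    exact this
  have h2 : Tendsto (fun q : Σ n, Ω n => b * |nrm (fun i => v q.1 q.2 i / σ q.1) - 1|) (whp μ)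
      (𝓝 0) := by
    simpa using ((h1.sub_const 1).abs).const_mul b
  refine squeeze_zero_norm' ?_ h2
  filter_upwards [eventually_whp_fst hab, eventually_whp_fst h.sigma_pos] with q hq hσ
  have h3 : nrm (v q.1 q.2) = σ q.1 * nrm (fun i => v q.1 q.2 i / σ q.1) := by
    conv_lhs => rw [eq_const_mul_div hσ (v q.1 q.2)]
    rw [nrm_const_mul, abs_of_pos hσ]
  rw [h3, Real.norm_eq_abs, ← mul_sub_one, abs_mul, abs_of_pos hσ]
  gcongr
  exact hq.2

lemma score_le {p : ℕ → ℕ} {x : ∀ n, Fin n → Fin (p n) → ℝ} {Λ : ℕ → ℝ}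
    (h : GaussianNoise μ v σ) (hΛ : PenaltyLevel x Λ) {ε : ℝ} (hε : 0 < ε) :
    ∀ᶠ q : Σ n, Ω n in whp μ, scoreMax (x q.1) (v q.1 q.2) ≤ (1 + ε) * (σ q.1 * Λ q.1) := by
  filter_upwards [(tendsto_whp_of_hasLaw h.law).eventually (hΛ.score ε hε),
    eventually_whp_fst h.sigma_pos] with q hq hσ
  rw [eq_const_mul_div hσ (v q.1 q.2), scoreMax_const_mul, abs_of_pos hσ]
  calc _ ≤ σ q.1 * ((1 + ε) * Λ q.1) := by gcongr
    _ = _ := by ring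

end GaussianNoise

namespace NoisyDesign

variable {Ω : ℕ → Type*} [∀ n, MeasurableSpace (Ω n)] {μ : ∀ n, Measure (Ω n)}
  {p : ℕ → ℕ} {x : ∀ n, Fin n → Fin (p n) → ℝ} {s : ℕ → ℕ} {β₀ : ∀ n, Fin (p n) → ℝ}
  {r : ∀ n, Fin n → ℝ} {v : ∀ n, Ω n → Fin n → ℝ} {σ : ℕ → ℝ} {y : ∀ n, Ω n → Fin n → ℝ}
  {Λ : ℕ → ℝ}

/-- Uniformly over penalty levels `2 t Λ` with `t` larger than the noise level by a constant factor,
Lasso and Post-Lasso are good with probability tending to one. -/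
lemma lasso_good (h : NoisyDesign μ x s β₀ r v σ)
    (hy : ∀ n ω i, y n ω i = fit (x n) (β₀ n) i + r n i + v n ω i) (hΛ : PenaltyLevel x Λ)
    {c C : ℝ} (hc : 1 < c) :
    ∃ B : ℝ, 0 < B ∧ ∀ᶠ q : Σ n, Ω n in whp μ, ∀ t, c * σ q.1 ≤ t → t ≤ C →
      ∀ b, IsLasso (y q.1 q.2) (x q.1) (2 * t * Λ q.1) b →
        Good x s β₀ B q.1 b ∧
          ∀ b', IsLeastSquares (y q.1 q.2) (x q.1) (supp b) b' → Good x s β₀ B q.1 b' := by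
  obtain ⟨a, a', ha, ha', hab⟩ := h.bounds
  obtain ⟨c₀, hc₀, hlow⟩ := hΛ.lower
  obtain ⟨C₀, hC₀, hup⟩ := hΛ.upper
  -- `c` is split into two factors, for the fluctuation of the score and for the Lasso bound.
  set η := √c - 1 with hη
  have hη0 : 0 < η := by
    have := Real.lt_sqrt_of_sq_lt (show 1 ^ 2 < c by linarith)
    linarith
  have hηc : (1 + η) * (1 + η) = c := by
    rw [hη, add_sub_cancel, Real.mul_self_sqrt (by linarith)]
  set D := max (2 * |C| * C₀ + 1) (1 / (2 * c * a * c₀)) with hD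
  have hD0 : 0 < D := lt_of_lt_of_le (by positivity) (le_max_left _ _)
  obtain ⟨B, hB, hgood⟩ := h.toSparseDesign.lasso_good hη0 hD0
  refine ⟨B, hB, ?_⟩
  filter_upwards [eventually_whp_fst hgood, eventually_whp_fst hlow, eventually_whp_fst hup,
    eventually_whp_fst hab, h.score_le hΛ hη0] with q hgood hlow hup hab hscore t ht1 ht2 b hb
  have hσ : 0 < σ q.1 := ha.trans_le hab.1
  have hΛ0 : 0 ≤ Λ q.1 := le_trans (by positivity) hlow
  have ht0 : 0 < t := lt_of_lt_of_le (by positivity) ht1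
  refine hgood _ (v q.1 q.2) _ b (hy q.1 q.2) ?_ ?_ ?_ hb
  · calc 2 * (1 + η) * scoreMax (x q.1) (v q.1 q.2)
        ≤ 2 * (1 + η) * ((1 + η) * (σ q.1 * Λ q.1)) := by gcongr
      _ = 2 * (((1 + η) * (1 + η)) * σ q.1) * Λ q.1 := by ring
      _ ≤ 2 * t * Λ q.1 := by rw [hηc]; gcongr
  · calc √(q.1 : ℝ) = 1 / (2 * c * a * c₀) * (2 * (c * a) * (c₀ * √q.1)) := by field_simp
      _ ≤ D * (2 * t * Λ q.1) := by
        gcongr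
        · exact le_max_right _ _
        · exact le_trans (by gcongr; exact hab.1) ht1
  · calc 2 * t * Λ q.1 ≤ 2 * |C| * (C₀ * √(q.1 * logMax p q.1)) := by
          gcongr
          exact ht2.trans (le_abs_self _)
      _ = 2 * |C| * C₀ * √(q.1 * logMax p q.1) := by ring
      _ ≤ D * √(q.1 * logMax p q.1) := by
        gcongr
        exact le_trans (by linarith) (le_max_left _ _)

/-- Good coefficient vectors have a residual standard deviation close to the noise level. -/
lemma sqrt_Qhat_of_good (h : NoisyDesign μ x s β₀ r v σ)
    (hy : ∀ n ω i, y n ω i = fit (x n) (β₀ n) i + r n i + v n ω i) {B ε : ℝ} (hε : 0 < ε) :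
    ∀ᶠ q : Σ n, Ω n in whp μ, ∀ b, Good x s β₀ B q.1 b →
      |√(Qhat (y q.1 q.2) (x q.1) b) - σ q.1| ≤ ε := by
  obtain ⟨K, hK, hr⟩ := h.toSparseDesign.nrm_r_le
  have h1 : Tendsto (fun n => (K + B) * rate p s n) atTop (𝓝 0) := by
    simpa using h.toSparseDesign.tendsto_rate.const_mul (K + B)
  filter_upwards [eventually_whp_fst hr,
    eventually_whp_fst (h1.eventually_le_const (half_pos hε)),
    Metric.tendsto_nhds.1 h.tendsto_nrm (ε / 2) (half_pos hε)] with q hr h1 h2 b hb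
  have h3 := SparseDesign.abs_sqrt_Qhat_sub_le (hy q.1 q.2) b
  have h4 := hb.nrm_le
  rw [Real.dist_eq, sub_zero] at h2
  have h5 := abs_sub_le (√(Qhat (y q.1 q.2) (x q.1) b)) (nrm (v q.1 q.2)) (σ q.1)
  linarith

/-- The degrees-of-freedom correction is negligible when the selected model is sparse. -/
lemma sqrt_Qhat_mul_of_good (h : NoisyDesign μ x s β₀ r v σ)
    (hy : ∀ n ω i, y n ω i = fit (x n) (β₀ n) i + r n i + v n ω i) {B ε : ℝ} (hε : 0 < ε) :
    ∀ᶠ q : Σ n, Ω n in whp μ, ∀ (b : Fin (p q.1) → ℝ) (k : ℕ), Good x s β₀ B q.1 b →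
      (k : ℝ) ≤ B * s q.1 →
      |√(Qhat (y q.1 q.2) (x q.1) b * (q.1 / ((q.1 : ℝ) - k))) - σ q.1| ≤ ε := by
  obtain ⟨a, a', ha, ha', hab⟩ := h.bounds
  have hsn : Tendsto (fun n => (s n : ℝ) / n) atTop (𝓝 0) := by
    have h1 : Tendsto (fun n => rate p s n ^ 2) atTop (𝓝 0) := by
      simpa using h.toSparseDesign.tendsto_rate.pow 2
    refine squeeze_zero' (.of_forall fun n => by positivity) ?_ h1
    filter_upwards [SparseDesign.sqrt_div_le_rate p s] with n hn
    calc (s n : ℝ) / n = √(s n / n) ^ 2 := (Real.sq_sqrt (by positivity)).symm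
      _ ≤ _ := by gcongr
  have hF : Tendsto (fun n => (a' + ε) * (1 / (1 - B * (s n / n)) - 1)) atTop (𝓝 0) := by
    have h1 : Tendsto (fun n => 1 - B * ((s n : ℝ) / n)) atTop (𝓝 1) := by
      simpa using (hsn.const_mul B).const_sub 1
    have h2 := ((h1.inv₀ one_ne_zero).sub_const 1).const_mul (a' + ε)
    simpa using h2
  have hsn' : Tendsto (fun n => B * ((s n : ℝ) / n)) atTop (𝓝 0) := by
    simpa using hsn.const_mul B
  filter_upwards [eventually_whp_fst (hF.eventually_le_const (half_pos hε)),
    eventually_whp_fst (hsn'.eventually_lt_const one_half_pos), eventually_whp_fst hab,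
    h.sqrt_Qhat_of_good hy (B := B) (half_pos hε), eventually_whp_fst (eventually_ge_atTop 1)]
    with q hF hs hab hQ hn b k hb hk
  have hn' : (0 : ℝ) < q.1 := by positivity
  have hQb := abs_le.1 (hQ b hb)
  set Q := √(Qhat (y q.1 q.2) (x q.1) b) with hQdef
  have hQ0 : 0 ≤ Q := Real.sqrt_nonneg _
  set F := (q.1 : ℝ) / ((q.1 : ℝ) - k) with hFdef
  have hkn : (k : ℝ) / q.1 ≤ B * (s q.1 / q.1) := by
    rw [← mul_div_assoc]
    gcongr
  have hk0 : (0 : ℝ) ≤ (k : ℝ) / q.1 := by positivity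
  have hFeq : F = 1 / (1 - k / q.1) := by
    rw [hFdef, one_sub_div hn'.ne', one_div_div]
  have hF1 : 1 ≤ F := by
    rw [hFeq, le_div_iff₀ (by linarith)]
    linarith
  have hF2 : F ≤ 1 / (1 - B * (s q.1 / q.1)) := by
    rw [hFeq]
    gcongr
    linarith
  have hsF1 : 1 ≤ √F := Real.one_le_sqrt.2 hF1
  have hsF2 : √F ≤ F := by
    rw [Real.sqrt_le_left (by linarith)]
    nlinarith
  rw [Real.sqrt_mul (Qhat_nonneg _ _ _), abs_le]
  have h1 : Q * (F - 1) ≤ ε / 2 := by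
    refine le_trans ?_ hF
    gcongr
    linarith [hab.2]
  constructor
  · nlinarith
  · nlinarith

/-- The least squares residuals from `o(n)` regressors have a standard deviation that is
asymptotically at least the noise level, and bounded. -/
lemma sqrt_Qhat_initial (h : NoisyDesign μ x s β₀ r v σ)
    (hy : ∀ n ω i, y n ω i = fit (x n) (β₀ n) i + r n i + v n ω i)
    {I₀ : ∀ n, Finset (Fin (p n))}
    (hI₀ : (fun n => ((I₀ n).card : ℝ)) =o[atTop] fun n => (n : ℝ)) {ε : ℝ} (hε : 0 < ε) :
    ∃ C : ℝ, ∀ᶠ q : Σ n, Ω n in whp μ, ∀ b, IsLeastSquares (y q.1 q.2) (x q.1) (I₀ q.1) b →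
      σ q.1 - ε ≤ √(Qhat (y q.1 q.2) (x q.1) b) ∧ √(Qhat (y q.1 q.2) (x q.1) b) ≤ C := by
  obtain ⟨a, a', ha, ha', hab⟩ := h.bounds
  obtain ⟨F, hF⟩ := h.signal
  -- The regression function is added to the regressors, so that only noise is left to project.
  let f : ∀ n, Fin n → ℝ := fun n i => fit (x n) (β₀ n) i + r n i
  let vec : ∀ n, Option (I₀ n) → EuclideanSpace ℝ (Fin n) := fun n j =>
    WithLp.toLp 2 (j.elim (f n) fun j i => x n i j.1)
  let U : ∀ n, Submodule ℝ (EuclideanSpace ℝ (Fin n)) := fun n =>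
    Submodule.span ℝ (Set.range (vec n))
  have hU : (fun n => (Module.finrank ℝ (U n) : ℝ)) =o[atTop] fun n => (n : ℝ) := by
    have h1 : (fun n : ℕ => ((I₀ n).card : ℝ) + 1) =o[atTop] fun n => (n : ℝ) :=
      hI₀.add (isLittleO_const_left.2 (Or.inr (tendsto_norm_atTop_atTop.comp
        tendsto_natCast_atTop_atTop)))
    refine IsBigO.trans_isLittleO (IsBigO.of_bound 1 (.of_forall fun n => ?_)) h1
    have h2 : Module.finrank ℝ (U n) ≤ (I₀ n).card + 1 := by
      have := finrank_range_le_card (R := ℝ) (vec n)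
      simpa [Set.finrank, U] using this
    rw [one_mul, Real.norm_eq_abs, Real.norm_eq_abs, Nat.abs_cast,
      abs_of_nonneg (by positivity)]
    exact_mod_cast h2
  have hproj := (tendsto_whp_of_hasLaw h.law).eventually
    (eventually_le_nrm_sub hU (ε := ε / a') (by positivity))
  refine ⟨F + a' + 1, ?_⟩
  filter_upwards [hproj, eventually_whp_fst hab, eventually_whp_fst hF,
    Metric.tendsto_nhds.1 h.tendsto_nrm 1 one_pos] with q hproj hab hF hv b hb
  have hσ : 0 < σ q.1 := ha.trans_le hab.1
  constructor
  · set w : EuclideanSpace ℝ (Fin q.1) :=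
      (σ q.1)⁻¹ • (∑ j : I₀ q.1, b j.1 • vec q.1 (some j) - vec q.1 none) with hw
    have hwU : w ∈ U q.1 := by
      refine Submodule.smul_mem _ _ (Submodule.sub_mem _ (Submodule.sum_mem _ fun j _ =>
        Submodule.smul_mem _ _ (Submodule.subset_span ⟨_, rfl⟩))
        (Submodule.subset_span ⟨_, rfl⟩))
    have h1 := hproj w hwU
    have h2 : (fun i => y q.1 q.2 i - fit (x q.1) b i) =
        fun i => σ q.1 * (v q.1 q.2 i / σ q.1 - w i) := by
      funext i
      have h3 : ∑ j : I₀ q.1, b j.1 * x q.1 i j.1 = fit (x q.1) b i := by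
        rw [fit, Finset.sum_coe_sort (I₀ q.1) fun j => b j * x q.1 i j]
        rw [← Finset.sum_subset (Finset.subset_univ (I₀ q.1)) fun j _ hj => by simp [hb.1 j hj]]
        exact Finset.sum_congr rfl fun j _ => mul_comm _ _
      have h4 : w i = (σ q.1)⁻¹ * (fit (x q.1) b i - f q.1 i) := by
        rw [← h3, hw]
        simp [vec]
      rw [h4, hy]
      simp only [f]
      field_simp
      ring
    rw [sqrt_Qhat, h2, nrm_const_mul, abs_of_pos hσ]
    have h5 : σ q.1 * (ε / a') ≤ ε := by
      rw [mul_div_assoc', div_le_iff₀ ha', mul_comm]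
      gcongr
      exact hab.2
    nlinarith
  · have h1 := hb.2 0 fun _ _ => rfl
    refine (Real.sqrt_le_sqrt h1).trans ?_
    have h2 : (fun i => y q.1 q.2 i - fit (x q.1) 0 i) = fun i => f q.1 i + v q.1 q.2 i := by
      funext i
      rw [hy]
      simp [fit, f]
    rw [sqrt_Qhat, h2]
    rw [Real.dist_eq, sub_zero] at hv
    have h3 := nrm_add_le (f q.1) (v q.1 q.2)
    have h4 := (abs_lt.1 hv).2
    have h5 : nrm (f q.1) ≤ F := hF
    linarith [hab.2]

end NoisyDesign

/-! ### Noise level estimates and feasible first stage estimates -/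

namespace NoisyDesign

variable {Ω : ℕ → Type*} [∀ n, MeasurableSpace (Ω n)] {μ : ∀ n, Measure (Ω n)}
  {p : ℕ → ℕ} {x : ∀ n, Fin n → Fin (p n) → ℝ} {s : ℕ → ℕ} {β₀ : ∀ n, Fin (p n) → ℝ}
  {r : ∀ n, Fin n → ℝ} {v : ∀ n, Ω n → Fin n → ℝ} {σ : ℕ → ℝ} {y : ∀ n, Ω n → Fin n → ℝ}
  {Λ : ℕ → ℝ} {γ : ℕ → ℝ}

/-- The output of an iteration is consistent as soon as each single step maps conservative noise
levels to accurate ones, uniformly with probability tending to one. The number of passes plays no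
role. -/
lemma tendsto_of_reports (h : NoisyDesign μ x s β₀ r v σ)
    (hy : ∀ n ω i, y n ω i = fit (x n) (β₀ n) i + r n i + v n ω i) {c ψ : ℝ} (hc : 1 < c)
    (hψ : 0 < ψ) (hcψ : 1 < c * ψ) {I₀ : ∀ n, Finset (Fin (p n))}
    (hI₀ : (fun n => ((I₀ n).card : ℝ)) =o[atTop] fun n => (n : ℝ))
    {step : ∀ n, Ω n → ℝ → ℝ → Prop}
    (hstep : ∀ c₁ C ε : ℝ, 1 < c₁ → 0 < ε → ∀ᶠ q : Σ n, Ω n in whp μ, ∀ τ τ', c₁ * σ q.1 ≤ c * τ →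
      c * τ ≤ C → step q.1 q.2 τ τ' → |τ' - σ q.1| ≤ ε)
    {tol : ℝ} {K : ℕ} {sig : ∀ n, Ω n → ℝ}
    (hrep : ∀ n ω, Reports (y n ω) (x n) (step n ω) ψ (I₀ n) tol K (sig n ω)) :
    Tendsto (fun q : Σ n, Ω n => sig q.1 q.2 - σ q.1) (whp μ) (𝓝 0) := by
  obtain ⟨a, a', ha, ha', hab⟩ := h.bounds
  -- `c₁` lies strictly between one and both `c` and `c ψ`; the slack absorbs estimation errors.
  set c₀ := min c (c * ψ) with hc₀
  have hc₀1 : 1 < c₀ := lt_min hc hcψ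
  set c₁ := (1 + c₀) / 2 with hc₁
  have hc₁1 : 1 < c₁ := by linarith
  have hc₁0 : c₁ < c₀ := by linarith
  set ε₀ := a * (c₀ - c₁) / (c * (ψ + 1)) with hε₀
  have hε₀0 : 0 < ε₀ := by
    have : 0 < c₀ - c₁ := by linarith
    positivity
  have hcε : c * ε₀ + c * ψ * ε₀ = a * (c₀ - c₁) := by
    rw [hε₀]
    field_simp
    ring
  obtain ⟨C₀, hinit⟩ := h.sqrt_Qhat_initial hy hI₀ hε₀0
  rw [Metric.tendsto_nhds]
  intro ε hε
  set C := max (c * ψ * C₀) (c * (a' + ε₀)) with hC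
  filter_upwards [hinit, eventually_whp_fst hab, hstep c₁ C (min ε₀ (ε / 2)) hc₁1
    (lt_min hε₀0 (half_pos hε))] with q hinit hab hstep
  obtain ⟨N, τ, ⟨b, hb, hτ0⟩, hτ, -, -, hsig⟩ := hrep q.1 q.2
  have hc0 : 0 < c := by linarith
  have hσ : 0 < σ q.1 := ha.trans_le hab.1
  have hcψ0 : 0 < c * ψ := by positivity
  have hslack : c₁ * σ q.1 ≤ c₀ * σ q.1 - a * (c₀ - c₁) := by nlinarith
  have key : ∀ k ≤ N, (c₁ * σ q.1 ≤ c * τ k ∧ c * τ k ≤ C) ∧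
      |τ (k + 1) - σ q.1| ≤ min ε₀ (ε / 2) := by
    intro k
    induction k with
    | zero =>
      intro hk
      obtain ⟨h1, h2⟩ := hinit b hb
      have h3 : c₁ * σ q.1 ≤ c * τ 0 ∧ c * τ 0 ≤ C := by
        rw [hτ0, ← mul_assoc]
        constructor
        · have h4 : c₀ * σ q.1 ≤ c * ψ * σ q.1 := by
            gcongr
            exact min_le_right _ _
          have h5 : c * ψ * (σ q.1 - ε₀) ≤ c * ψ * √(Qhat (y q.1 q.2) (x q.1) b) := by gcongr
          have h6 : 0 < c * ε₀ := by positivity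
          linarith
        · exact le_trans (by gcongr) (le_max_left _ _)
      exact ⟨h3, hstep _ _ h3.1 h3.2 (hτ 0 hk)⟩
    | succ k ih =>
      intro hk
      have h1 := abs_le.1 ((ih (by omega)).2.trans (min_le_left _ _))
      have h3 : c₁ * σ q.1 ≤ c * τ (k + 1) ∧ c * τ (k + 1) ≤ C := by
        constructor
        · have h4 : c₀ * σ q.1 ≤ c * σ q.1 := by
            gcongr
            exact min_le_left _ _
          have h5 : c * (σ q.1 - ε₀) ≤ c * τ (k + 1) := by gcongr; linarith
          have h6 : 0 < c * ψ * ε₀ := by positivity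
          linarith
        · refine le_trans ?_ (le_max_right _ _)
          gcongr
          linarith [hab.2]
      exact ⟨h3, hstep _ _ h3.1 h3.2 (hτ _ hk)⟩
  have h1 := (key N le_rfl).2.trans (min_le_right _ _)
  rw [Real.dist_eq, sub_zero, hsig]
  linarith

lemma lassoStep_accurate (h : NoisyDesign μ x s β₀ r v σ)
    (hy : ∀ n ω i, y n ω i = fit (x n) (β₀ n) i + r n i + v n ω i)
    (hΛ : PenaltyLevel x fun n => Lam (x n) (γ n)) (c c₁ C ε : ℝ) (hc₁ : 1 < c₁) (hε : 0 < ε) :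
    ∀ᶠ q : Σ n, Ω n in whp μ, ∀ τ τ', c₁ * σ q.1 ≤ c * τ → c * τ ≤ C →
      LassoStep (y q.1 q.2) (x q.1) c (γ q.1) τ τ' → |τ' - σ q.1| ≤ ε := by
  obtain ⟨B, hB, hgood⟩ := h.lasso_good hy hΛ (C := C) hc₁
  filter_upwards [hgood, h.sqrt_Qhat_of_good hy (B := B) hε] with q h1 h2 τ τ' h3 h4 hs
  obtain ⟨b, hb, rfl⟩ := hs
  rw [mul_assoc 2 c τ] at hb
  exact h2 b (h1 _ h3 h4 b hb).1

lemma postLassoStep_accurate (h : NoisyDesign μ x s β₀ r v σ)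
    (hy : ∀ n ω i, y n ω i = fit (x n) (β₀ n) i + r n i + v n ω i)
    (hΛ : PenaltyLevel x fun n => Lam (x n) (γ n)) (c c₁ C ε : ℝ) (hc₁ : 1 < c₁) (hε : 0 < ε) :
    ∀ᶠ q : Σ n, Ω n in whp μ, ∀ τ τ', c₁ * σ q.1 ≤ c * τ → c * τ ≤ C →
      PostLassoStep (y q.1 q.2) (x q.1) c (γ q.1) τ τ' → |τ' - σ q.1| ≤ ε := by
  obtain ⟨B, hB, hgood⟩ := h.lasso_good hy hΛ (C := C) hc₁
  filter_upwards [hgood, h.sqrt_Qhat_mul_of_good hy (B := B) hε] with q h1 h2 τ τ' h3 h4 hs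
  obtain ⟨b, b', hb, hb', rfl⟩ := hs
  rw [mul_assoc 2 c τ] at hb
  have h5 := h1 _ h3 h4 b hb
  exact h2 b' _ (h5.2 b' hb') h5.1.card_le

/-- The conclusion for the first stage: with probability tending to one, `b` and the least squares
estimates in the model selected by `b` are good. -/
def GoodFirstStage (μ : ∀ n, Measure (Ω n)) (x : ∀ n, Fin n → Fin (p n) → ℝ) (s : ℕ → ℕ)
    (β₀ : ∀ n, Fin (p n) → ℝ) (y : ∀ n, Ω n → Fin n → ℝ) (b : ∀ n, Ω n → Fin (p n) → ℝ) : Prop :=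
  ∃ B : ℝ, 0 < B ∧ ∀ᶠ q : Σ n, Ω n in whp μ, Good x s β₀ B q.1 (b q.1 q.2) ∧
    ∀ b', IsLeastSquares (y q.1 q.2) (x q.1) (supp (b q.1 q.2)) b' → Good x s β₀ B q.1 b'

/-- Lasso with a consistent noise level estimate. -/
lemma goodFirstStage_of_tendsto (h : NoisyDesign μ x s β₀ r v σ)
    (hy : ∀ n ω i, y n ω i = fit (x n) (β₀ n) i + r n i + v n ω i) (hΛ : PenaltyLevel x Λ)
    {c : ℝ} (hc : 1 < c) {sig : ∀ n, Ω n → ℝ}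
    (hsig : Tendsto (fun q : Σ n, Ω n => sig q.1 q.2 - σ q.1) (whp μ) (𝓝 0))
    {b : ∀ n, Ω n → Fin (p n) → ℝ}
    (hb : ∀ᶠ q : Σ n, Ω n in whp μ,
      IsLasso (y q.1 q.2) (x q.1) (2 * c * sig q.1 q.2 * Λ q.1) (b q.1 q.2)) :
    GoodFirstStage μ x s β₀ y b := by
  obtain ⟨a, a', ha, ha', hab⟩ := h.bounds
  set c₁ := (1 + c) / 2 with hc₁
  have hc₁1 : 1 < c₁ := by linarith
  set ε := a * (c - c₁) / c with hε
  have hε0 : 0 < ε := by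
    have : 0 < c - c₁ := by linarith
    positivity
  have hcε : c * ε = a * (c - c₁) := by
    rw [hε]
    field_simp
  obtain ⟨B, hB, hgood⟩ := h.lasso_good hy hΛ (C := c * (a' + ε)) hc₁1
  refine ⟨B, hB, ?_⟩
  filter_upwards [hgood, eventually_whp_fst hab, Metric.tendsto_nhds.1 hsig ε hε0, hb]
    with q hgood hab hsig hb
  rw [Real.dist_eq, sub_zero, abs_lt] at hsig
  rw [mul_assoc 2 c] at hb
  refine hgood _ ?_ ?_ _ hb
  · have h1 : c * (σ q.1 - ε) ≤ c * sig q.1 q.2 := by gcongr; linarith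
    nlinarith
  · gcongr
    linarith [hab.2]

/-- The residual standard deviation of Square-root Lasso is a consistent noise level estimate. -/
lemma tendsto_sqrtLasso (h : NoisyDesign μ x s β₀ r v σ)
    (hy : ∀ n ω i, y n ω i = fit (x n) (β₀ n) i + r n i + v n ω i) (hΛ : PenaltyLevel x Λ)
    {c : ℝ} (hc : 1 < c) {b : ∀ n, Ω n → Fin (p n) → ℝ}
    (hb : ∀ n ω, IsSqrtLasso (y n ω) (x n) (c * Λ n) (b n ω)) :
    Tendsto (fun q : Σ n, Ω n => √(Qhat (y q.1 q.2) (x q.1) (b q.1 q.2)) - σ q.1)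
      (whp μ) (𝓝 0) := by
  obtain ⟨a, a', ha, ha', hab⟩ := h.bounds
  obtain ⟨c₀, hc₀, hlow⟩ := hΛ.lower
  obtain ⟨C₀, hC₀, hup⟩ := hΛ.upper
  have hτ₀ : ∀ ε : ℝ, 0 < ε → ∀ᶠ q : Σ n, Ω n in whp μ,
      |√(Qhat (y q.1 q.2) (x q.1) (β₀ q.1)) - σ q.1| ≤ ε := by
    intro ε hε
    filter_upwards [h.sqrt_Qhat_of_good hy (B := 1) hε, eventually_whp_fst h.card_supp]
      with q hq hcard
    refine hq _ ⟨?_, ?_⟩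
    · rw [sub_self]
      have : nrm (fit (x q.1) 0) = 0 := by simp [nrm, fit, En]
      rw [this, one_mul]
      exact Real.sqrt_nonneg _
    · rw [one_mul]
      exact_mod_cast hcard
  -- The fraction `θ = c^{-1/2}` of the penalty still dominates the score.
  set θ := 1 / √c with hθ
  have hsc : 1 < √c := Real.lt_sqrt_of_sq_lt (by linarith)
  have hθ0 : 0 ≤ θ := by positivity
  have hθ1 : θ < 1 := by rw [hθ, div_lt_one (by linarith)]; exact hsc
  have hθc : θ * c = √c := by
    rw [hθ, one_div, inv_mul_eq_div, Real.div_sqrt]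
  set η := √√c - 1 with hη
  have hη0 : 0 < η := by
    have : 1 < √√c := Real.lt_sqrt_of_sq_lt (by linarith)
    linarith
  have hηc : (1 + η) * (1 + η) = √c := by
    rw [hη, add_sub_cancel, Real.mul_self_sqrt (by linarith)]
  rw [Metric.tendsto_nhds]
  intro ε hε
  set ε₁ := min (1 / 2) (ε / (16 * a')) with hε₁
  have hε₁0 : 0 < ε₁ := lt_min one_half_pos (by positivity)
  set ε₂ := min (min (a / 2) (ε / 4)) (a * (η / (1 + η))) with hε₂
  have hε₂0 : 0 < ε₂ := lt_min (lt_min (half_pos ha) (by positivity)) (by positivity)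
  filter_upwards [hτ₀ ε₂ hε₂0, eventually_whp_fst hab, eventually_whp_fst hlow,
    eventually_whp_fst hup, h.score_le hΛ hη0,
    eventually_whp_fst (h.toSparseDesign.sqrtLasso_sub_le hθ0 hθ1 (C := c * C₀) (half_pos ha)
      hε₁0)] with q hτ₀ hab hlow hup hscore hsub
  have hσ : 0 < σ q.1 := ha.trans_le hab.1
  have hΛ0 : 0 ≤ Λ q.1 := le_trans (by positivity) hlow
  set τ := √(Qhat (y q.1 q.2) (x q.1) (b q.1 q.2)) with hτ
  set τ₀ := √(Qhat (y q.1 q.2) (x q.1) (β₀ q.1)) with hτ₀def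
  have hτ0 : 0 ≤ τ := Real.sqrt_nonneg _
  have h1 := abs_le.1 hτ₀
  have he1 : ε₂ ≤ a / 2 := (min_le_left _ _).trans (min_le_left _ _)
  have he2 : ε₂ ≤ ε / 4 := (min_le_left _ _).trans (min_le_right _ _)
  have he3 : ε₂ ≤ a * (η / (1 + η)) := min_le_right _ _
  have h2 : a / 2 ≤ τ₀ := by linarith [hab.1]
  have h3 : σ q.1 ≤ (1 + η) * τ₀ := by
    have h4 : σ q.1 - σ q.1 * (η / (1 + η)) ≤ τ₀ := by
      have : a * (η / (1 + η)) ≤ σ q.1 * (η / (1 + η)) := by gcongr; exact hab.1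
      linarith
    have h5 : σ q.1 - σ q.1 * (η / (1 + η)) = σ q.1 / (1 + η) := by field_simp; ring
    rw [h5, div_le_iff₀ (by positivity)] at h4
    linarith
  have h6 := hsub (y q.1 q.2) (v q.1 q.2) (c * Λ q.1) (b q.1 q.2) (hy q.1 q.2) (by positivity)
    (by rw [mul_assoc]; gcongr) h2 (by
      calc scoreMax (x q.1) (v q.1 q.2) ≤ (1 + η) * (σ q.1 * Λ q.1) := hscore
        _ ≤ (1 + η) * ((1 + η) * τ₀ * Λ q.1) := by gcongr
        _ = ((1 + η) * (1 + η)) * (τ₀ * Λ q.1) := by ring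
        _ = θ * (c * Λ q.1) * τ₀ := by rw [hηc, ← hθc]; ring) (hb q.1 q.2)
  have h7 := abs_le.1 h6
  have hτ₀le : τ₀ ≤ 2 * a' := by linarith [hab.1, hab.2]
  have he4 : ε₁ ≤ 1 / 2 := min_le_left _ _
  have hτle : τ ≤ 3 * τ₀ := by nlinarith
  have h8 : |τ - τ₀| ≤ ε / 2 := by
    calc |τ - τ₀| ≤ ε₁ * (τ + τ₀) := h6
      _ ≤ ε / (16 * a') * (8 * a') := by
        gcongr
        · exact min_le_right _ _
        · linarith
      _ = ε / 2 := by field_simp; norm_num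
  rw [Real.dist_eq, sub_zero]
  have h9 := abs_sub_le τ τ₀ (σ q.1)
  linarith

lemma goodFirstStage_of_isSqrtLasso (h : NoisyDesign μ x s β₀ r v σ)
    (hy : ∀ n ω i, y n ω i = fit (x n) (β₀ n) i + r n i + v n ω i) (hΛ : PenaltyLevel x Λ)
    {c : ℝ} (hc : 1 < c) {b : ∀ n, Ω n → Fin (p n) → ℝ}
    (hb : ∀ n ω, IsSqrtLasso (y n ω) (x n) (c * Λ n) (b n ω)) :
    GoodFirstStage μ x s β₀ y b := by
  obtain ⟨a, a', ha, ha', hab⟩ := h.bounds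
  have hτ := h.tendsto_sqrtLasso hy hΛ hc hb
  refine h.goodFirstStage_of_tendsto hy hΛ hc
    (sig := fun n ω => √(Qhat (y n ω) (x n) (b n ω))) hτ ?_
  filter_upwards [eventually_whp_fst hab, Metric.tendsto_nhds.1 hτ a ha] with q hab hq
  rw [Real.dist_eq, sub_zero, abs_lt] at hq
  have h1 := (hb q.1 q.2).isLasso (by linarith [hab.1])
  have h2 : ∀ t l : ℝ, 2 * t * (c * l) = 2 * c * t * l := fun t l => by ring
  rw [h2] at h1
  exact h1

end NoisyDesign

/-! ### Sparse eigenvalues and Gaussian vectors -/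

section Gram

variable {n p : ℕ} (x : Fin n → Fin p → ℝ)

lemma dotProduct_gram (d : Fin p → ℝ) : d ⬝ᵥ (gram x).mulVec d = nrm (fit x d) ^ 2 := by
  have h1 : nrm (fit x d) ^ 2 = En fun i => fit x d i * fit x d i := by
    rw [nrm_sq]
    simp only [sq]
  rw [h1, En_mul_fit]
  simp only [dotProduct, Matrix.mulVec, gram, Matrix.of_apply]
  refine Finset.sum_congr rfl fun j _ => ?_
  rw [En_mul_fit]
  refine congrArg _ (Finset.sum_congr rfl fun k _ => ?_)
  rw [mul_comm]
  exact congrArg (d k * ·) (congrArg En (funext fun i => mul_comm _ _))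

lemma isSelfAdjoint_gram : IsSelfAdjoint (gram x) := by
  rw [isSelfAdjoint_iff, Matrix.star_eq_conjTranspose]
  ext j k
  simp [gram, mul_comm]

lemma dotProduct_self_eq (d : Fin p → ℝ) : d ⬝ᵥ d = ∑ j, d j ^ 2 := by
  simp only [dotProduct, sq]

lemma dotProduct_algebraMap (t : ℝ) (d : Fin p → ℝ) :
    d ⬝ᵥ (algebraMap ℝ (Matrix (Fin p) (Fin p) ℝ) t).mulVec d = t * ∑ j, d j ^ 2 := by
  rw [Matrix.algebraMap_eq_diagonal, ← dotProduct_self_eq]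
  simp only [Matrix.mulVec_diagonal, dotProduct, Finset.mul_sum, Pi.algebraMap_apply,
    Algebra.algebraMap_self, RingHom.id_apply]
  exact Finset.sum_congr rfl fun j _ => by ring

lemma nrm_fit_sq_le (d : Fin p → ℝ) :
    nrm (fit x d) ^ 2 ≤ (En fun i => ∑ j, x i j ^ 2) * ∑ j, d j ^ 2 := by
  rw [nrm_sq, mul_comm, ← En_const_mul]
  refine En_mono fun i => ?_
  rw [mul_comm]
  exact Finset.sum_mul_sq_le_sq_mul_sq _ _ _

lemma sum_sq_pos {d : Fin p → ℝ} (hd : d ≠ 0) : 0 < ∑ j, d j ^ 2 := by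
  obtain ⟨j, hj⟩ := Function.ne_iff.1 hd
  exact Finset.sum_pos' (fun k _ => sq_nonneg _) ⟨j, Finset.mem_univ j, by
    have : d j ≠ 0 := hj
    positivity⟩

lemma mem_sparseRayleigh {m : ℝ} {d : Fin p → ℝ} (hd : d ≠ 0) (hm : ((supp d).card : ℝ) ≤ m) :
    nrm (fit x d) ^ 2 / ∑ j, d j ^ 2 ∈ sparseRayleigh m (gram x) :=
  ⟨d, hd, hm, by rw [dotProduct_gram, dotProduct_self_eq]⟩

lemma exists_of_mem_sparseRayleigh {m t : ℝ} (ht : t ∈ sparseRayleigh m (gram x)) :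
    ∃ d : Fin p → ℝ, d ≠ 0 ∧ ((supp d).card : ℝ) ≤ m ∧ t = nrm (fit x d) ^ 2 / ∑ j, d j ^ 2 := by
  obtain ⟨d, hd, hm, h⟩ := ht
  exact ⟨d, hd, hm, by rw [h, dotProduct_gram, dotProduct_self_eq]⟩

variable {x}

lemma sparseLower_of_le {m κ : ℝ} (h : κ ≤ sparseEigMin m (gram x)) : SparseLower x m κ := by
  intro d hd
  rcases eq_or_ne d 0 with rfl | hd0
  · simpa using sq_nonneg _
  · have h1 : κ ≤ nrm (fit x d) ^ 2 / ∑ j, d j ^ 2 := by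
      refine h.trans (csInf_le ⟨0, fun t ht => ?_⟩ (mem_sparseRayleigh x hd0 hd))
      obtain ⟨d', -, -, rfl⟩ := exists_of_mem_sparseRayleigh x ht
      positivity
    rwa [le_div_iff₀ (sum_sq_pos hd0)] at h1

lemma sparseUpper_of_le {m κ : ℝ} (h : sparseEigMax m (gram x) ≤ κ) : SparseUpper x m κ := by
  intro d hd
  rcases eq_or_ne d 0 with rfl | hd0
  · simp [nrm, fit, En]
  · have h1 : nrm (fit x d) ^ 2 / ∑ j, d j ^ 2 ≤ κ := by
      refine (le_csSup ⟨En fun i => ∑ j, x i j ^ 2, fun t ht => ?_⟩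
        (mem_sparseRayleigh x hd0 hd)).trans h
      obtain ⟨d', hd', -, rfl⟩ := exists_of_mem_sparseRayleigh x ht
      rw [div_le_iff₀ (sum_sq_pos hd')]
      exact nrm_fit_sq_le x d'
    rwa [div_le_iff₀ (sum_sq_pos hd0)] at h1

/-- A positive minimal sparse eigenvalue is a genuine one: the infimum over the empty set being zero,
there is a nonzero sparse vector. -/
lemma one_le_of_sparseEigMin_pos {l : ℝ} {s : ℕ} (h : 0 < sparseEigMin (l * s) (gram x)) :
    1 ≤ p ∧ 1 ≤ s := by
  have hne : (sparseRayleigh (l * s) (gram x)).Nonempty := by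
    by_contra hne
    rw [Set.not_nonempty_iff_eq_empty] at hne
    rw [sparseEigMin, hne, Real.sInf_empty] at h
    exact h.false
  obtain ⟨-, d, hd, hm, -⟩ := hne
  obtain ⟨j, hj⟩ := Function.ne_iff.1 hd
  refine ⟨by have := j.2; omega, ?_⟩
  have h1 : 0 < (supp d).card := Finset.card_pos.2 ⟨j, by rw [mem_supp]; exact hj⟩
  by_contra hs
  have hs0 : s = 0 := by omega
  rw [hs0, Nat.cast_zero, mul_zero] at hm
  have h2 : (0 : ℝ) < (supp d).card := by exact_mod_cast h1
  linarith

open scoped MatrixOrder in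
/-- The eigenvalues of a Gram matrix bound its quadratic form. -/
lemma nrm_fit_sq_bounds_of_spectrum {a b : ℝ}
    (h : ∀ e ∈ spectrum ℝ (gram x), a ≤ e ∧ e ≤ b) (d : Fin p → ℝ) :
    a * ∑ j, d j ^ 2 ≤ nrm (fit x d) ^ 2 ∧ nrm (fit x d) ^ 2 ≤ b * ∑ j, d j ^ 2 := by
  have h2 := (Matrix.le_iff.1 ((algebraMap_le_iff_le_spectrum (ha := isSelfAdjoint_gram x)).2
    fun e he => (h e he).1)).dotProduct_mulVec_nonneg d
  have h3 := (Matrix.le_iff.1 ((le_algebraMap_iff_spectrum_le (ha := isSelfAdjoint_gram x)).2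
    fun e he => (h e he).2)).dotProduct_mulVec_nonneg d
  rw [star_trivial, Matrix.sub_mulVec, dotProduct_sub, dotProduct_algebraMap, dotProduct_gram]
    at h2 h3
  exact ⟨by linarith, by linarith⟩

end Gram

/-- Independent centred Gaussian variables with a common variance, in standard units. -/
lemma hasLaw_stdNormal_div {Ω : Type*} [MeasurableSpace Ω] {μ : Measure Ω} {n : ℕ}
    {X : Fin n → Ω → ℝ} (hX : iIndepFun X μ) (hg : ∀ i, HasGaussianLaw (X i) μ)
    (hm : ∀ i, ∫ ω, X i ω ∂μ = 0) {σ : ℝ} (hσ : 0 < σ) (hv : ∀ i, Var[X i; μ] = σ ^ 2) :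
    HasLaw (fun ω i => X i ω / σ) (stdNormal n) μ := by
  refine iIndepFun.hasLaw_pi (X := fun i ω => X i ω / σ) (fun i => ?_)
    (hX.comp (fun _ t => t / σ) fun _ => measurable_id.div_const σ)
  have h1 : HasLaw (X i) (gaussianReal 0 (σ ^ 2).toNNReal) μ :=
    ⟨(hg i).aemeasurable, by rw [(hg i).map_eq_gaussianReal, hm, hv]⟩
  convert! gaussianReal_div_const h1 σ using 2
  · simp
  · ext
    simp [Real.toNNReal_of_nonneg (sq_nonneg σ)]
    field_simp

/-! ### The first stage of the simultaneous equation model -/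

namespace IVArray

variable {Ω : ℕ → Type*} [∀ n, MeasurableSpace (Ω n)] {μ : ∀ n, Measure (Ω n)} {kw : ℕ}
  {M : IVArray μ kw} {s : ℕ → ℕ} {c : ℝ} {γ : ℕ → ℝ}

lemma hasLaw_v {n : ℕ} (h : 0 < M.σv n) :
    HasLaw (fun ω i => M.v n i ω / M.σv n) (stdNormal n) (μ n) :=
  hasLaw_stdNormal_div ((M.indep n).comp (fun _ => Prod.snd) fun _ => measurable_snd)
    (fun i => (M.gaussian n i).snd) (M.mean_v n) h (M.var_v n)

lemma hasLaw_ζ {n : ℕ} (h : 0 < M.σζ n) :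
    HasLaw (fun ω i => M.ζ n i ω / M.σζ n) (stdNormal n) (μ n) :=
  hasLaw_stdNormal_div ((M.indep n).comp (fun _ => Prod.fst) fun _ => measurable_fst)
    (fun i => (M.gaussian n i).fst) (M.mean_ζ n) h (M.var_ζ n)

lemma ASIV.eventually_one_le (h : M.ASIV s) : ∀ᶠ n in atTop, 1 ≤ M.p n ∧ 1 ≤ s n := by
  obtain ⟨l, κ₁, κ₂, -, hκ₁, -, h1⟩ := h.sparseEig
  filter_upwards [h1] with n hn
  exact one_le_of_sparseEigMin_pos (hκ₁.trans_le hn.1)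

/-- The quadratic form of `Qₙ` is bounded by its eigenvalues. -/
lemma ASIV.exists_bounds (h : M.ASIV s) : ∃ a b : ℝ, 0 < a ∧ 0 < b ∧ ∀ᶠ n in atTop,
    (a ≤ M.σv n ∧ M.σv n ≤ b) ∧ (a ≤ M.σζ n ∧ M.σζ n ≤ b) ∧
      ∀ d, a * ∑ j, d j ^ 2 ≤ nrm (fit (M.A n) d) ^ 2 ∧
        nrm (fit (M.A n) d) ^ 2 ≤ b * ∑ j, d j ^ 2 := by
  obtain ⟨a, b, ha, h1⟩ := h.bounded
  obtain ⟨n, hn⟩ := h1.exists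
  refine ⟨a, b, ha, by linarith, ?_⟩
  filter_upwards [h1] with n h2
  exact ⟨⟨h2.1, h2.2.1⟩, ⟨h2.2.2.1, h2.2.2.2.1⟩, nrm_fit_sq_bounds_of_spectrum h2.2.2.2.2⟩

lemma ASIV.regularDesign (h : M.ASIV s) (hγ : M.ConfidenceLevel γ) : RegularDesign M.x γ where
  one_le := h.eventually_one_le.mono fun n hn => hn.1
  normalised := h.sparse.1
  logMax_isLittleO := by
    refine IsBigO.trans_isLittleO ?_ h.growth
    refine IsBigO.of_bound 1 ?_
    filter_upwards [h.eventually_one_le, (tendsto_logMax M.p).eventually_ge_atTop 1] with n h1 h2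
    have h3 : (1 : ℝ) ≤ s n := by exact_mod_cast h1.2
    have h4 : logMax M.p n ≤ logMax M.p n ^ 2 := by nlinarith
    have h5 : logMax M.p n ^ 2 ≤ (s n : ℝ) ^ 2 * logMax M.p n ^ 2 :=
      le_mul_of_one_le_left (sq_nonneg _) (one_le_pow₀ h3)
    rw [one_mul, Real.norm_of_nonneg (by linarith)]
    exact (h4.trans h5).trans (le_abs_self _)
  pos := hγ.pos
  lt_one := hγ.lt_one
  tendsto := hγ.tendsto
  log_le := hγ.log_le

lemma ASIV.exists_noisyDesign (h : M.ASIV s) : ∃ β₀ : ∀ n, Fin (M.p n) → ℝ,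
    NoisyDesign μ M.x s β₀ (fun n i => M.f n (M.z n i) - fit (M.x n) (β₀ n) i)
      (fun n ω i => M.v n i ω) M.σv := by
  classical
  obtain ⟨K, hK⟩ := h.sparse.2
  obtain ⟨a, b, ha, hb, hab⟩ := h.exists_bounds
  obtain ⟨l, κ₁, κ₂, hl, hκ₁, hκ₂, hse⟩ := h.sparseEig
  have hK' : ∀ n, ∃ β₀ : Fin (M.p n) → ℝ, (∃ β₀ : Fin (M.p n) → ℝ, (supp β₀).card ≤ s n ∧
      √(En fun i => (M.f n (M.z n i) - ∑ j, M.x n i j * β₀ j) ^ 2) ≤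
        K * M.σv n * √(s n / n)) → (supp β₀).card ≤ s n ∧
      √(En fun i => (M.f n (M.z n i) - ∑ j, M.x n i j * β₀ j) ^ 2) ≤
        K * M.σv n * √(s n / n) := fun n => by
    by_cases hex : ∃ β₀ : Fin (M.p n) → ℝ, (supp β₀).card ≤ s n ∧
      √(En fun i => (M.f n (M.z n i) - ∑ j, M.x n i j * β₀ j) ^ 2) ≤
        K * M.σv n * √(s n / n)
    · exact hex.imp fun β₀ hβ₀ _ => hβ₀
    · exact ⟨0, fun h => absurd h hex⟩
  choose β₀ hβ₀ using hK'
  refine ⟨β₀, ⟨⟨?_, h.sparse.1, ?_, ⟨(|K| + 1) * b, by positivity, ?_⟩, h.growth,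
    ⟨l, κ₁, κ₂, hl, hκ₁, hκ₁.trans hκ₂, ?_⟩⟩, ⟨⟨a, b, ha, hb, ?_⟩, ?_⟩, ⟨√b, ?_⟩⟩⟩
  · exact h.eventually_one_le.mono fun n hn => hn.2
  · exact hK.mono fun n hn => (hβ₀ n hn).1
  · filter_upwards [hK, hab] with n h1 h2
    refine (hβ₀ n h1).2.trans ?_
    have h3 : 0 ≤ M.σv n := ha.le.trans h2.1.1
    gcongr
    · linarith [le_abs_self K]
    · exact h2.1.2
  · filter_upwards [hse] with n hn
    exact ⟨sparseLower_of_le hn.1, sparseUpper_of_le hn.2.2⟩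
  · exact hab.mono fun n hn => hn.1
  · exact hab.mono fun n hn => hasLaw_v (ha.trans_le hn.1.1)
  · filter_upwards [hab] with n hn
    have h1 : fit (M.A n) (Pi.single 0 1) =
        fun i => fit (M.x n) (β₀ n) i + (M.f n (M.z n i) - fit (M.x n) (β₀ n) i) := by
      funext i
      rw [add_sub_cancel]
      simp [fit, A, Pi.single_apply]
    have h2 := (hn.2.2 (Pi.single 0 1)).2
    rw [h1] at h2
    refine Real.le_sqrt_of_sq_le (h2.trans_eq ?_)
    simp [Pi.single_apply]

lemma NoiseEstimate.tendsto (h : M.ASIV s) (hγ : M.ConfidenceLevel γ) (hc : 1 < c)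
    {sig : ∀ n, Ω n → ℝ} (hsig : M.NoiseEstimate c γ sig) :
    Tendsto (fun q : Σ n, Ω n => sig q.1 q.2 - M.σv q.1) (whp μ) (𝓝 0) := by
  obtain ⟨β₀, hD⟩ := h.exists_noisyDesign
  have hΛ := (h.regularDesign hγ).penaltyLevel_lam
  have hy : ∀ n ω i, M.y₂ n ω i = fit (M.x n) (β₀ n) i +
      (M.f n (M.z n i) - fit (M.x n) (β₀ n) i) + M.v n i ω := fun n ω i => by
    rw [add_sub_cancel, y₂]
  cases hsig with
  | consistent h1 =>
    exact (isLittleOP_iff_tendsto (X := fun n ω => sig n ω - M.σv n)).1 h1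
  | lassoIteration ψ tol K I₀ hψ hcψ htol hK hI₀ h1 =>
    exact hD.tendsto_of_reports hy hc hψ hcψ hI₀
      (step := fun n ω => LassoStep (M.y₂ n ω) (M.x n) c (γ n))
      (hD.lassoStep_accurate hy hΛ c) h1
  | postLassoIteration ψ tol K I₀ hψ hcψ htol hK hI₀ h1 =>
    exact hD.tendsto_of_reports hy hc hψ hcψ hI₀
      (step := fun n ω => PostLassoStep (M.y₂ n ω) (M.x n) c (γ n))
      (hD.postLassoStep_accurate hy hΛ c) h1

lemma FeasibleFirstStage.exists_good (h : M.ASIV s) (hγ : M.ConfidenceLevel γ) (hc : 1 < c)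
    {β : ∀ n, Ω n → Fin (M.p n) → ℝ} (hβ : M.FeasibleFirstStage c γ β) :
    ∃ (β₀ : ∀ n, Fin (M.p n) → ℝ) (B : ℝ), 0 < B ∧
      SparseDesign M.x s β₀ (fun n i => M.f n (M.z n i) - fit (M.x n) (β₀ n) i) ∧
      ∀ᶠ q : Σ n, Ω n in whp μ, Good M.x s β₀ B q.1 (β q.1 q.2) := by
  obtain ⟨β₀, hD⟩ := h.exists_noisyDesign
  have hR := h.regularDesign hγ
  have hy : ∀ n ω i, M.y₂ n ω i = fit (M.x n) (β₀ n) i +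
      (M.f n (M.z n i) - fit (M.x n) (β₀ n) i) + M.v n i ω := fun n ω i => by
    rw [add_sub_cancel, y₂]
  have key : ∀ b, M.FeasibleLasso c γ b →
      NoisyDesign.GoodFirstStage μ M.x s β₀ M.y₂ b := by
    intro b hb
    cases hb with
    | iteratedIndep sig hsig hb =>
      exact hD.goodFirstStage_of_tendsto hy hR.penaltyLevel_phiInv hc (hsig.tendsto h hγ hc)
        (Eventually.of_forall fun q => hb q.1 q.2)
    | iteratedDep sig hsig hb =>
      exact hD.goodFirstStage_of_tendsto hy hR.penaltyLevel_lam hc (hsig.tendsto h hγ hc)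
        (Eventually.of_forall fun q => hb q.1 q.2)
    | sqrtDep hb => exact hD.goodFirstStage_of_isSqrtLasso hy hR.penaltyLevel_lamSqrt hc hb
    | sqrtIndep hb => exact hD.goodFirstStage_of_isSqrtLasso hy hR.penaltyLevel_phiInv hc hb
  rcases hβ with hβ | ⟨b', hb', hls⟩
  · obtain ⟨B, hB, hg⟩ := key β hβ
    exact ⟨β₀, B, hB, hD.toSparseDesign, hg.mono fun q hq => hq.1⟩
  · obtain ⟨B, hB, hg⟩ := key b' hb'
    exact ⟨β₀, B, hB, hD.toSparseDesign, hg.mono fun q hq => hq.2 _ (hls q.1 q.2)⟩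

end IVArray

/-! ### Inverses and square roots of positive definite matrices -/

section Matrices

variable {d : ℕ} {Q G S T : Matrix (Fin d) (Fin d) ℝ}

/-- The quadratic form of `Q` is at least `c` times the squared Euclidean norm. -/
def FormGE (c : ℝ) (Q : Matrix (Fin d) (Fin d) ℝ) : Prop :=
  ∀ u : Fin d → ℝ, c * ∑ j, u j ^ 2 ≤ u ⬝ᵥ Q.mulVec u

lemma FormGE.det_isUnit {c : ℝ} (hc : 0 < c) (h : FormGE c G) : IsUnit G.det := by
  rw [isUnit_iff_ne_zero]
  intro h0
  obtain ⟨u, hu, h1⟩ := Matrix.exists_mulVec_eq_zero_iff.2 h0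
  have h2 := h u
  rw [h1, dotProduct_zero] at h2
  have := mul_pos hc (sum_sq_pos hu)
  linarith

lemma sq_le_sum_sq (u : Fin d → ℝ) (j : Fin d) : u j ^ 2 ≤ ∑ k, u k ^ 2 :=
  Finset.single_le_sum (f := fun k => u k ^ 2) (fun _ _ => sq_nonneg _) (Finset.mem_univ j)

lemma FormGE.abs_inv_le {c : ℝ} (hc : 0 < c) (h : FormGE c G) (j k : Fin d) :
    |G⁻¹ j k| ≤ 1 / c := by
  have hG := h.det_isUnit hc
  set u : Fin d → ℝ := fun j => G⁻¹ j k with hu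
  have h1 : G.mulVec u = Pi.single k 1 := by
    have h2 : u = G⁻¹.mulVec (Pi.single k 1) := by
      rw [Matrix.mulVec_single_one]
      rfl
    rw [h2, Matrix.mulVec_mulVec, Matrix.mul_nonsing_inv _ hG, Matrix.one_mulVec]
  have h2 := h u
  rw [h1, dotProduct_single_one] at h2
  have h3 := sq_le_sum_sq u k
  have h4 := sq_le_sum_sq u j
  have h5 : u k ≤ 1 / c := by
    rw [le_div_iff₀ hc]
    by_contra! h6
    have h7 : 0 < u k := by nlinarith
    nlinarith
  refine abs_le_of_sq_le_sq ?_ (by positivity)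
  calc G⁻¹ j k ^ 2 ≤ ∑ k, u k ^ 2 := h4
    _ ≤ u k / c := by rw [le_div_iff₀ hc, mul_comm]; exact h2
    _ ≤ (1 / c) / c := by gcongr
    _ = (1 / c) ^ 2 := by field_simp

/-- A form bound is stable under small changes of the entries. -/
lemma FormGE.of_sub {c : ℝ} (h : FormGE c Q) : FormGE (c - ∑ j, ∑ k, |G j k - Q j k|) G := by
  intro u
  have h1 : u ⬝ᵥ Q.mulVec u - u ⬝ᵥ G.mulVec u ≤ (∑ j, ∑ k, |G j k - Q j k|) * ∑ j, u j ^ 2 := by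
    have h2 := sq_le_sum_sq u
    set N := ∑ j, u j ^ 2
    rw [← dotProduct_sub, ← Matrix.sub_mulVec, Finset.sum_mul]
    simp only [dotProduct, Matrix.mulVec, Finset.mul_sum, Finset.sum_mul, Matrix.sub_apply]
    refine Finset.sum_le_sum fun j _ => Finset.sum_le_sum fun k _ => ?_
    have h4 : |u j * u k| ≤ N := by
      rw [abs_mul]
      have := two_mul_le_add_sq |u j| |u k|
      rw [sq_abs, sq_abs] at this
      linarith [h2 j, h2 k]
    calc u j * ((Q j k - G j k) * u k) = (Q j k - G j k) * (u j * u k) := by ring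
      _ ≤ |(Q j k - G j k) * (u j * u k)| := le_abs_self _
      _ = |G j k - Q j k| * |u j * u k| := by rw [abs_mul, abs_sub_comm]
      _ ≤ _ := by gcongr
  have := h u
  linarith

open scoped MatrixOrder in
lemma FormGE.le_spectrum {c : ℝ} (hQ : IsSelfAdjoint Q) (h : FormGE c Q) :
    ∀ e ∈ spectrum ℝ Q, c ≤ e := by
  refine (algebraMap_le_iff_le_spectrum (ha := hQ)).1 (Matrix.le_iff.2 ?_)
  refine Matrix.PosSemidef.of_dotProduct_mulVec_nonneg ?_ fun u => ?_
  · exact hQ.sub (IsSelfAdjoint.algebraMap _ (IsSelfAdjoint.all c))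
  · have h1 := h u
    rw [star_trivial, Matrix.sub_mulVec, dotProduct_sub, dotProduct_algebraMap]
    linarith

/-- The matrix `(t Q⁻¹)^{-1/2}` is the positive square root of `Q / t`. -/
lemma invSqrt_smul_inv {c t : ℝ} (hc : 0 < c) (ht : 0 < t) (hQ : IsSelfAdjoint Q) (h : FormGE c Q) :
    invSqrt (t • Q⁻¹) = cfc (fun e : ℝ => √(e / t)) Q := by
  have hs := h.le_spectrum hQ
  have hne : ∀ e ∈ spectrum ℝ Q, e ≠ 0 := fun e he => (hc.trans_le (hs e he)).ne'
  have h1 : t • Q⁻¹ = cfc (fun e : ℝ => t * e⁻¹) Q := by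
    rw [cfc_const_mul t (fun e : ℝ => e⁻¹) Q (continuousOn_id.inv₀ hne),
      cfc_inv (fun e : ℝ => e) Q hne (ha := hQ), cfc_id' ℝ Q hQ, Matrix.nonsing_inv_eq_ringInverse]
  have hcont : ContinuousOn (fun e : ℝ => t * e⁻¹) (spectrum ℝ Q) :=
    continuousOn_const.mul (continuousOn_id.inv₀ hne)
  rw [invSqrt, h1, ← cfc_comp (fun t : ℝ => (√t)⁻¹) (fun e : ℝ => t * e⁻¹) Q hQ ?_ hcont]
  · refine cfc_congr fun e he => ?_
    simp only [Function.comp]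
    rw [← Real.sqrt_inv, mul_inv, inv_inv, inv_mul_eq_div]
  · refine Real.continuous_sqrt.continuousOn.inv₀ ?_
    rintro _ ⟨e, he, rfl⟩
    have : 0 < e := hc.trans_le (hs e he)
    positivity

/-- `S` is a symmetric square root of `P` whose quadratic form has the lower bound `c`. -/
structure IsPosSqrt (c : ℝ) (P S : Matrix (Fin d) (Fin d) ℝ) : Prop where
  transpose_eq : S.transpose = S
  mul_self : S * S = P
  formGE : FormGE c S

open scoped MatrixOrder in
lemma isPosSqrt_invSqrt {c t : ℝ} (hc : 0 < c) (ht : 0 < t) (hQ : IsSelfAdjoint Q) (h : FormGE c Q) :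
    IsPosSqrt √(c / t) (t⁻¹ • Q) (invSqrt (t • Q⁻¹)) := by
  rw [invSqrt_smul_inv hc ht hQ h]
  have hs := h.le_spectrum hQ
  have hcont : ContinuousOn (fun e : ℝ => √(e / t)) (spectrum ℝ Q) := by fun_prop
  refine ⟨?_, ?_, fun u => ?_⟩
  · have h1 : IsSelfAdjoint (cfc (fun e : ℝ => √(e / t)) Q) := cfc_predicate _ _
    rw [isSelfAdjoint_iff, Matrix.star_eq_conjTranspose, Matrix.conjTranspose_eq_transpose_of_trivial]
      at h1
    exact h1
  · rw [← cfc_mul _ _ Q hcont hcont]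
    have h1 : t⁻¹ • Q = cfc (fun e : ℝ => t⁻¹ * e) Q := by
      rw [cfc_const_mul t⁻¹ (fun e : ℝ => e) Q, cfc_id' ℝ Q hQ]
    rw [h1]
    refine cfc_congr fun e he => ?_
    have : 0 < e := hc.trans_le (hs e he)
    rw [Real.mul_self_sqrt (by positivity), inv_mul_eq_div]
  · have h1 := algebraMap_le_cfc (fun e : ℝ => √(e / t)) √(c / t) Q
      (fun e he => by have := hs e he; gcongr) hcont hQ
    have h2 := (Matrix.le_iff.1 h1).dotProduct_mulVec_nonneg u
    rw [star_trivial, Matrix.sub_mulVec, dotProduct_sub, dotProduct_algebraMap] at h2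
    linarith

/-- Positive square roots depend continuously on the matrix: pair the identity
`S (S - T) + (S - T) T = S² - T²` with `S - T` in the Frobenius inner product. -/
lemma abs_sub_le_of_formGE {c : ℝ} (hc : 0 < c) (hS : S.transpose = S) (hT : T.transpose = T)
    (hSc : FormGE c S) (hT0 : FormGE 0 T) (j k : Fin d) :
    |S j k - T j k| ≤ (∑ j, ∑ k, |(S * S) j k - (T * T) j k|) / c := by
  set D := S - T with hD
  have hDt : D.transpose = D := by rw [hD, Matrix.transpose_sub, hS, hT]
  have hDs : ∀ j k, D j k = D k j := fun j k => by
    conv_lhs => rw [← hDt]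
    rfl
  set F := ∑ j, ∑ k, D j k ^ 2 with hF
  have hF0 : 0 ≤ F := by positivity
  have hDF : ∀ j k, |D j k| ≤ √F := fun j k => Real.abs_le_sqrt ((sq_le_sum_sq (D j) k).trans
    (Finset.single_le_sum (f := fun j => ∑ k, D j k ^ 2) (fun _ _ => by positivity)
      (Finset.mem_univ j)))
  have hform : ∀ R : Matrix (Fin d) (Fin d) ℝ,
      (D * (R * D)).trace = ∑ k, (fun j => D j k) ⬝ᵥ R.mulVec fun j => D j k := by
    intro R
    simp only [Matrix.trace, Matrix.diag, Matrix.mul_apply, dotProduct, Matrix.mulVec]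
    exact Finset.sum_congr rfl fun k _ => Finset.sum_congr rfl fun j _ => by rw [hDs k j]
  have hcol : ∑ k, ∑ j, D j k ^ 2 = F := Finset.sum_comm
  have h1 : c * F ≤ (D * (S * D)).trace := by
    rw [hform, ← hcol, Finset.mul_sum]
    exact Finset.sum_le_sum fun k _ => hSc _
  have h2 : 0 ≤ (D * (D * T)).trace := by
    rw [← Matrix.trace_mul_comm, Matrix.mul_assoc, hform]
    refine Finset.sum_nonneg fun k _ => ?_
    have := hT0 fun j => D j k
    rwa [zero_mul] at this
  have h3 : (D * (S * D)).trace + (D * (D * T)).trace = (D * (S * S - T * T)).trace := by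
    rw [← Matrix.trace_add, ← Matrix.mul_add]
    congr 2
    rw [hD, Matrix.mul_sub, Matrix.sub_mul]
    abel
  set E := ∑ j, ∑ k, |(S * S) j k - (T * T) j k| with hE
  have h4 : (D * (S * S - T * T)).trace ≤ √F * E := by
    simp only [Matrix.trace, Matrix.diag, Matrix.mul_apply (M := D), Matrix.sub_apply]
    rw [Finset.sum_comm, hE, Finset.mul_sum]
    refine Finset.sum_le_sum fun j _ => ?_
    rw [Finset.mul_sum]
    refine Finset.sum_le_sum fun k _ => ?_
    refine (le_abs_self _).trans ?_
    rw [abs_mul]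
    gcongr
    exact hDF k j
  have h5 : c * √F ≤ E := by
    rcases hF0.eq_or_lt with h0 | h0
    · rw [← h0, Real.sqrt_zero, mul_zero]
      positivity
    · have h6 : 0 < √F := Real.sqrt_pos.2 h0
      have h7 : √F * (c * √F) ≤ √F * E := by
        calc √F * (c * √F) = c * (√F * √F) := by ring
          _ = c * F := by rw [Real.mul_self_sqrt hF0]
          _ ≤ _ := by linarith
      exact le_of_mul_le_mul_left h7 h6
  have h6 : |S j k - T j k| ≤ √F := hDF j k
  rw [le_div_iff₀ hc]
  nlinarith

end Matrices

/-! ### Limits of random matrices -/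

section Close

variable {ι : Type*} {l : Filter ι} {d : ℕ} {X X₀ Y Y₀ : ι → Matrix (Fin d) (Fin d) ℝ}

/-- Families of matrices that are bounded and approach each other along a filter, entry by entry. -/
structure Close (l : Filter ι) (X X₀ : ι → Matrix (Fin d) (Fin d) ℝ) : Prop where
  bounded : ∀ j k, (fun q => X₀ q j k) =O[l] fun _ => (1 : ℝ)
  sub : ∀ j k, (fun q => X q j k - X₀ q j k) =o[l] fun _ => (1 : ℝ)

lemma Close.refl (h : ∀ j k, (fun q => X q j k) =O[l] fun _ => (1 : ℝ)) : Close l X X :=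
  ⟨h, fun j k => by simp only [sub_self]; exact isLittleO_zero _ _⟩

lemma Close.bounded_left (h : Close l X X₀) (j k : Fin d) :
    (fun q => X q j k) =O[l] fun _ => (1 : ℝ) := by
  have := (h.sub j k).isBigO.add (h.bounded j k)
  simpa using this

lemma Close.mul (hX : Close l X X₀) (hY : Close l Y Y₀) :
    Close l (fun q => X q * Y q) fun q => X₀ q * Y₀ q := by
  have h1 : ∀ (f g : ι → ℝ), f =O[l] (fun _ => (1 : ℝ)) → g =O[l] (fun _ => (1 : ℝ)) →
      (fun q => f q * g q) =O[l] fun _ => (1 : ℝ) := fun f g hf hg => by simpa using hf.mul hg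
  refine ⟨fun j k => ?_, fun j k => ?_⟩
  · simp only [Matrix.mul_apply]
    exact IsBigO.fun_sum fun i _ => h1 _ _ (hX.bounded j i) (hY.bounded i k)
  · have h2 : ∀ q, (X q * Y q) j k - (X₀ q * Y₀ q) j k =
        ∑ i, ((X q j i - X₀ q j i) * Y q i k + X₀ q j i * (Y q i k - Y₀ q i k)) := by
      intro q
      rw [Matrix.mul_apply, Matrix.mul_apply, ← Finset.sum_sub_distrib]
      exact Finset.sum_congr rfl fun i _ => by ring
    simp only [h2]
    refine IsLittleO.fun_sum fun i _ => IsLittleO.add ?_ ?_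
    · simpa using (hX.sub j i).mul_isBigO (hY.bounded_left i k)
    · simpa using (hX.bounded j i).mul_isLittleO (hY.sub i k)

lemma Close.tendsto_sum_abs (h : Close l X X₀) :
    Tendsto (fun q => ∑ j, ∑ k, |X q j k - X₀ q j k|) l (𝓝 0) := by
  have := tendsto_finsetSum Finset.univ fun j (_ : j ∈ Finset.univ) =>
    tendsto_finsetSum Finset.univ fun k (_ : k ∈ Finset.univ) =>
      ((isLittleO_one_iff ℝ).1 (h.sub j k)).abs
  simpa using this

/-- A form bound is inherited, up to a factor, by nearby matrices. -/
lemma Close.formGE (h : Close l X X₀) {c : ℝ} (hc : 0 < c) (hX : ∀ᶠ q in l, FormGE c (X₀ q)) :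
    ∀ᶠ q in l, FormGE (c / 2) (X q) := by
  filter_upwards [hX, h.tendsto_sum_abs.eventually_le_const (half_pos hc)] with q h1 h2 u
  refine le_trans ?_ (h1.of_sub u)
  gcongr
  linarith

lemma Close.inv (h : Close l X X₀) {c : ℝ} (hc : 0 < c) (hX : ∀ᶠ q in l, FormGE c (X₀ q)) :
    Close l (fun q => (X q)⁻¹) fun q => (X₀ q)⁻¹ := by
  have hX' := h.formGE hc hX
  have hb : ∀ {Z : ι → Matrix (Fin d) (Fin d) ℝ} {c : ℝ}, 0 < c → (∀ᶠ q in l, FormGE c (Z q)) →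
      ∀ j k, (fun q => (Z q)⁻¹ j k) =O[l] fun _ => (1 : ℝ) := by
    intro Z c hc hZ j k
    refine IsBigO.of_bound (1 / c) ?_
    filter_upwards [hZ] with q hq
    rw [norm_one, mul_one]
    exact hq.abs_inv_le hc j k
  refine ⟨hb hc hX, fun j k => ?_⟩
  -- The resolvent identity `X⁻¹ - X₀⁻¹ = X⁻¹ (X₀ - X) X₀⁻¹`.
  have h1 : ∀ᶠ q in l, ∑ m, ∑ i, (X q)⁻¹ j i * (X₀ q i m - X q i m) * (X₀ q)⁻¹ m k =
      (X q)⁻¹ j k - (X₀ q)⁻¹ j k := by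
    filter_upwards [hX, hX'] with q h2 h3
    have h4 : (X q)⁻¹ * (X₀ q - X q) * (X₀ q)⁻¹ = (X q)⁻¹ - (X₀ q)⁻¹ := by
      rw [Matrix.mul_sub, Matrix.nonsing_inv_mul _ (h3.det_isUnit (half_pos hc)), Matrix.sub_mul,
        Matrix.mul_assoc, Matrix.mul_nonsing_inv _ (h2.det_isUnit hc), Matrix.mul_one,
        Matrix.one_mul]
    have h5 := congrFun (congrFun h4 j) k
    simp only [Matrix.mul_apply, Finset.sum_mul, Matrix.sub_apply] at h5
    exact h5
  refine IsLittleO.congr' ?_ h1 EventuallyEq.rfl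
  refine IsLittleO.fun_sum fun m _ => IsLittleO.fun_sum fun i _ => ?_
  have h2 : (fun q => X₀ q i m - X q i m) =o[l] fun _ => (1 : ℝ) := by
    simpa using (h.sub i m).neg_left
  have h3 := ((hb (half_pos hc) hX' j i).mul_isLittleO h2).mul_isBigO (hb hc hX m k)
  simpa using h3

/-- The standardising matrices `(t Q⁻¹)^{-1/2}` approach each other when the variances `t` and the
matrices `Q` do. -/
lemma Close.invSqrt (h : Close l X X₀) {c C : ℝ} (hc : 0 < c) (hC : 0 < C)
    (hX : ∀ᶠ q in l, FormGE c (X₀ q)) (hsa : ∀ᶠ q in l, IsSelfAdjoint (X q))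
    (hsa₀ : ∀ᶠ q in l, IsSelfAdjoint (X₀ q)) {t t₀ : ι → ℝ} (ht₀ : ∀ᶠ q in l, c ≤ t₀ q ∧ t₀ q ≤ C)
    (ht : Tendsto (fun q => t q - t₀ q) l (𝓝 0)) :
    Close l (fun q => LassoIV.invSqrt (t q • (X q)⁻¹)) fun q =>
      LassoIV.invSqrt (t₀ q • (X₀ q)⁻¹) := by
  have hX' := h.formGE hc hX
  have ht' : ∀ᶠ q in l, c / 2 ≤ t q := by
    filter_upwards [ht₀, ht.eventually_const_le (neg_lt_zero.2 (half_pos hc))] with q h1 h2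
    linarith
  have hinv₀ : (fun q => (t₀ q)⁻¹) =O[l] fun _ => (1 : ℝ) := by
    refine IsBigO.of_bound c⁻¹ (ht₀.mono fun q hq => ?_)
    rw [norm_one, mul_one, norm_inv, Real.norm_of_nonneg (hc.le.trans hq.1)]
    exact inv_anti₀ hc hq.1
  have hinv : (fun q => (t q)⁻¹) =O[l] fun _ => (1 : ℝ) := by
    refine IsBigO.of_bound (c / 2)⁻¹ (ht'.mono fun q hq => ?_)
    rw [norm_one, mul_one, norm_inv, Real.norm_of_nonneg ((half_pos hc).le.trans hq)]
    exact inv_anti₀ (half_pos hc) hq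
  have hinv_sub : (fun q => (t q)⁻¹ - (t₀ q)⁻¹) =o[l] fun _ => (1 : ℝ) := by
    have h1 : (fun q => t₀ q - t q) =o[l] fun _ => (1 : ℝ) := by
      rw [isLittleO_one_iff]
      simpa using ht.neg
    have h2 := (hinv.mul_isLittleO h1).mul_isBigO hinv₀
    refine IsLittleO.congr' h2 ?_ (by simp)
    filter_upwards [ht₀, ht'] with q h3 h4
    have h5 : 0 < t q := by linarith
    have h6 : 0 < t₀ q := by linarith
    field_simp
  have hsq : Close l (fun q => (t q)⁻¹ • X q) fun q => (t₀ q)⁻¹ • X₀ q := by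
    refine ⟨fun j k => ?_, fun j k => ?_⟩
    · simpa using hinv₀.mul (h.bounded j k)
    · have h1 := (hinv_sub.mul_isBigO (h.bounded_left j k)).add
        (by simpa using hinv₀.mul_isLittleO (h.sub j k) :
          (fun q => (t₀ q)⁻¹ * (X q j k - X₀ q j k)) =o[l] fun _ => (1 : ℝ) * 1)
      rw [show (fun _ : ι => (1 : ℝ) * 1) = fun _ => 1 by simp] at h1
      refine h1.congr_left fun q => ?_
      simp only [Matrix.smul_apply, smul_eq_mul]
      ring
  have hS₀ : ∀ᶠ q in l, IsPosSqrt √(c / t₀ q) ((t₀ q)⁻¹ • X₀ q)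
      (LassoIV.invSqrt (t₀ q • (X₀ q)⁻¹)) := by
    filter_upwards [hX, hsa₀, ht₀] with q h1 h2 h3
    exact isPosSqrt_invSqrt (t := t₀ q) hc (hc.trans_le h3.1) h2 h1
  have hS : ∀ᶠ q in l, IsPosSqrt √(c / 2 / t q) ((t q)⁻¹ • X q)
      (LassoIV.invSqrt (t q • (X q)⁻¹)) := by
    filter_upwards [hX', hsa, ht'] with q h1 h2 h3
    exact isPosSqrt_invSqrt (t := t q) (half_pos hc) ((half_pos hc).trans_le h3) h2 h1
  refine ⟨fun j k => ?_, fun j k => ?_⟩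
  · -- The squared entries of a row of a symmetric root add up to a diagonal entry of the matrix.
    have h1 : (fun q => √|((t₀ q)⁻¹ • X₀ q) j j|) =O[l] fun _ => (1 : ℝ) := by
      obtain ⟨K, hK⟩ := (hsq.bounded j j).bound
      refine IsBigO.of_bound √K (hK.mono fun q hq => ?_)
      rw [norm_one, mul_one] at hq ⊢
      rw [Real.norm_of_nonneg (Real.sqrt_nonneg _)]
      exact Real.sqrt_le_sqrt hq
    refine IsBigO.trans (IsBigO.of_bound 1 ?_) h1
    filter_upwards [hS₀] with q hq
    rw [one_mul, Real.norm_of_nonneg (Real.sqrt_nonneg _), Real.norm_eq_abs]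
    refine Real.abs_le_sqrt ?_
    rw [← hq.mul_self, Matrix.mul_apply]
    refine le_trans ?_ (le_abs_self _)
    have h2 : ∀ m, LassoIV.invSqrt (t₀ q • (X₀ q)⁻¹) m j =
        LassoIV.invSqrt (t₀ q • (X₀ q)⁻¹) j m := fun m => by
      conv_lhs => rw [← hq.transpose_eq]
      rfl
    simp only [h2, ← sq]
    exact sq_le_sum_sq _ k
  · rw [isLittleO_one_iff]
    refine squeeze_zero_norm' ?_ (by
      simpa using hsq.tendsto_sum_abs.div_const √(c / C) :
      Tendsto (fun q => (∑ j, ∑ k, |((t q)⁻¹ • X q) j k - ((t₀ q)⁻¹ • X₀ q) j k|) / √(c / C)) l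
        (𝓝 0))
    filter_upwards [hS₀, hS, ht₀] with q h1 h2 h3
    rw [← h1.mul_self, ← h2.mul_self, Real.norm_eq_abs, abs_sub_comm]
    have h4 : FormGE √(c / C) (LassoIV.invSqrt (t₀ q • (X₀ q)⁻¹)) := fun u => by
      refine le_trans ?_ (h1.formGE u)
      have := hc.trans_le h3.1
      gcongr
      exact h3.2
    have h5 : FormGE 0 (LassoIV.invSqrt (t q • (X q)⁻¹)) := fun u => by
      refine le_trans ?_ (h2.formGE u)
      gcongr
      positivity
    refine (abs_sub_le_of_formGE (by positivity) h1.transpose_eq h2.transpose_eq h4 h5 j k).trans_eq ?_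
    simp only [abs_sub_comm]

end Close

/-! ### Averages of Gaussian noise -/

section Averages

lemma sqrt_mul_En {n : ℕ} (hn : 1 ≤ n) {σ : ℝ} (hσ : σ ≠ 0) (a v : Fin n → ℝ) :
    √n * (En fun i => a i * v i) = ∑ i, a i * (σ / √n) * (v i / σ) := by
  have h1 : (0 : ℝ) < √n := Real.sqrt_pos.2 (by exact_mod_cast hn)
  have h2 : √n ^ 2 = (n : ℝ) := Real.sq_sqrt n.cast_nonneg
  rw [En, mul_div_assoc', Finset.mul_sum, Finset.sum_div]
  refine Finset.sum_congr rfl fun i _ => ?_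
  have h3 : (n : ℝ) ≠ 0 := by positivity
  field_simp
  rw [h2]
  ring

lemma sum_sq_mul_div_sqrt {n : ℕ} (a : Fin n → ℝ) (σ : ℝ) :
    ∑ i, (a i * (σ / √n)) ^ 2 = (σ * nrm a) ^ 2 := by
  rw [mul_pow, nrm_sq, En, mul_div_assoc', Finset.mul_sum, Finset.sum_div]
  refine Finset.sum_congr rfl fun i _ => ?_
  rw [mul_pow, div_pow, Real.sq_sqrt n.cast_nonneg]
  ring

namespace GaussianNoise

variable {Ω : ℕ → Type*} [∀ n, MeasurableSpace (Ω n)] {μ : ∀ n, Measure (Ω n)}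
  {v : ∀ n, Ω n → Fin n → ℝ} {σ : ℕ → ℝ} {a : ∀ n, Fin n → ℝ}

lemma isBigOP_average (h : GaussianNoise μ v σ) {C : ℝ} (ha : ∀ᶠ n in atTop, nrm (a n) ≤ C) :
    IsBigOP μ fun n ω => √n * En fun i => a n i * v n ω i := by
  obtain ⟨l, u, hl, hu, hlu⟩ := h.bounds
  have h1 : IsBigOP stdNormal fun n g => ∑ i, a n i * (σ n / √n) * g i := by
    refine isBigOP_of_variance (Eventually.of_forall fun n => memLp_linear _)
      (Eventually.of_forall fun n => integral_linear _) (B := (u * C) ^ 2) ?_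
    filter_upwards [ha, hlu] with n h2 h3
    rw [variance_linear, sum_sq_mul_div_sqrt]
    have h4 := nrm_nonneg (a n)
    have h5 : 0 ≤ σ n := hl.le.trans h3.1
    gcongr
    exact h3.2
  intro ε hε
  obtain ⟨K, hK⟩ := isBigOP_of_hasLaw h.law h1 ε hε
  refine ⟨K, ?_⟩
  filter_upwards [hK, h.sigma_pos, eventually_ge_atTop 1] with n h2 h3 h4
  simpa only [sqrt_mul_En h4 h3.ne'] using h2

lemma tendsto_average (h : GaussianNoise μ v σ) (ha : Tendsto (fun n => nrm (a n)) atTop (𝓝 0)) :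
    Tendsto (fun q : Σ n, Ω n => √q.1 * En fun i => a q.1 i * v q.1 q.2 i) (whp μ) (𝓝 0) := by
  obtain ⟨l, u, hl, hu, hlu⟩ := h.bounds
  have h1 : Tendsto (fun q : Σ n, (Fin n → ℝ) => ∑ i, a q.1 i * (σ q.1 / √q.1) * q.2 i)
      (whp stdNormal) (𝓝 0) := by
    have h2 := tendsto_whp_of_variance (μ := stdNormal)
      (X := fun n g => ∑ i, a n i * (σ n / √n) * g i) (m := fun _ => 0)
      (e := fun n => (u * nrm (a n)) ^ 2)
      (Eventually.of_forall fun n => memLp_linear _)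
      (Eventually.of_forall fun n => integral_linear _)
      (by simpa using (ha.const_mul u).pow 2) (by
        filter_upwards [hlu] with n h3
        rw [variance_linear, sum_sq_mul_div_sqrt]
        have h4 := nrm_nonneg (a n)
        have h5 : 0 ≤ σ n := hl.le.trans h3.1
        gcongr
        exact h3.2)
    simpa using h2
  refine (h1.comp (tendsto_whp_of_hasLaw h.law)).congr' ?_
  filter_upwards [eventually_whp_fst h.sigma_pos, eventually_whp_fst (eventually_ge_atTop 1)]
    with q h3 h4
  exact (sqrt_mul_En h4 h3.ne' _ _).symm

lemma tendsto_En (h : GaussianNoise μ v σ) {C : ℝ} (ha : ∀ᶠ n in atTop, nrm (a n) ≤ C) :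
    Tendsto (fun q : Σ n, Ω n => En fun i => a q.1 i * v q.1 q.2 i) (whp μ) (𝓝 0) := by
  have h1 : Tendsto (fun q : Σ n, Ω n => (√(q.1 : ℝ))⁻¹) (whp μ) (𝓝 0) :=
    ((Real.tendsto_sqrt_atTop.comp tendsto_natCast_atTop_atTop).inv_tendsto_atTop).comp
      tendsto_fst_whp
  refine (tendsto_whp_mul_of_isBigOP (X := fun n _ => (√(n : ℝ))⁻¹) h1
    (h.isBigOP_average ha)).congr' ?_
  filter_upwards [eventually_whp_fst (eventually_ge_atTop 1)] with q hq
  have : (0 : ℝ) < √q.1 := Real.sqrt_pos.2 (by exact_mod_cast hq)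
  rw [← mul_assoc, inv_mul_cancel₀ this.ne', one_mul]

lemma isBigO_nrm (h : GaussianNoise μ v σ) :
    (fun q : Σ n, Ω n => nrm (v q.1 q.2)) =O[whp μ] fun _ => (1 : ℝ) := by
  obtain ⟨l, u, hl, hu, hlu⟩ := h.bounds
  refine IsBigO.of_bound (u + 1) ?_
  filter_upwards [h.tendsto_nrm.eventually_le_const one_pos, eventually_whp_fst hlu] with q h1 h2
  rw [norm_one, mul_one, Real.norm_of_nonneg (nrm_nonneg _)]
  linarith [h2.2]

end GaussianNoise

end Averages

/-! ### Second stage -/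

section SecondStage

variable {Ω : ℕ → Type*} [∀ n, MeasurableSpace (Ω n)] {μ : ∀ n, Measure (Ω n)}

/-- Slutsky's theorem for linear maps with random coefficients. -/
lemma Close.tendsto_mulVec_sub {d : ℕ} {W W₀ : (Σ n, Ω n) → Matrix (Fin d) (Fin d) ℝ}
    (h : Close (whp μ) W W₀) {S R : ∀ n, Ω n → Fin d → ℝ}
    (hS : ∀ j, IsBigOP μ fun n ω => S n ω j)
    (hR : ∀ j, Tendsto (fun q : Σ n, Ω n => R q.1 q.2 j) (whp μ) (𝓝 0)) :
    Tendsto (fun q : Σ n, Ω n => (W q).mulVec (S q.1 q.2 + R q.1 q.2) - (W₀ q).mulVec (S q.1 q.2))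
      (whp μ) (𝓝 0) := by
  rw [tendsto_pi_nhds]
  intro j
  have h1 : ∀ k, Tendsto (fun q : Σ n, Ω n => (W q j k - W₀ q j k) *
      (S q.1 q.2 k + R q.1 q.2 k) + W₀ q j k * R q.1 q.2 k) (whp μ) (𝓝 0) := by
    intro k
    have h2 := tendsto_whp_mul_of_isBigOP (X := fun n ω => W ⟨n, ω⟩ j k - W₀ ⟨n, ω⟩ j k)
      (Y := fun n ω => S n ω k + R n ω k) ((isLittleO_one_iff ℝ).1 (h.sub j k))
      ((hS k).add_tendsto (Y := fun n ω => R n ω k) (hR k))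
    have h3 : Tendsto (fun q : Σ n, Ω n => W₀ q j k * R q.1 q.2 k) (whp μ) (𝓝 0) := by
      rw [← isLittleO_one_iff ℝ]
      simpa using (h.bounded j k).mul_isLittleO ((isLittleO_one_iff ℝ).2 (hR k))
    simpa using h2.add h3
  have h4 := tendsto_finsetSum Finset.univ fun k (_ : k ∈ Finset.univ) => h1 k
  simp only [Finset.sum_const_zero] at h4
  refine h4.congr fun q => ?_
  simp only [Pi.sub_apply, Matrix.mulVec, dotProduct, Pi.add_apply]
  rw [← Finset.sum_sub_distrib]
  exact Finset.sum_congr rfl fun k _ => by ring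

end SecondStage

namespace IVArray

variable {Ω : ℕ → Type*} [∀ n, MeasurableSpace (Ω n)] {μ : ∀ n, Measure (Ω n)} {kw : ℕ}
  {M : IVArray μ kw} {s : ℕ → ℕ} {c : ℝ} {γ : ℕ → ℝ} {β : ∀ n, Ω n → Fin (M.p n) → ℝ}

lemma ASIV.noise_v (h : M.ASIV s) : GaussianNoise μ (fun n ω i => M.v n i ω) M.σv := by
  obtain ⟨a, b, ha, hb, hab⟩ := h.exists_bounds
  exact ⟨⟨a, b, ha, hb, hab.mono fun n hn => hn.1⟩,
    hab.mono fun n hn => hasLaw_v (ha.trans_le hn.1.1)⟩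

lemma ASIV.noise_ζ (h : M.ASIV s) : GaussianNoise μ (fun n ω i => M.ζ n i ω) M.σζ := by
  obtain ⟨a, b, ha, hb, hab⟩ := h.exists_bounds
  exact ⟨⟨a, b, ha, hb, hab.mono fun n hn => hn.2.1⟩,
    hab.mono fun n hn => hasLaw_ζ (ha.trans_le hn.2.1.1)⟩

/-- The error `xᵢ'b - f(zᵢ)` of the estimated optimal instrument. -/
def instrError (M : IVArray μ kw) (n : ℕ) (b : Fin (M.p n) → ℝ) (i : Fin n) : ℝ :=
  fit (M.x n) b i - M.f n (M.z n i)

lemma Ahat_apply (n : ℕ) (b : Fin (M.p n) → ℝ) (i : Fin n) (j : Fin (kw + 1)) :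
    M.Ahat n b i j = M.A n i j + (Pi.single 0 1 : Fin (kw + 1) → ℝ) j * M.instrError n b i := by
  refine Fin.cases ?_ (fun j => ?_) j
  · simp [Ahat, A, instrError, fit]
  · simp [Ahat, A]

lemma d_apply (n : ℕ) (ω : Ω n) (i : Fin n) (j : Fin (kw + 1)) :
    M.d n ω i j = M.A n i j + (Pi.single 0 1 : Fin (kw + 1) → ℝ) j * M.v n i ω := by
  refine Fin.cases ?_ (fun j => ?_) j
  · simp [d, A, y₂]
  · simp [d, A]

lemma y₁_eq (n : ℕ) (ω : Ω n) (i : Fin n) :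
    M.y₁ n ω i = ∑ k, M.d n ω i k * M.α n k + M.ζ n i ω := by
  rw [Fin.sum_univ_succ]
  simp [y₁, d]

/-- `𝔼ₙ[Âᵢ dᵢ']`. -/
def Ghat (M : IVArray μ kw) (n : ℕ) (b : Fin (M.p n) → ℝ) (ω : Ω n) :
    Matrix (Fin (kw + 1)) (Fin (kw + 1)) ℝ :=
  Matrix.of fun j k => En fun i => M.Ahat n b i j * M.d n ω i k

/-- The score `√n 𝔼ₙ[Aᵢ ζᵢ]` of the ideal instruments. -/
def score (M : IVArray μ kw) (n : ℕ) (ω : Ω n) (j : Fin (kw + 1)) : ℝ :=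
  √n * En fun i => M.A n i j * M.ζ n i ω

/-- The contribution of the instrument error to the score. -/
def scoreError (M : IVArray μ kw) (n : ℕ) (b : Fin (M.p n) → ℝ) (ω : Ω n) (j : Fin (kw + 1)) : ℝ :=
  (Pi.single 0 1 : Fin (kw + 1) → ℝ) j * (√n * En fun i => M.instrError n b i * M.ζ n i ω)

lemma sqrt_smul_αhat_sub {n : ℕ} {b : Fin (M.p n) → ℝ} {ω : Ω n}
    (h : IsUnit (M.Ghat n b ω).det) : √(n : ℝ) • (M.αhat n b ω - M.α n) =
      (M.Ghat n b ω)⁻¹.mulVec (M.score n ω + M.scoreError n b ω) := by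
  have h1 : (fun j => En fun i => M.Ahat n b i j * M.y₁ n ω i) =
      (M.Ghat n b ω).mulVec (M.α n) + fun j => En fun i => M.Ahat n b i j * M.ζ n i ω := by
    funext j
    simp only [y₁_eq, mul_add, En_add, Finset.mul_sum, En_sum, Pi.add_apply]
    congr 1
    simp only [Matrix.mulVec, dotProduct, Ghat, Matrix.of_apply]
    refine Finset.sum_congr rfl fun k _ => ?_
    rw [mul_comm (En _), ← En_const_mul]
    exact congrArg En (funext fun i => by ring)
  have h2 : √(n : ℝ) • (fun j => En fun i => M.Ahat n b i j * M.ζ n i ω) =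
      M.score n ω + M.scoreError n b ω := by
    funext j
    simp only [Pi.smul_apply, smul_eq_mul, Pi.add_apply, score, scoreError, Ahat_apply, add_mul,
      En_add, mul_add, mul_assoc, En_const_mul]
    ring
  have h3 : M.αhat n b ω = (M.Ghat n b ω)⁻¹.mulVec
      fun j => En fun i => M.Ahat n b i j * M.y₁ n ω i := rfl
  rw [h3, h1, Matrix.mulVec_add, Matrix.mulVec_mulVec, Matrix.nonsing_inv_mul _ h,
    Matrix.one_mulVec, add_sub_cancel_left, ← Matrix.mulVec_smul, h2]

/-! #### Moments of the instruments -/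

lemma ASIV.nrm_A_le (h : M.ASIV s) : ∃ C : ℝ, 0 < C ∧ ∀ᶠ n in atTop, ∀ j,
    (nrm fun i => M.A n i j) ≤ C := by
  obtain ⟨a, b, ha, hb, hab⟩ := h.exists_bounds
  refine ⟨√b, Real.sqrt_pos.2 hb, hab.mono fun n hn j => ?_⟩
  have h1 := (hn.2.2 (Pi.single j 1)).2
  have h2 : fit (M.A n) (Pi.single j 1) = fun i => M.A n i j := by
    funext i
    simp [fit, Pi.single_apply]
  rw [h2] at h1
  refine Real.le_sqrt_of_sq_le (h1.trans_eq ?_)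
  simp [Pi.single_apply]

/-- Cross moments of perturbed instruments are close to `Qₙ`, if the perturbation of the second
factor is asymptotically orthogonal to the ideal instruments. -/
lemma ASIV.close_moments (h : M.ASIV s) {Δ η : ∀ q : Σ n, Ω n, Fin q.1 → ℝ}
    (hΔ : Tendsto (fun q => nrm (Δ q)) (whp μ) (𝓝 0))
    (hη : (fun q => nrm (η q)) =O[whp μ] fun _ => (1 : ℝ))
    (hAη : ∀ j, Tendsto (fun q => En fun i => M.A q.1 i j * η q i) (whp μ) (𝓝 0))
    (e : Fin (kw + 1) → ℝ) :
    Close (whp μ) (fun q => Matrix.of fun j k => En fun i =>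
      (M.A q.1 i j + e j * Δ q i) * (M.A q.1 i k + e k * η q i)) fun q => M.Q q.1 := by
  obtain ⟨C, hC, hA⟩ := h.nrm_A_le
  have hA' : ∀ j, (fun q : Σ n, Ω n => nrm fun i => M.A q.1 i j) =O[whp μ] fun _ => (1 : ℝ) := by
    intro j
    refine IsBigO.of_bound C ((eventually_whp_fst hA).mono fun q hq => ?_)
    rw [norm_one, mul_one, Real.norm_of_nonneg (nrm_nonneg _)]
    exact hq j
  have hmul : ∀ {g k : ∀ q : Σ n, Ω n, Fin q.1 → ℝ},
      (fun q => nrm (g q)) =o[whp μ] (fun _ => (1 : ℝ)) →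
      (fun q => nrm (k q)) =O[whp μ] (fun _ => (1 : ℝ)) →
      (fun q => En fun i => g q i * k q i) =o[whp μ] fun _ => (1 : ℝ) := by
    intro g k hg hk
    refine IsBigO.trans_isLittleO (IsBigO.of_bound 1 (Eventually.of_forall fun q => ?_))
      (by simpa using hg.mul_isBigO hk : (fun q => nrm (g q) * nrm (k q)) =o[whp μ] _)
    rw [one_mul, Real.norm_eq_abs]
    exact (abs_En_mul_le _ _).trans (le_abs_self _)
  have hΔ' := (isLittleO_one_iff ℝ).2 hΔ
  refine ⟨fun j k => ?_, fun j k => ?_⟩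
  · refine IsBigO.of_bound (C * C) ((eventually_whp_fst hA).mono fun q hq => ?_)
    rw [norm_one, mul_one, Real.norm_eq_abs]
    refine (abs_En_mul_le _ _).trans ?_
    have := nrm_nonneg fun i => M.A q.1 i k
    gcongr
    · exact hq j
    · exact hq k
  · have h1 : ∀ q : Σ n, Ω n, (En fun i => (M.A q.1 i j + e j * Δ q i) *
        (M.A q.1 i k + e k * η q i)) - M.Q q.1 j k = e k * (En fun i => M.A q.1 i j * η q i) +
        e j * (En fun i => Δ q i * M.A q.1 i k) + e j * e k * (En fun i => Δ q i * η q i) := by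
      intro q
      rw [← En_const_mul, ← En_const_mul, ← En_const_mul, ← En_add, ← En_add]
      have h2 : M.Q q.1 j k = En fun i => M.A q.1 i j * M.A q.1 i k := rfl
      rw [h2, ← En_sub]
      exact congrArg En (funext fun i => by ring)
    simp only [Matrix.of_apply, h1]
    exact ((((isLittleO_one_iff ℝ).2 (hAη j)).const_mul_left _).add
      ((hmul hΔ' (hA' k)).const_mul_left _)).add ((hmul hΔ' hη).const_mul_left _)

end IVArray

namespace IVArray

variable {Ω : ℕ → Type*} [∀ n, MeasurableSpace (Ω n)] {μ : ∀ n, Measure (Ω n)} {kw : ℕ}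
  {M : IVArray μ kw} {s : ℕ → ℕ} {c : ℝ} {γ : ℕ → ℝ} {β : ∀ n, Ω n → Fin (M.p n) → ℝ}

/-! #### Negligibility of the instrument error -/

lemma instrError_eq (n : ℕ) (b β₀ : Fin (M.p n) → ℝ) (i : Fin n) :
    M.instrError n b i =
      fit (M.x n) (b - β₀) i - (M.f n (M.z n i) - fit (M.x n) β₀ i) := by
  rw [fit_sub, instrError]
  ring

lemma FeasibleFirstStage.tendsto_nrm (h : M.ASIV s) (hγ : M.ConfidenceLevel γ) (hc : 1 < c)
    (hβ : M.FeasibleFirstStage c γ β) :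
    Tendsto (fun q : Σ n, Ω n => nrm (M.instrError q.1 (β q.1 q.2))) (whp μ) (𝓝 0) := by
  obtain ⟨β₀, B, hB, hD, hgood⟩ := hβ.exists_good h hγ hc
  obtain ⟨K, hK, hr⟩ := hD.nrm_r_le
  have h1 : Tendsto (fun q : Σ n, Ω n => (B + K) * rate M.p s q.1) (whp μ) (𝓝 0) := by
    simpa using (hD.tendsto_rate.comp (tendsto_fst_whp (μ := μ))).const_mul (B + K)
  refine squeeze_zero' (Eventually.of_forall fun q => nrm_nonneg _) ?_ h1
  filter_upwards [hgood, eventually_whp_fst hr] with q h2 h3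
  have h4 : M.instrError q.1 (β q.1 q.2) = fun i => fit (M.x q.1) (β q.1 q.2 - β₀ q.1) i -
      (M.f q.1 (M.z q.1 i) - fit (M.x q.1) (β₀ q.1) i) :=
    funext fun i => instrError_eq _ _ _ i
  rw [h4, add_mul]
  exact (nrm_sub_le _ _).trans (add_le_add h2.nrm_le h3)

/-- The effect of estimating the instrument on the score is negligible: the sparse part of the error
is controlled by Hölder's inequality with the bound `√(n log (p ∨ n))` for the score and the bound
`√s · √(s log (p ∨ n) / n)` for the `ℓ¹` norm, the approximation error is fixed. -/
lemma FeasibleFirstStage.tendsto_score (h : M.ASIV s) (hγ : M.ConfidenceLevel γ) (hc : 1 < c)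
    (hβ : M.FeasibleFirstStage c γ β) :
    Tendsto (fun q : Σ n, Ω n => √q.1 * En fun i => M.instrError q.1 (β q.1 q.2) i *
      M.ζ q.1 i q.2) (whp μ) (𝓝 0) := by
  obtain ⟨β₀, B, hB, hD, hgood⟩ := hβ.exists_good h hγ hc
  obtain ⟨K, hK, hr⟩ := hD.nrm_r_le
  obtain ⟨D, hD0, hl1⟩ := hD.l1Norm_le_of_good hB
  have hΛ := (h.regularDesign hγ).penaltyLevel_lam
  obtain ⟨C, hC, hup⟩ := hΛ.upper
  obtain ⟨a, b, ha, hb, hab⟩ := h.noise_ζ.bounds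
  have h1 : Tendsto (fun n => nrm fun i => M.f n (M.z n i) - fit (M.x n) (β₀ n) i) atTop (𝓝 0) :=
    squeeze_zero' (Eventually.of_forall fun n => nrm_nonneg _) hr
      (by simpa using hD.tendsto_rate.const_mul K)
  have h2 := h.noise_ζ.tendsto_average h1
  have h3 : Tendsto (fun q : Σ n, Ω n => √q.1 * En fun i => M.ζ q.1 i q.2 *
      fit (M.x q.1) (β q.1 q.2 - β₀ q.1) i) (whp μ) (𝓝 0) := by
    have h4 : Tendsto (fun q : Σ n, Ω n => 2 * b * C * D * (s q.1 * logMax M.p q.1 / √q.1))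
        (whp μ) (𝓝 0) := by
      simpa using (hD.tendsto_sq_mul_logMax.comp (tendsto_fst_whp (μ := μ))).const_mul
        (2 * b * C * D)
    refine squeeze_zero_norm' ?_ h4
    filter_upwards [hgood, eventually_whp_fst hl1, eventually_whp_fst hup, eventually_whp_fst hab,
      h.noise_ζ.score_le hΛ one_pos, eventually_whp_fst (eventually_ge_atTop 1)]
      with q h5 h6 h7 h8 h9 h10
    have hn : (0 : ℝ) < q.1 := by exact_mod_cast h10
    have hL := logMax_nonneg M.p h10
    have h11 : scoreMax (M.x q.1) (fun i => M.ζ q.1 i q.2) ≤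
        2 * (b * (C * √(q.1 * logMax M.p q.1))) := by
      refine h9.trans ?_
      have h12 : M.σζ q.1 * Lam (M.x q.1) (γ q.1) ≤ b * (C * √(q.1 * logMax M.p q.1)) := by
        have : M.σζ q.1 * Lam (M.x q.1) (γ q.1) ≤ M.σζ q.1 * (C * √(q.1 * logMax M.p q.1)) := by
          have := ha.le.trans h8.1
          gcongr
        refine this.trans ?_
        gcongr
        exact h8.2
      linarith
    rw [Real.norm_eq_abs, abs_mul, abs_of_nonneg (Real.sqrt_nonneg _)]
    calc √(q.1 : ℝ) * |En fun i => M.ζ q.1 i q.2 * fit (M.x q.1) (β q.1 q.2 - β₀ q.1) i|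
        ≤ √(q.1 : ℝ) * (2 * (b * (C * √(q.1 * logMax M.p q.1))) / q.1 *
          (D * (√(s q.1) * rate M.p s q.1))) := by
          gcongr
          refine (abs_En_mul_fit_le _ _ _).trans ?_
          gcongr
          · exact Finset.sum_nonneg fun j _ => abs_nonneg _
          · exact h6 _ h5
      _ = 2 * b * C * D * (s q.1 * logMax M.p q.1 / √q.1) := by
          rw [rate, Real.sqrt_mul hn.le, Real.sqrt_div (by positivity),
            Real.sqrt_mul (Nat.cast_nonneg _)]
          have e1 := Real.sq_sqrt hn.le
          have e2 := Real.sq_sqrt hL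
          have e3 := Real.sq_sqrt (Nat.cast_nonneg (α := ℝ) (s q.1))
          have hn' : 0 < √(q.1 : ℝ) := Real.sqrt_pos.2 hn
          set u := √(q.1 : ℝ)
          set w := √(logMax M.p q.1)
          set t := √(s q.1 : ℝ)
          rw [← e1, ← e2, ← e3]
          field_simp
  have h4 := h3.sub h2
  rw [sub_zero] at h4
  refine h4.congr fun q => ?_
  rw [← mul_sub, ← En_sub]
  refine congrArg (√(q.1 : ℝ) * ·) (congrArg En (funext fun i => ?_))
  rw [instrError_eq _ _ (β₀ q.1)]
  ring

lemma FeasibleFirstStage.close_Ghat (h : M.ASIV s) (hγ : M.ConfidenceLevel γ) (hc : 1 < c)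
    (hβ : M.FeasibleFirstStage c γ β) :
    Close (whp μ) (fun q => M.Ghat q.1 (β q.1 q.2) q.2) fun q => M.Q q.1 := by
  obtain ⟨C, -, hA⟩ := h.nrm_A_le
  have h1 : (fun q : Σ n, Ω n => M.Ghat q.1 (β q.1 q.2) q.2) = fun q => Matrix.of fun j k =>
      En fun i => (M.A q.1 i j + (Pi.single 0 1 : Fin (kw + 1) → ℝ) j *
        M.instrError q.1 (β q.1 q.2) i) * (M.A q.1 i k +
        (Pi.single 0 1 : Fin (kw + 1) → ℝ) k * M.v q.1 i q.2) := by
    funext q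
    simp only [Ghat, Ahat_apply, d_apply]
  rw [h1]
  exact h.close_moments (Δ := fun q => M.instrError q.1 (β q.1 q.2))
    (η := fun q i => M.v q.1 i q.2) (hβ.tendsto_nrm h hγ hc) h.noise_v.isBigO_nrm
    (fun j => h.noise_v.tendsto_En (a := fun n i => M.A n i j) (hA.mono fun n hn => hn j))
    (Pi.single 0 1)

lemma FeasibleFirstStage.close_Qhat (h : M.ASIV s) (hγ : M.ConfidenceLevel γ) (hc : 1 < c)
    (hβ : M.FeasibleFirstStage c γ β) :
    Close (whp μ) (fun q => M.Qhat q.1 (β q.1 q.2)) fun q => M.Q q.1 := by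
  obtain ⟨C, hC, hA⟩ := h.nrm_A_le
  have hΔ := hβ.tendsto_nrm h hγ hc
  have hAΔ : ∀ j, Tendsto (fun q : Σ n, Ω n => En fun i => M.A q.1 i j *
      M.instrError q.1 (β q.1 q.2) i) (whp μ) (𝓝 0) := by
    intro j
    refine squeeze_zero_norm' ?_ (by simpa using hΔ.const_mul C)
    filter_upwards [eventually_whp_fst hA] with q hq
    refine (abs_En_mul_le _ _).trans ?_
    have := nrm_nonneg (M.instrError q.1 (β q.1 q.2))
    gcongr
    exact hq j
  have h1 : (fun q : Σ n, Ω n => M.Qhat q.1 (β q.1 q.2)) = fun q => Matrix.of fun j k =>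
      En fun i => (M.A q.1 i j + (Pi.single 0 1 : Fin (kw + 1) → ℝ) j *
        M.instrError q.1 (β q.1 q.2) i) * (M.A q.1 i k +
        (Pi.single 0 1 : Fin (kw + 1) → ℝ) k * M.instrError q.1 (β q.1 q.2) i) := by
    funext q
    simp only [Qhat, gram, Ahat_apply]
  rw [h1]
  exact h.close_moments (Δ := fun q => M.instrError q.1 (β q.1 q.2))
    (η := fun q => M.instrError q.1 (β q.1 q.2)) hΔ ((isLittleO_one_iff ℝ).2 hΔ).isBigO hAΔ
    (Pi.single 0 1)

/-! #### The limit law -/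

/-- `(σζ² Qₙ⁻¹)^{-1/2}`. -/
def standardizer (M : IVArray μ kw) (n : ℕ) : Matrix (Fin (kw + 1)) (Fin (kw + 1)) ℝ :=
  invSqrt (M.σζ n ^ 2 • (M.Q n)⁻¹)

lemma ASIV.formGE_Q (h : M.ASIV s) : ∃ a b : ℝ, 0 < a ∧ 0 < b ∧ ∀ᶠ n in atTop,
    FormGE a (M.Q n) ∧ a ≤ M.σζ n ^ 2 ∧ M.σζ n ^ 2 ≤ b := by
  obtain ⟨a, b, ha, hb, hab⟩ := h.exists_bounds
  refine ⟨min a (a ^ 2), b ^ 2, lt_min ha (by positivity), by positivity, hab.mono fun n hn => ?_⟩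
  have h1 : 0 ≤ M.σζ n := ha.le.trans hn.2.1.1
  refine ⟨fun u => ?_, (min_le_right _ _).trans (by gcongr; exact hn.2.1.1),
    by gcongr; exact hn.2.1.2⟩
  have h2 : u ⬝ᵥ (M.Q n).mulVec u = nrm (fit (M.A n) u) ^ 2 := dotProduct_gram _ _
  rw [h2]
  refine le_trans ?_ (hn.2.2 u).1
  gcongr
  exact min_le_left _ _

/-- The standardised ideal score is an orthonormal linear transform of the standardised structural
disturbances, hence exactly standard normal. -/
lemma ASIV.hasLaw_score (h : M.ASIV s) : ∀ᶠ n in atTop, HasLaw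
    (fun ω => (M.standardizer n * (M.Q n)⁻¹).mulVec (M.score n ω)) (stdNormal (kw + 1)) (μ n) := by
  obtain ⟨a, b, ha, hb, hab⟩ := h.formGE_Q
  filter_upwards [hab, h.noise_ζ.law, h.noise_ζ.sigma_pos, eventually_ge_atTop 1]
    with n h1 h2 hσ hn
  set T := M.standardizer n
  set σ := M.σζ n
  have hn0 : (0 : ℝ) < n := by exact_mod_cast hn
  have hσ2 : 0 < σ ^ 2 := by positivity
  have hT : IsPosSqrt √(a / σ ^ 2) ((σ ^ 2)⁻¹ • M.Q n) T :=
    isPosSqrt_invSqrt ha hσ2 (isSelfAdjoint_gram _) h1.1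
  have hTu := hT.formGE.det_isUnit (by positivity)
  have hQu := h1.1.det_isUnit ha
  set N : Matrix (Fin n) (Fin (kw + 1)) ℝ := Matrix.of (M.A n)
  have hN : N.transpose * N = (n : ℝ) • M.Q n := by
    ext j k
    simp only [Matrix.mul_apply, Matrix.transpose_apply, Matrix.smul_apply, smul_eq_mul]
    have : M.Q n j k = (∑ i, N i j * N i k) / n := rfl
    rw [this]
    field_simp
  set W := (σ / √n) • (T * (M.Q n)⁻¹ * N.transpose) with hW
  have hQt : (M.Q n)⁻¹.transpose = (M.Q n)⁻¹ := by
    rw [Matrix.transpose_nonsing_inv]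
    congr 1
    ext j k
    simp [Q, gram, mul_comm]
  have hWW : W * W.transpose = 1 := by
    have e1 : (M.Q n)⁻¹ * (T * T) = (σ ^ 2)⁻¹ • 1 := by
      rw [hT.mul_self, Matrix.mul_smul, Matrix.nonsing_inv_mul _ hQu]
    have e2 : T * (M.Q n)⁻¹ * T = (σ ^ 2)⁻¹ • 1 := by
      calc T * (M.Q n)⁻¹ * T = T * ((M.Q n)⁻¹ * (T * T)) * T⁻¹ := by
            rw [Matrix.mul_assoc, Matrix.mul_assoc, Matrix.mul_assoc, Matrix.mul_assoc,
              Matrix.mul_nonsing_inv _ hTu, Matrix.mul_one]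
        _ = _ := by
            rw [e1, Matrix.mul_smul, Matrix.mul_one, Matrix.smul_mul, Matrix.mul_nonsing_inv _ hTu]
    rw [hW, Matrix.transpose_smul, Matrix.transpose_mul, Matrix.transpose_mul,
      Matrix.transpose_transpose, hT.transpose_eq, hQt, Matrix.smul_mul, Matrix.mul_smul, smul_smul]
    have e3 : T * (M.Q n)⁻¹ * N.transpose * (N * ((M.Q n)⁻¹ * T)) =
        (n : ℝ) • (T * (M.Q n)⁻¹ * T) := by
      calc _ = T * (M.Q n)⁻¹ * (N.transpose * N) * ((M.Q n)⁻¹ * T) := by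
            simp only [Matrix.mul_assoc]
        _ = (n : ℝ) • (T * ((M.Q n)⁻¹ * M.Q n) * ((M.Q n)⁻¹ * T)) := by
            rw [hN, Matrix.mul_smul, Matrix.smul_mul, Matrix.mul_assoc T]
        _ = _ := by
            rw [Matrix.nonsing_inv_mul _ hQu, Matrix.mul_one, Matrix.mul_assoc]
    rw [e3, e2, smul_smul, smul_smul]
    have e4 : σ / √n * (σ / √n) * (n * (σ ^ 2)⁻¹) = 1 := by
      rw [div_mul_div_comm, Real.mul_self_sqrt hn0.le]
      field_simp
    rw [mul_assoc (σ / √n * (σ / √n)), e4, one_smul]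
  have h3 := (hasLaw_mulVec hWW).comp h2
  refine h3.congr (Eventually.of_forall fun ω => ?_)
  have e5 : M.score n ω = (σ / √n) • N.transpose.mulVec fun i => M.ζ n i ω / σ := by
    funext j
    have : M.score n ω j = _ := sqrt_mul_En hn hσ.ne' (fun i => M.A n i j) fun i => M.ζ n i ω
    rw [this]
    simp only [Pi.smul_apply, smul_eq_mul, Matrix.mulVec, dotProduct, Matrix.transpose_apply,
      Finset.mul_sum]
    exact Finset.sum_congr rfl fun i _ => by
      have : N i j = M.A n i j := rfl
      rw [this]
      ring
  simp only [Function.comp]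
  rw [e5, hW, Matrix.smul_mulVec]
  simp only [Matrix.mulVec_smul, Matrix.mulVec_mulVec, Matrix.mul_assoc]

lemma ASIV.isBigOP_score (h : M.ASIV s) (j : Fin (kw + 1)) :
    IsBigOP μ fun n ω => M.score n ω j := by
  obtain ⟨C, -, hA⟩ := h.nrm_A_le
  exact h.noise_ζ.isBigOP_average (a := fun n i => M.A n i j) (hA.mono fun n hn => hn j)

lemma ASIV.isBigOP_inv_mulVec_score (h : M.ASIV s) (j : Fin (kw + 1)) :
    IsBigOP μ fun n ω => (M.Q n)⁻¹.mulVec (M.score n ω) j := by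
  obtain ⟨C, hC, hA⟩ := h.nrm_A_le
  obtain ⟨a, b, ha, hb, hab⟩ := h.formGE_Q
  have h1 : ∀ n ω, (M.Q n)⁻¹.mulVec (M.score n ω) j =
      √n * En fun i => fit (M.A n) (fun k => (M.Q n)⁻¹ j k) i * M.ζ n i ω := by
    intro n ω
    simp only [mul_comm (fit _ _ _), En_mul_fit]
    simp only [Matrix.mulVec, dotProduct, score, Finset.mul_sum]
    exact Finset.sum_congr rfl fun k _ => by ring
  simp only [h1]
  refine h.noise_ζ.isBigOP_average (C := ∑ _ : Fin (kw + 1), 1 / a * C) ?_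
  filter_upwards [hA, hab] with n h2 h3
  have h4 := nrm_sum_le Finset.univ fun k i => (M.Q n)⁻¹ j k * M.A n i k
  simp only [nrm_const_mul] at h4
  have h5 : fit (M.A n) (fun k => (M.Q n)⁻¹ j k) = fun i => ∑ k, (M.Q n)⁻¹ j k * M.A n i k := by
    funext i
    exact Finset.sum_congr rfl fun k _ => mul_comm _ _
  rw [h5]
  refine h4.trans (Finset.sum_le_sum fun k _ => ?_)
  have := nrm_nonneg fun i => M.A n i k
  gcongr
  · exact h3.1.abs_inv_le ha j k
  · exact h2 k

lemma FeasibleFirstStage.close_inv (h : M.ASIV s) (hγ : M.ConfidenceLevel γ) (hc : 1 < c)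
    (hβ : M.FeasibleFirstStage c γ β) :
    Close (whp μ) (fun q => (M.Ghat q.1 (β q.1 q.2) q.2)⁻¹) fun q => (M.Q q.1)⁻¹ := by
  obtain ⟨a, b, ha, hb, hab⟩ := h.formGE_Q
  exact (hβ.close_Ghat h hγ hc).inv ha (eventually_whp_fst (hab.mono fun n hn => hn.1))

lemma FeasibleFirstStage.eventually_sqrt_smul (h : M.ASIV s) (hγ : M.ConfidenceLevel γ)
    (hc : 1 < c) (hβ : M.FeasibleFirstStage c γ β) : ∀ᶠ q : Σ n, Ω n in whp μ,
      √(q.1 : ℝ) • (M.αhat q.1 (β q.1 q.2) q.2 - M.α q.1) =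
        (M.Ghat q.1 (β q.1 q.2) q.2)⁻¹.mulVec
          (M.score q.1 q.2 + M.scoreError q.1 (β q.1 q.2) q.2) := by
  obtain ⟨a, b, ha, hb, hab⟩ := h.formGE_Q
  filter_upwards [(hβ.close_Ghat h hγ hc).formGE ha
    (eventually_whp_fst (hab.mono fun n hn => hn.1))] with q hq
  exact sqrt_smul_αhat_sub (hq.det_isUnit (half_pos ha))

lemma FeasibleFirstStage.tendsto_scoreError (h : M.ASIV s) (hγ : M.ConfidenceLevel γ) (hc : 1 < c)
    (hβ : M.FeasibleFirstStage c γ β) (j : Fin (kw + 1)) :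
    Tendsto (fun q : Σ n, Ω n => M.scoreError q.1 (β q.1 q.2) q.2 j) (whp μ) (𝓝 0) := by
  simpa [scoreError] using (hβ.tendsto_score h hγ hc).const_mul
    ((Pi.single 0 1 : Fin (kw + 1) → ℝ) j)

lemma FeasibleFirstStage.isBigOP (h : M.ASIV s) (hγ : M.ConfidenceLevel γ) (hc : 1 < c)
    (hβ : M.FeasibleFirstStage c γ β) :
    IsBigOP μ fun n ω => √(n : ℝ) • (M.αhat n (β n ω) ω - M.α n) := by
  have h1 := (hβ.close_inv h hγ hc).tendsto_mulVec_sub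
    (R := fun n ω => M.scoreError n (β n ω) ω) h.isBigOP_score (hβ.tendsto_scoreError h hγ hc)
  have h2 : Tendsto (fun q : Σ n, Ω n =>
      √(q.1 : ℝ) • (M.αhat q.1 (β q.1 q.2) q.2 - M.α q.1) -
        (M.Q q.1)⁻¹.mulVec (M.score q.1 q.2)) (whp μ) (𝓝 0) := by
    refine h1.congr' ?_
    filter_upwards [hβ.eventually_sqrt_smul h hγ hc] with q hq
    rw [hq]
  rw [tendsto_pi_nhds] at h2
  refine isBigOP_pi fun j => ?_
  have h3 := (h.isBigOP_inv_mulVec_score j).add_tendsto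
    (Y := fun n ω => (√(n : ℝ) • (M.αhat n (β n ω) ω - M.α n) -
      (M.Q n)⁻¹.mulVec (M.score n ω)) j) (h2 j)
  simpa using h3

/-- Standardising by matrices that approach the ideal ones gives the same standard normal
approximation. -/
lemma FeasibleFirstStage.isStdNormalPlusOP (h : M.ASIV s) (hγ : M.ConfidenceLevel γ) (hc : 1 < c)
    (hβ : M.FeasibleFirstStage c γ β)
    {T : ∀ n, Ω n → Matrix (Fin (kw + 1)) (Fin (kw + 1)) ℝ}
    (hT : Close (whp μ) (fun q => T q.1 q.2) fun q => M.standardizer q.1) :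
    IsStdNormalPlusOP μ fun n ω => (T n ω).mulVec
      (√(n : ℝ) • (M.αhat n (β n ω) ω - M.α n)) := by
  refine ⟨_, h.hasLaw_score, ?_⟩
  rw [isLittleOP_iff_tendsto]
  refine ((hT.mul (hβ.close_inv h hγ hc)).tendsto_mulVec_sub
    (R := fun n ω => M.scoreError n (β n ω) ω) h.isBigOP_score
    (hβ.tendsto_scoreError h hγ hc)).congr' ?_
  filter_upwards [hβ.eventually_sqrt_smul h hγ hc] with q hq
  rw [hq, Matrix.mulVec_mulVec]

lemma FeasibleFirstStage.tendsto_αhat_sub (h : M.ASIV s) (hγ : M.ConfidenceLevel γ) (hc : 1 < c)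
    (hβ : M.FeasibleFirstStage c γ β) (k : Fin (kw + 1)) :
    Tendsto (fun q : Σ n, Ω n => (M.αhat q.1 (β q.1 q.2) q.2 - M.α q.1) k) (whp μ) (𝓝 0) := by
  have h1 : Tendsto (fun q : Σ n, Ω n => (√(q.1 : ℝ))⁻¹) (whp μ) (𝓝 0) :=
    ((Real.tendsto_sqrt_atTop.comp tendsto_natCast_atTop_atTop).inv_tendsto_atTop).comp
      tendsto_fst_whp
  have h2 : IsBigOP μ fun n ω => (√(n : ℝ) • (M.αhat n (β n ω) ω - M.α n)) k := by
    intro ε hε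
    obtain ⟨C, hC⟩ := hβ.isBigOP h hγ hc ε hε
    refine ⟨C, hC.mono fun n hn => le_trans (measure_mono fun ω hω => ?_) hn⟩
    exact lt_of_lt_of_le hω
      (norm_le_pi_norm (√(n : ℝ) • (M.αhat n (β n ω) ω - M.α n)) k)
  refine (tendsto_whp_mul_of_isBigOP (X := fun n _ => (√(n : ℝ))⁻¹) h1 h2).congr' ?_
  filter_upwards [eventually_whp_fst (eventually_ge_atTop 1)] with q hq
  have : (0 : ℝ) < √q.1 := Real.sqrt_pos.2 (by exact_mod_cast hq)
  rw [Pi.smul_apply, smul_eq_mul, ← mul_assoc, inv_mul_cancel₀ this.ne', one_mul]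

lemma FeasibleFirstStage.tendsto_σζsqHat (h : M.ASIV s) (hγ : M.ConfidenceLevel γ) (hc : 1 < c)
    (hβ : M.FeasibleFirstStage c γ β) :
    Tendsto (fun q : Σ n, Ω n => M.σζsqHat q.1 (β q.1 q.2) q.2 - M.σζ q.1 ^ 2) (whp μ) (𝓝 0) := by
  obtain ⟨C, hC, hA⟩ := h.nrm_A_le
  obtain ⟨a, b, ha, hb, hab⟩ := h.noise_ζ.bounds
  set e : Fin (kw + 1) → ℝ := Pi.single 0 1 with he
  set η : (Σ n, Ω n) → ℝ := fun q => nrm fun i =>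
    M.y₁ q.1 q.2 i - ∑ k, M.d q.1 q.2 i k * M.αhat q.1 (β q.1 q.2) q.2 k with hη
  have hd : ∀ k, (fun q : Σ n, Ω n => nrm fun i => M.d q.1 q.2 i k) =O[whp μ]
      fun _ => (1 : ℝ) := by
    intro k
    have h1 : (fun q : Σ n, Ω n => C + |e k| * nrm fun i => M.v q.1 i q.2) =O[whp μ]
        fun _ => (1 : ℝ) :=
      (isBigO_const_const _ one_ne_zero _).add (h.noise_v.isBigO_nrm.const_mul_left _)
    refine IsBigO.trans (IsBigO.of_bound 1 ?_) h1
    filter_upwards [eventually_whp_fst hA] with q hq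
    rw [one_mul, Real.norm_of_nonneg (nrm_nonneg _)]
    refine le_trans ?_ (le_abs_self _)
    simp only [d_apply]
    refine (nrm_add_le _ _).trans ?_
    rw [nrm_const_mul]
    gcongr
    exact hq k
  have h1 : Tendsto (fun q => η q - nrm fun i => M.ζ q.1 i q.2) (whp μ) (𝓝 0) := by
    have h2 : Tendsto (fun q : Σ n, Ω n => ∑ k, |(M.αhat q.1 (β q.1 q.2) q.2 - M.α q.1) k| *
        nrm fun i => M.d q.1 q.2 i k) (whp μ) (𝓝 0) := by
      rw [← isLittleO_one_iff ℝ]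
      refine IsLittleO.fun_sum fun k _ => ?_
      have := ((isLittleO_one_iff ℝ).2 (hβ.tendsto_αhat_sub h hγ hc k)).abs_left.mul_isBigO (hd k)
      simpa using this
    refine squeeze_zero_norm (fun q => ?_) h2
    refine (abs_nrm_sub_nrm_le _ _).trans ?_
    have h3 : (fun i => M.y₁ q.1 q.2 i - ∑ k, M.d q.1 q.2 i k * M.αhat q.1 (β q.1 q.2) q.2 k -
        M.ζ q.1 i q.2) = fun i => ∑ k, -(M.αhat q.1 (β q.1 q.2) q.2 - M.α q.1) k *
          M.d q.1 q.2 i k := by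
      funext i
      rw [y₁_eq, add_sub_right_comm, add_sub_cancel_right, ← Finset.sum_sub_distrib]
      exact Finset.sum_congr rfl fun k _ => by rw [Pi.sub_apply]; ring
    rw [h3]
    refine (nrm_sum_le _ _).trans_eq ?_
    simp only [nrm_const_mul, abs_neg]
  have h2 : Tendsto (fun q : Σ n, Ω n => η q - M.σζ q.1) (whp μ) (𝓝 0) := by
    simpa using h1.add h.noise_ζ.tendsto_nrm
  have h3 : (fun q : Σ n, Ω n => M.σζ q.1) =O[whp μ] fun _ => (1 : ℝ) := by
    refine IsBigO.of_bound b ((eventually_whp_fst hab).mono fun q hq => ?_)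
    rw [norm_one, mul_one, Real.norm_of_nonneg (ha.le.trans hq.1)]
    exact hq.2
  have h4 : (fun q : Σ n, Ω n => η q - M.σζ q.1) =o[whp μ] fun _ => (1 : ℝ) :=
    (isLittleO_one_iff ℝ).2 h2
  have h5 := h4.mul_isBigO (h4.isBigO.add (h3.const_mul_left 2))
  rw [← isLittleO_one_iff ℝ]
  refine (by simpa using h5 : _ =o[whp μ] fun _ => (1 : ℝ)).congr_left fun q => ?_
  have h6 : M.σζsqHat q.1 (β q.1 q.2) q.2 = η q ^ 2 := (nrm_sq _).symm
  rw [h6]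
  ring

/-- The standardising matrices built from the estimated instruments and residuals. -/
lemma FeasibleFirstStage.close_standardizer (h : M.ASIV s) (hγ : M.ConfidenceLevel γ) (hc : 1 < c)
    (hβ : M.FeasibleFirstStage c γ β) :
    Close (whp μ) (fun q => invSqrt (M.σζsqHat q.1 (β q.1 q.2) q.2 • (M.Qhat q.1 (β q.1 q.2))⁻¹))
      fun q => M.standardizer q.1 := by
  obtain ⟨a, b, ha, hb, hab⟩ := h.formGE_Q
  exact (hβ.close_Qhat h hγ hc).invSqrt ha hb (eventually_whp_fst (hab.mono fun n hn => hn.1))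
    (Eventually.of_forall fun q => isSelfAdjoint_gram _)
    (Eventually.of_forall fun q => isSelfAdjoint_gram _)
    (eventually_whp_fst (hab.mono fun n hn => hn.2)) (hβ.tendsto_σζsqHat h hγ hc)

end IVArray

end

end LassoIV

open LassoIV in
theorem theorem3 {Ω : ℕ → Type*} [∀ n, MeasurableSpace (Ω n)] (μ : ∀ n, Measure (Ω n))
    [∀ n, IsProbabilityMeasure (μ n)] (kw : ℕ) (M : IVArray μ kw)
    (s : ℕ → ℕ) (hASIV : M.ASIV s)
    (c : ℝ) (hc : 1 < c) (γ : ℕ → ℝ) (hγ : M.ConfidenceLevel γ)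
    (β : ∀ n, Ω n → Fin (M.p n) → ℝ) (hβ : M.FeasibleFirstStage c γ β) :
    IsBigOP μ (fun n ω => √(n : ℝ) • (M.αhat n (β n ω) ω - M.α n)) ∧
    IsStdNormalPlusOP μ (fun n ω =>
      (invSqrt (M.σζ n ^ 2 • (M.Q n)⁻¹)).mulVec
        (√(n : ℝ) • (M.αhat n (β n ω) ω - M.α n))) ∧
    IsStdNormalPlusOP μ (fun n ω =>
      (invSqrt (M.σζsqHat n (β n ω) ω • (M.Qhat n (β n ω))⁻¹)).mulVec
        (√(n : ℝ) • (M.αhat n (β n ω) ω - M.α n))) := by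
  have h1 := hβ.close_standardizer hASIV hγ hc
  exact ⟨hβ.isBigOP hASIV hγ hc,
    hβ.isStdNormalPlusOP hASIV hγ hc (T := fun n _ => M.standardizer n) (Close.refl h1.bounded),
    hβ.isStdNormalPlusOP hASIV hγ hc h1⟩
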